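/- All hypergraphs are finite, undirected and loopless: a hypergraph $H$ consists of a finite vertex set $V(H)$, a finite edge set $E(H)$ and an incidence function $i_H$ that assigns to each edge a set of at least two vertices; parallel edges ($e\ne e'$ with $i_H(e)=i_H(e')$) are allowed, and $H$ is simple if it has none. Write $|H|=|V(H)|$, $d_H(v)$ for the number of edges incident with $v$, $\delta(H)=\min_v d_H(v)$ (and $0$ if $H$ is empty), and $d(H)=\sum_{v\in V(H)}d_H(v)$. For $X\subseteq V(H)$, $H[X]$ is the subhypergraph induced by $X$ (edges $e$ with $i_H(e)\subseteq X$), $H-v=H[V(H)\setminus\{v\}]$, and $H(X)$ is the hypergraph with vertex set $X$, edges those $e\in E(H)$ with $|i_H(e)\cap X|\ge 2$, and incidence $e\mapsto i_H(e)\cap X$. Let $\mathcal P$ be a hypergraph property, i.e. an isomorphism-closed class of hypergraphs, that is smooth (closed under induced subhypergraphs, containing a non-empty hypergraph but not all hypergraphs) and additive (closed under vertex-disjoint unions). Let $\mathcal F(\mathcal P)$ be the class of hypergraphs $H\notin\mathcal P$ with $H-v\in\mathcal P$ for all $v\in V(H)$, and let $d(\mathcal P)=\min\{\delta(H): H\in\mathcal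 F(\mathcal P)\}$. For a list-assignment $L$ (a set $L(v)$ of colors for each vertex $v$), $H$ is $(\mathcal P,L)$-colorable if there is a map $\varphi$ on $V(H)$ with $\varphi(v)\in L(v)$ for all $v$ such that $H[\varphi^{-1}(c)]\in\mathcal P$ for each color $c$; and $H$ is $(\mathcal P,L)$-critical if $H$ is not $(\mathcal P,L)$-colorable but $H-v$ is, for every $v\in V(H)$. The number $\chi^\ell(H:\mathcal P)$ is the least integer $m$ such that $H$ is $(\mathcal P,L)$-colorable for all $L$ with $|L(v)|\ge m$ for all $v$. $H$ is $(\chi^\ell,\mathcal P)$-critical if $\chi^\ell(G:\mathcal P)<\chi^\ell(H:\mathcal P)$ for each proper induced subhypergraph $G$ of $H$. A $(\chi^\ell,\mathcal P)$-critical hypergraph $H$ with $\chi^\ell(H:\mathcal P)=k+1$ is locally linear with respect to $(\chi^\ell,\mathcal P)$ if there is a list-assignment $L$ with $|L(v)|=k$ for all $v$ such that $H$ is $(\mathcal P,L)$-critical and $H(U)$ is simple, where $U=\{v\in V(H): d_H(v)=d(\mathcal P)\,|L(v)|\}$. **Corollary.** Let $\mathcal P$ be a smooth additive hypergraph property with $d(\mathcal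 P)=r\ge 1$, let $k\ge 2$, and let $\delta=kr\ge 3$. Let $H$ be a $(\chi^\ell,\mathcal P)$-critical hypergraph with $\chi^\ell(H:\mathcal P)=k+1$ that is locally linear with respect to $(\chi^\ell,\mathcal P)$ and is not (isomorphic to) the complete graph $K_{\delta+1}$. Then $$d(H)\ \ge\ a(\delta,|H|),\qquad\text{where } a(\delta,n)=\delta n+\frac{\delta-2}{\delta^2+2\delta-2}\,n .$$ -/

import Mathlib

/-- A finite, undirected, loopless hypergraph in which parallel edges are allowed: finite vertex
and edge types and an incidence function which sends every edge to a set of at least two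
vertices. -/
structure FinHypergraph : Type 1 where
  V : Type
  E : Type
  finV : Finite V
  finE : Finite E
  inc : E → Set V
  two_le_inc : ∀ e, 2 ≤ (inc e).ncard

attribute [instance] FinHypergraph.finV FinHypergraph.finE

namespace FinHypergraph

/-- Isomorphisms of hypergraphs. -/
structure Iso (G H : FinHypergraph) where
  toV : G.V ≃ H.V
  toE : G.E ≃ H.E
  inc_map : ∀ e, H.inc (toE e) = toV '' G.inc e

/-- The order `|H|`. -/
noncomputable def order (H : FinHypergraph) : ℕ := Nat.card H.V

/-- The degree `d_H(v)`: the number of edges which contain `v`. -/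
noncomputable def deg (H : FinHypergraph) (v : H.V) : ℕ := {e : H.E | v ∈ H.inc e}.ncard

/-- The degree sum `d(H)` over all vertices. -/
noncomputable def degSum (H : FinHypergraph) : ℕ := ∑ᶠ v : H.V, H.deg v

/-- The minimum degree `δ(H)`; it is `0` for the empty hypergraph, since `sInf ∅ = 0` in `ℕ`. -/
noncomputable def minDeg (H : FinHypergraph) : ℕ := sInf (Set.range H.deg)

/-- A hypergraph is simple if it has no parallel edges. -/
def IsSimple (H : FinHypergraph) : Prop := Function.Injective H.inc

theorem ncard_val_preimage {α : Type} (X s : Set α) :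
    ((Subtype.val : X → α) ⁻¹' s).ncard = (s ∩ X).ncard := by
  rw [← Set.ncard_image_of_injective _ Subtype.val_injective, Subtype.image_preimage_coe,
    Set.inter_comm]

/-- The subhypergraph `H[X]` induced by `X`: its edges are the edges of `H` contained in `X`. -/
def induce (H : FinHypergraph) (X : Set H.V) : FinHypergraph where
  V := X
  E := {e : H.E // H.inc e ⊆ X}
  finV := inferInstance
  finE := inferInstance
  inc e := Subtype.val ⁻¹' H.inc e.1
  two_le_inc e := by
    rw [ncard_val_preimage, Set.inter_eq_left.mpr e.2]
    exact H.two_le_inc e.1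

/-- The hypergraph `H(X)` obtained by shrinking `H` to `X`: every edge `e` of `H` which has at
least two vertices in `X` is replaced by `e ∩ X`, and the other edges are removed. -/
def shrink (H : FinHypergraph) (X : Set H.V) : FinHypergraph where
  V := X
  E := {e : H.E // 2 ≤ (H.inc e ∩ X).ncard}
  finV := inferInstance
  finE := inferInstance
  inc e := Subtype.val ⁻¹' H.inc e.1
  two_le_inc e := by
    rw [ncard_val_preimage]
    exact e.2

/-- The vertex-disjoint union of two hypergraphs. -/
def disjUnion (G H : FinHypergraph) : FinHypergraph where
  V := G.V ⊕ H.V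
  E := G.E ⊕ H.E
  finV := inferInstance
  finE := inferInstance
  inc := Sum.elim (fun e => Sum.inl '' G.inc e) (fun e => Sum.inr '' H.inc e)
  two_le_inc e := by
    cases e with
    | inl e =>
      simpa [Set.ncard_image_of_injective _ Sum.inl_injective] using G.two_le_inc e
    | inr e =>
      simpa [Set.ncard_image_of_injective _ Sum.inr_injective] using H.two_le_inc e

/-- The complete graph `K_n`: its edges are the two-element sets of vertices, each taken once. -/
def complete (n : ℕ) : FinHypergraph where
  V := Fin n
  E := {s : Set (Fin n) // s.ncard = 2}
  finV := inferInstance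
  finE := inferInstance
  inc e := e.1
  two_le_inc e := e.2.ge

/-- A hypergraph property is a class of hypergraphs which is closed under isomorphism. -/
def IsProperty (P : FinHypergraph → Prop) : Prop :=
  ∀ G H : FinHypergraph, Nonempty (Iso G H) → P G → P H

/-- A smooth hypergraph property is hereditary (closed under induced subhypergraphs) and
non-trivial (it contains a non-empty hypergraph, but not all hypergraphs). -/
structure IsSmooth (P : FinHypergraph → Prop) : Prop where
  isProperty : IsProperty P
  hereditary : ∀ (H : FinHypergraph) (X : Set H.V), P H → P (H.induce X)
  exists_nonempty : ∃ H : FinHypergraph, Nonempty H.V ∧ P H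
  exists_not : ∃ H : FinHypergraph, ¬ P H

/-- An additive hypergraph property is closed under vertex-disjoint unions. -/
def IsAdditive (P : FinHypergraph → Prop) : Prop :=
  ∀ G H : FinHypergraph, P G → P H → P (disjUnion G H)

/-- The class `F(P)` of the hypergraphs `H` outside `P` such that `H - v` is in `P` for every
vertex `v`. -/
def MinForbidden (P : FinHypergraph → Prop) (H : FinHypergraph) : Prop :=
  ¬ P H ∧ ∀ v : H.V, P (H.induce {v}ᶜ)

/-- `d(P)`, the smallest minimum degree of a hypergraph in `F(P)`; `F(P)` is non-empty when `P` is
smooth. -/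
noncomputable def propDeg (P : FinHypergraph → Prop) : ℕ :=
  sInf {d | ∃ H : FinHypergraph, MinForbidden P H ∧ H.minDeg = d}

/-- `H` is `(P, L)`-colorable: there is a coloring `φ` of the vertices with `φ v ∈ L v` for all
`v`, all of whose color classes induce members of `P`. -/
def ListColorable (P : FinHypergraph → Prop) (H : FinHypergraph) {C : Type}
    (L : H.V → Set C) : Prop :=
  ∃ φ : H.V → C, (∀ v, φ v ∈ L v) ∧ ∀ c : C, P (H.induce (φ ⁻¹' {c}))

/-- The `P`-list-chromatic number `χ^ℓ(H : P)`: the least `k` such that `H` is `(P, L)`-colorable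
for every list-assignment `L`, over any color set, all of whose lists have at least `k` colors.
Such `k` exist when `P` is smooth. -/
noncomputable def listChi (P : FinHypergraph → Prop) (H : FinHypergraph) : ℕ :=
  sInf {k | ∀ (C : Type) (L : H.V → Set C), (∀ v, (k : ℕ∞) ≤ (L v).encard) →
    ListColorable P H L}

/-- `H` is `(P, L)`-critical: `H` is not `(P, L)`-colorable, but `H - v` is for every `v`. -/
def ListCritical (P : FinHypergraph → Prop) (H : FinHypergraph) {C : Type}
    (L : H.V → Set C) : Prop :=
  (∀ v : H.V, ListColorable P (H.induce {v}ᶜ) (fun u => L u.1)) ∧ ¬ ListColorable P H L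

/-- `H` is `(χ^ℓ, P)`-critical: every proper induced subhypergraph has a smaller
`P`-list-chromatic number. -/
def ChiCritical (P : FinHypergraph → Prop) (H : FinHypergraph) : Prop :=
  ∀ X : Set H.V, X ≠ Set.univ → listChi P (H.induce X) < listChi P H

/-- The set `V(H, P, L)` of low vertices, those with `d_H(v) = d(P) |L(v)|`. -/
def lowVerts (P : FinHypergraph → Prop) (H : FinHypergraph) {C : Type}
    (L : H.V → Set C) : Set H.V :=
  {v | (H.deg v : ℕ∞) = (propDeg P : ℕ∞) * (L v).encard}

/-- `H` is locally linear with respect to `(P, L)`, for a list-assignment `L` with lists of constant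
size: `H` is `(P, L)`-critical and its low-vertex hypergraph is simple. -/
def LocallyLinear (P : FinHypergraph → Prop) (H : FinHypergraph) {C : Type}
    (L : H.V → Set C) : Prop :=
  ListCritical P H L ∧ (H.shrink (lowVerts P H L)).IsSimple

/-- `H` is locally linear with respect to `(χ^ℓ, P)`: it is `(χ^ℓ, P)`-critical and, with
`χ^ℓ(H : P) = k + 1`, it is locally linear with respect to `(P, L)` for some list-assignment `L`
all of whose lists have exactly `k` colors. -/
def ChiLocallyLinear (P : FinHypergraph → Prop) (H : FinHypergraph) : Prop :=
  ChiCritical P H ∧ ∃ k : ℕ, listChi P H = k + 1 ∧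
    ∃ (C : Type) (L : H.V → Set C), (∀ v, (L v).encard = k) ∧ LocallyLinear P H L

/-- The bound `a(δ, n) = δ n + (δ - 2) / (δ² + 2 δ - 2) n`, a real number. -/
noncomputable def gallaiBound (δ n : ℕ) : ℝ :=
  (δ : ℝ) * n + ((δ : ℝ) - 2) / ((δ : ℝ) ^ 2 + 2 * δ - 2) * n

end FinHypergraph

/-! ### Partitions into strictly degenerate sets with variable capacities. -/

namespace VariableDegeneracy

open Finset

/-! Write `r = d(P)` and `δ = kr`. Criticality forces every degree to be at least `δ`; let `U` be
the set of vertices of degree exactly `δ`. The heart is a Gallai-type bound: the degrees in `H(U)`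
sum to at most `β|U|`, where `β = δ - 1 + 2/δ` (`ListCritical.sum_partDeg_le`). The remaining edge
incidences at `U`, at least `(δ - β)|U|` of them, come from edges with a single vertex in `U`, so
the degree sum outside `U` is at least as large. This gives `d(H) ≥ (2δ - β)|U|`. Trivially `d(H) ≥
(δ + 1)|H| - |U|`, and eliminating `|U|` yields the claim (`gallaiBound_le`).

The property `P` enters through one fact: a set that induces no member of `P` contains a set
inducing a member of `F(P)`, whose degrees are all at least `r`. Let `T` be a component of `H(U)`,
and color the other vertices by criticality. A color `c` of `L(v)` retains at `v` the capacity `r`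
minus the number of edges at `v` whose other vertices all lie outside `T` and have color `c`. A
partition of `T` into sets strictly degenerate for these capacities would color `H`, so none exists
(`not_colorable_capacity`); yet the capacities at each vertex add up to at least its degree in
`H(T)` (`le_sum_capacity`).

Such an obstruction is rigid. In a block either a single color has capacity, which forces degrees at
most `r ≤ δ/2`, or the block is a complete graph or a cycle. For simple graphs this is
`block_structure`, by induction on deleting a colored vertex; moving an uncolored vertex around
reduces hypergraphs to that case (`hyperBlock_structure`).

The blocks are then counted by the potential `∑ (β - deg)`. Peeling off end blocks shows that it is
at least `2` unless the component is `K_{δ+1}` (`potential_bound`); `β` is the value for which `K_δ`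
has potential exactly `2`. A component `K_{δ+1}` is either all of `H`, or an edge leaving it makes
one color class cheap enough to color `H` (`ListCritical.nonempty_iso_of_complete`). -/

/-- The number of edges of the family `I` which contain `v` and lie inside `S`. -/
def degOn {V E : Type*} [DecidableEq V] [Fintype E] (I : E → Finset V) (S : Finset V) (v : V) : ℕ :=
  #{e | v ∈ I e ∧ I e ⊆ S}

/-- Strict `f`-degeneracy of the hypergraph induced on `S`. -/
def Degenerate {V E : Type*} [DecidableEq V] [Fintype E] (I : E → Finset V) (f : V → ℕ)
    (S : Finset V) : Prop :=
  ∀ Y ⊆ S, Y.Nonempty → ∃ y ∈ Y, degOn I Y y < f y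

/-- `S` can be partitioned into strictly `F c`-degenerate sets. -/
def Colorable {V E C : Type*} [DecidableEq V] [Fintype E] [DecidableEq C] (I : E → Finset V)
    (F : C → V → ℕ) (S : Finset V) : Prop :=
  ∃ φ : V → C, ∀ c, Degenerate I (F c) {v ∈ S | φ v = c}

/-- No edge inside `S` crosses the boundary of `X`. -/
def ClosedIn {V E : Type*} [DecidableEq V] (I : E → Finset V) (S X : Finset V) : Prop :=
  ∀ e, I e ⊆ S → (I e ∩ X).Nonempty → I e ⊆ X

/-- The hypergraph induced on `S` is connected. -/
def Conn {V E : Type*} [DecidableEq V] (I : E → Finset V) (S : Finset V) : Prop :=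
  S.Nonempty ∧ ∀ X ⊆ S, X.Nonempty → ClosedIn I S X → X = S

theorem ClosedIn.compl {V E : Type*} [DecidableEq V] {I : E → Finset V} {S X : Finset V}
    (hX : ClosedIn I S X) : ClosedIn I S (S \ X) := by
  intro e heS hne x hx
  refine mem_sdiff.mpr ⟨heS hx, fun hxX => ?_⟩
  obtain ⟨y, hy⟩ := hne
  rw [mem_inter, mem_sdiff] at hy
  exact hy.2.2 (hX e heS ⟨x, mem_inter.mpr ⟨hx, hxX⟩⟩ hy.1)

section

variable {V E C : Type*} [DecidableEq V] [Fintype E] [DecidableEq C]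
  {I : E → Finset V} {F : C → V → ℕ} {S T X : Finset V}

theorem degOn_mono (h : S ⊆ T) (v : V) : degOn I S v ≤ degOn I T v :=
  card_le_card fun e he => by
    simp only [mem_filter, mem_univ, true_and] at he ⊢
    exact ⟨he.1, he.2.trans h⟩

theorem degOn_lt {e : E} {v : V} (h : S ⊆ T) (hv : v ∈ I e) (heT : I e ⊆ T) (heS : ¬ I e ⊆ S) :
    degOn I S v < degOn I T v := by
  refine card_lt_card (Finset.ssubset_iff_of_subset ?_ |>.mpr ⟨e, ?_, ?_⟩)
  · intro e he
    simp only [mem_filter, mem_univ, true_and] at he ⊢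
    exact ⟨he.1, he.2.trans h⟩
  · simp [hv, heT]
  · simp [heS]

theorem degOn_singleton (hI : ∀ e, 2 ≤ #(I e)) (v : V) : degOn I {v} v = 0 := by
  refine card_eq_zero.mpr (filter_eq_empty_iff.mpr fun e _ he => ?_)
  have := card_le_card he.2
  have := hI e
  simp at *
  omega

theorem Degenerate.mono {f : V → ℕ} (h : Degenerate I f T) (hST : S ⊆ T) : Degenerate I f S :=
  fun Y hY hn => h Y (hY.trans hST) hn

theorem Degenerate.insert {f : V → ℕ} {v : V} (h : Degenerate I f S)
    (hv : degOn I (insert v S) v < f v) : Degenerate I f (insert v S) := by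
  intro Y hY hn
  by_cases hvY : v ∈ Y
  · exact ⟨v, hvY, (degOn_mono hY v).trans_lt hv⟩
  · exact h Y (fun y hy => (mem_insert.mp (hY hy)).resolve_left
      (fun h => hvY (h ▸ hy))) hn

/-- A partition extends to a vertex which has more capacity than edges. -/
theorem Colorable.insert_of_lt [Fintype C] (hI : ∀ e, 2 ≤ #(I e)) {v : V} (hv : v ∈ S)
    (h : Colorable I F (S.erase v)) (hlt : degOn I S v < ∑ c, F c v) : Colorable I F S := by
  classical
  obtain ⟨φ, hφ⟩ := h
  -- Pigeonhole: an edge at `v` has a second vertex, so it counts for at most one color.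
  have key : ∃ c, degOn I (insert v {u ∈ S.erase v | φ u = c}) v < F c v := by
    by_contra! hcon
    refine absurd hlt (not_lt.mpr ((sum_le_sum fun c _ => hcon c).trans ?_))
    unfold degOn
    rw [← card_biUnion]
    · refine card_le_card fun e he => ?_
      simp only [mem_biUnion, mem_filter, mem_univ, true_and] at he ⊢
      obtain ⟨c, hve, hec⟩ := he
      refine ⟨hve, hec.trans ?_⟩
      intro u hu
      rcases mem_insert.mp hu with rfl | hu
      · exact hv
      · exact mem_of_mem_erase (mem_filter.mp hu).1
    · intro c _ c' _ hcc
      refine disjoint_left.mpr fun e he he' => hcc ?_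
      simp only [mem_filter, mem_univ, true_and] at he he'
      obtain ⟨u, hu, huv⟩ := exists_mem_ne (hI e) v
      have h1 := he.2 hu
      have h2 := he'.2 hu
      simp only [mem_insert, huv, false_or, mem_filter] at h1 h2
      exact h1.2.symm.trans h2.2
  obtain ⟨c, hc⟩ := key
  refine ⟨Function.update φ v c, fun c' => ?_⟩
  by_cases hcc : c' = c
  · subst hcc
    refine ((hφ c').insert hc).mono fun u hu => ?_
    rw [mem_filter] at hu
    by_cases huv : u = v
    · simp [huv]
    · simpa [huv, hu.1] using hu.2
  · refine (hφ c').mono fun u hu => ?_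
    rw [mem_filter] at hu
    by_cases huv : u = v
    · subst huv; simp at hu; exact absurd hu.2.symm hcc
    · simpa [huv, hu.1] using hu.2

/-- Color greedily: remove a vertex with spare capacity and put it back last. A part that becomes
closed only after the removal has lost an edge, which creates spare capacity at a vertex of that
part, so the hypothesis is inherited. -/
theorem colorable_of_excess [Fintype C] [Nonempty C] (hI : ∀ e, 2 ≤ #(I e))
    (hd : ∀ v ∈ S, degOn I S v ≤ ∑ c, F c v)
    (hex : ∀ X ⊆ S, X.Nonempty → ClosedIn I S X → ∃ v ∈ X, degOn I S v < ∑ c, F c v) :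
    Colorable I F S := by
  induction S using Finset.strongInduction with
  | H S ih =>
    rcases S.eq_empty_or_nonempty with rfl | hne
    · exact ⟨fun _ => Classical.arbitrary C, fun c Y hY hn => by
        simp at hY; simp [hY] at hn⟩
    obtain ⟨v, hv, hlt⟩ := hex S subset_rfl hne fun e he _ => he
    have hsub : S.erase v ⊆ S := erase_subset _ _
    refine Colorable.insert_of_lt hI hv (ih _ (erase_ssubset hv) ?_ ?_) hlt
    · exact fun u hu => (degOn_mono hsub u).trans (hd u (hsub hu))
    · intro X hX hXn hcl
      by_cases h : ClosedIn I S X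
      · obtain ⟨u, hu, hlt⟩ := hex X (hX.trans hsub) hXn h
        exact ⟨u, hu, (degOn_mono hsub u).trans_lt hlt⟩
      · unfold ClosedIn at h
        push Not at h
        obtain ⟨e, heS, ⟨x, hx⟩, heX⟩ := h
        have hxe := mem_inter.mp hx
        refine ⟨x, hxe.2, (degOn_lt hsub hxe.1 heS fun h => heX ?_).trans_le
          (hd x (hsub (hX hxe.2)))⟩
        exact hcl e h ⟨x, hx⟩

theorem sum_eq_degOn [Fintype C] [Nonempty C] (hI : ∀ e, 2 ≤ #(I e)) (hS : Conn I S)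
    (hd : ∀ v ∈ S, degOn I S v ≤ ∑ c, F c v) (hF : ¬ Colorable I F S) {v : V} (hv : v ∈ S) :
    ∑ c, F c v = degOn I S v := by
  refine ((hd v hv).antisymm ?_).symm
  by_contra! hlt
  refine hF (colorable_of_excess hI hd fun X hX hXn hcl => ?_)
  rw [hS.2 X hX hXn hcl]
  exact ⟨v, hv, hlt⟩

/-- By connectedness an edge of `S` crosses the boundary of every closed part of `T`; it does not
lie in `T`, so its end in the part has spare capacity. -/
theorem colorable_of_ssubset [Fintype C] [Nonempty C] (hI : ∀ e, 2 ≤ #(I e)) (hS : Conn I S)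
    (hd : ∀ v ∈ S, degOn I S v ≤ ∑ c, F c v) (hTS : T ⊂ S) : Colorable I F T := by
  refine colorable_of_excess hI
    (fun v hv => (degOn_mono hTS.1 v).trans (hd v (hTS.1 hv))) fun X hX hXn hcl => ?_
  have hcl' : ¬ ClosedIn I S X := fun h => by
    have := hS.2 X (hX.trans hTS.1) hXn h
    exact hTS.2 (this ▸ hX)
  unfold ClosedIn at hcl'
  push Not at hcl'
  obtain ⟨e, heS, ⟨x, hx⟩, heX⟩ := hcl'
  have hxe := mem_inter.mp hx
  refine ⟨x, hxe.2, (degOn_lt hTS.1 hxe.1 heS fun h => heX ?_).trans_le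
    (hd x (hTS.1 (hX hxe.2)))⟩
  exact hcl e h ⟨x, hx⟩

/-- What is left of the capacities `F` on `X` when `S \ X` has been colored by `ψ`. -/
def residual (I : E → Finset V) (F : C → V → ℕ) (S X : Finset V) (ψ : V → C) (c : C) (v : V) : ℕ :=
  F c v - #{e | v ∈ I e ∧ I e ⊆ S ∧ ¬ I e ⊆ X ∧ ∀ u ∈ I e, u ≠ v → u ∉ X ∧ ψ u = c}

theorem residual_le (ψ : V → C) (c : C) (v : V) : residual I F S X ψ c v ≤ F c v :=
  Nat.sub_le _ _

theorem residual_eq (ψ : V → C) (c : C) {v : V}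
    (h : ∀ e, v ∈ I e → I e ⊆ S → I e ⊆ X) : residual I F S X ψ c v = F c v := by
  unfold residual
  rw [card_eq_zero.mpr, Nat.sub_zero]
  exact filter_eq_empty_iff.mpr fun e _ he => he.2.2.1 (h e he.1 he.2.1)

theorem degOn_le_sum_residual [Fintype C] (hI : ∀ e, 2 ≤ #(I e)) (hXS : X ⊆ S) (ψ : V → C) {v : V}
    (hd : degOn I S v ≤ ∑ c, F c v) : degOn I X v ≤ ∑ c, residual I F S X ψ c v := by
  classical
  have h1 : ∑ c, F c v ≤ ∑ c, residual I F S X ψ c v +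
      ∑ c, #{e | v ∈ I e ∧ I e ⊆ S ∧ ¬ I e ⊆ X ∧ ∀ u ∈ I e, u ≠ v → u ∉ X ∧ ψ u = c} := by
    rw [← sum_add_distrib]
    exact sum_le_sum fun c _ => by unfold residual; omega
  have h2 : ∑ c, #{e | v ∈ I e ∧ I e ⊆ S ∧ ¬ I e ⊆ X ∧ ∀ u ∈ I e, u ≠ v → u ∉ X ∧ ψ u = c} ≤
      #{e | v ∈ I e ∧ I e ⊆ S ∧ ¬ I e ⊆ X} := by
    rw [← card_biUnion]
    · refine card_le_card fun e he => ?_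
      simp only [mem_biUnion, mem_filter, mem_univ, true_and] at he ⊢
      obtain ⟨c, h⟩ := he
      exact ⟨h.1, h.2.1, h.2.2.1⟩
    · intro c _ c' _ hcc
      refine disjoint_left.mpr fun e he he' => hcc ?_
      simp only [mem_filter, mem_univ, true_and] at he he'
      obtain ⟨u, hu, huv⟩ := exists_mem_ne (hI e) v
      exact (he.2.2.2 u hu huv).2.symm.trans (he'.2.2.2 u hu huv).2
  have h3 : degOn I X v + #{e | v ∈ I e ∧ I e ⊆ S ∧ ¬ I e ⊆ X} ≤ degOn I S v := by
    unfold degOn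
    rw [← card_union_of_disjoint]
    · refine card_le_card fun e he => ?_
      simp only [mem_union, mem_filter, mem_univ, true_and] at he ⊢
      rcases he with he | he
      · exact ⟨he.1, he.2.trans hXS⟩
      · exact ⟨he.1, he.2.1⟩
    · refine disjoint_left.mpr fun e he he' => ?_
      simp only [mem_filter, mem_univ, true_and] at he he'
      exact he'.2.2 he.2
  omega

/-- A partition of `X` for the residual capacities could be glued to `ψ`. A crossing edge has only
one vertex in `X`, so it matters there only if its other vertices share one color of `ψ`, and then
it has been paid for by `residual`. -/
theorem not_colorable_residual
    (hcross : ∀ e, I e ⊆ S → ¬ I e ⊆ X → #(I e ∩ X) ≤ 1) {ψ : V → C}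
    (hψ : ∀ c, Degenerate I (F c) {v ∈ S \ X | ψ v = c}) (hF : ¬ Colorable I F S) :
    ¬ Colorable I (residual I F S X ψ) X := by
  classical
  rintro ⟨φ, hφ⟩
  refine hF ⟨fun v => if v ∈ X then φ v else ψ v, fun c Y hY hn => ?_⟩
  by_cases hYX : (Y ∩ X).Nonempty
  · obtain ⟨y, hy, hlt⟩ := hφ c (Y ∩ X) (fun y hy => by
      rw [mem_inter] at hy
      have := (mem_filter.mp (hY hy.1)).2
      simp only [hy.2, if_true] at this
      exact mem_filter.mpr ⟨hy.2, this⟩) hYX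
    rw [mem_inter] at hy
    refine ⟨y, hy.1, ?_⟩
    unfold residual at hlt
    have : degOn I Y y ≤ degOn I (Y ∩ X) y +
        #{e | y ∈ I e ∧ I e ⊆ S ∧ ¬ I e ⊆ X ∧ ∀ u ∈ I e, u ≠ y → u ∉ X ∧ ψ u = c} := by
      unfold degOn
      refine le_trans (card_le_card fun e he => ?_) (card_union_le _ _)
      simp only [mem_union, mem_filter, mem_univ, true_and] at he ⊢
      by_cases heX : I e ⊆ X
      · exact Or.inl ⟨he.1, subset_inter he.2 heX⟩
      · have heS : I e ⊆ S := fun u hu => (mem_filter.mp (hY (he.2 hu))).1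
        refine Or.inr ⟨he.1, heS, heX, fun u hu huy => ?_⟩
        have huX : u ∉ X := fun huX => huy (card_le_one.mp (hcross e heS heX) u
          (mem_inter.mpr ⟨hu, huX⟩) y (mem_inter.mpr ⟨he.1, hy.2⟩))
        have := (mem_filter.mp (hY (he.2 hu))).2
        simp only [huX, if_false] at this
        exact ⟨huX, this⟩
    omega
  · refine hψ c Y (fun y hy => ?_) hn
    have h := mem_filter.mp (hY hy)
    have hyX : y ∉ X := fun h => hYX ⟨y, mem_inter.mpr ⟨hy, h⟩⟩
    simp only [hyX, if_false] at h
    exact mem_filter.mpr ⟨mem_sdiff.mpr ⟨h.1, hyX⟩, h.2⟩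

/-- Noncolorability passes to parts which are attached by single vertices. -/
theorem exists_not_colorable_part [Fintype C] [Nonempty C] (hI : ∀ e, 2 ≤ #(I e)) (hS : Conn I S)
    (hd : ∀ v ∈ S, degOn I S v ≤ ∑ c, F c v) (hF : ¬ Colorable I F S) (hXS : X ⊆ S)
    (hX : X.Nonempty) (hcross : ∀ e, I e ⊆ S → ¬ I e ⊆ X → #(I e ∩ X) ≤ 1) :
    ∃ F' : C → V → ℕ, (∀ c v, F' c v ≤ F c v) ∧
      (∀ v, (∀ e, v ∈ I e → I e ⊆ S → I e ⊆ X) → ∀ c, F' c v = F c v) ∧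
      (∀ v ∈ X, degOn I X v ≤ ∑ c, F' c v) ∧ ¬ Colorable I F' X := by
  obtain ⟨ψ, hψ⟩ := colorable_of_ssubset hI hS hd (T := S \ X) (sdiff_ssubset hXS hX)
  exact ⟨residual I F S X ψ, residual_le ψ, fun v h c => residual_eq ψ c h,
    fun v hv => degOn_le_sum_residual hI hXS ψ (hd v (hXS hv)),
    not_colorable_residual hcross hψ hF⟩

end

end VariableDegeneracy

/-! ### Lobes and blocks of simple graphs. -/

namespace VariableDegeneracy

open Finset

/-- `u` and `v` are the ends of an edge of size two. -/
def Adj {V E : Type*} [DecidableEq V] (I : E → Finset V) (u v : V) : Prop :=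
  ∃ e, I e = {u, v}

/-- The hypergraph induced on `S` is connected and has no cut vertex. -/
def Block {V E : Type*} [DecidableEq V] (I : E → Finset V) (S : Finset V) : Prop :=
  Conn I S ∧ ∀ z ∈ S, (S.erase z).Nonempty → Conn I (S.erase z)

/-- All edges inside `S` have size two, and no two of them are parallel. -/
def IsGraphOn {V E : Type*} (I : E → Finset V) (S : Finset V) : Prop :=
  (∀ e, I e ⊆ S → #(I e) = 2) ∧ ∀ e e', I e ⊆ S → I e = I e' → e = e'

/-- A proper part `B` of `X` which is attached to the rest of `X` by the vertex `b`. -/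
def Lobe {V E : Type*} [DecidableEq V] (I : E → Finset V) (X B : Finset V) (b : V) : Prop :=
  b ∈ B ∧ B ⊆ X ∧ (B.erase b).Nonempty ∧ (∀ u ∈ B.erase b, ∀ w ∈ X, Adj I u w → w ∈ B) ∧
    ∃ y ∈ X, y ∉ B

/-- Only one color has positive capacity on `S`. -/
def Monochrome {V C : Type*} (F : C → V → ℕ) (S : Finset V) : Prop :=
  ∃ c, ∀ c', c' ≠ c → ∀ v ∈ S, F c' v = 0

/-- All capacities are constant on `S`. -/
def ConstOn {V C : Type*} (F : C → V → ℕ) (S : Finset V) : Prop :=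
  ∀ c, ∀ u ∈ S, ∀ v ∈ S, F c u = F c v

theorem IsGraphOn.mono {V E : Type*} {I : E → Finset V} {S X : Finset V}
    (h : IsGraphOn I S) (hX : X ⊆ S) : IsGraphOn I X :=
  ⟨fun e he => h.1 e (he.trans hX), fun e e' he => h.2 e e' (he.trans hX)⟩

section

variable {V E : Type*} [DecidableEq V] {I : E → Finset V} {S X B : Finset V}

theorem Adj.symm {u v : V} (h : Adj I u v) : Adj I v u := by
  obtain ⟨e, he⟩ := h
  exact ⟨e, he.trans (pair_comm u v)⟩

theorem IsGraphOn.eq_pair (h : IsGraphOn I S) {e : E} (heS : I e ⊆ S) {x y : V} (hx : x ∈ I e)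
    (hy : y ∈ I e) (hxy : x ≠ y) : I e = {x, y} := by
  refine (eq_of_subset_of_card_le ?_ ?_).symm
  · intro z hz
    rcases mem_insert.mp hz with rfl | hz
    · exact hx
    · rwa [mem_singleton.mp hz]
  · rw [h.1 e heS, card_pair hxy]

theorem Conn.exists_adj (hG : IsGraphOn I S) (hS : Conn I S) (hXS : X ⊆ S) (hX : X.Nonempty)
    (hne : X ≠ S) : ∃ u ∈ X, ∃ v ∈ S, v ∉ X ∧ Adj I u v := by
  have h : ¬ ClosedIn I S X := fun h => hne (hS.2 X hXS hX h)
  unfold ClosedIn at h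
  push Not at h
  obtain ⟨e, heS, ⟨x, hx⟩, heX⟩ := h
  obtain ⟨y, hy, hyX⟩ := not_subset.mp heX
  rw [mem_inter] at hx
  exact ⟨x, hx.2, y, heS hy, hyX, e, hG.eq_pair heS hx.1 hy fun h => hyX (h ▸ hx.2)⟩

theorem conn_of_avoid {a : V} (ha : a ∈ S)
    (h : ∀ X ⊆ S, X.Nonempty → a ∉ X → ∃ u ∈ X, ∃ v ∈ S, v ∉ X ∧ Adj I u v) : Conn I S := by
  refine ⟨⟨a, ha⟩, fun X hXS hX hcl => ?_⟩
  have key : ∀ Y ⊆ S, Y.Nonempty → a ∉ Y → ¬ ClosedIn I S Y := by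
    intro Y hYS hY haY hcl
    obtain ⟨u, hu, v, hv, hvY, e, he⟩ := h Y hYS hY haY
    refine hvY (hcl e ?_ ⟨u, ?_⟩ ?_)
    · rw [he]
      intro z hz
      rcases mem_insert.mp hz with rfl | hz
      · exact hYS hu
      · rwa [mem_singleton.mp hz]
    · simp [he, hu]
    · simp [he]
  by_cases haX : a ∈ X
  · by_contra hne
    refine key (S \ X) sdiff_subset ?_ (by simp [haX]) hcl.compl
    exact sdiff_nonempty.mpr fun h => hne (hXS.antisymm h)
  · exact absurd hcl (key X hXS hX haX)

theorem exists_separated {a : V} (ha : a ∈ S) (h : ¬ Conn I S) :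
    ∃ X ⊆ S, X.Nonempty ∧ a ∉ X ∧ ∀ u ∈ X, ∀ v ∈ S, Adj I u v → v ∈ X := by
  by_contra! hcon
  exact h (conn_of_avoid ha fun X hXS hX haX => by
    obtain ⟨u, hu, v, hv, huv, hvX⟩ := hcon X hXS hX haX
    exact ⟨u, hu, v, hv, hvX, huv⟩)

theorem Lobe.conn (hG : IsGraphOn I X) (hX : Conn I X) {b : V} (hB : Lobe I X B b) :
    Conn I B := by
  obtain ⟨hb, hBX, -, hcl, -⟩ := hB
  refine conn_of_avoid hb fun Z hZ hZn hbZ => ?_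
  obtain ⟨u, hu, w, hw, hwZ, huw⟩ := hX.exists_adj hG (hZ.trans hBX) hZn
    (fun h => hbZ (h ▸ hBX hb))
  exact ⟨u, hu, w, hcl u (mem_erase.mpr ⟨fun h => hbZ (h ▸ hu), hZ hu⟩) w hw huw, hwZ, huw⟩

/-- Every lobe contains a lobe without cut vertices. -/
theorem Lobe.exists_block (hG : IsGraphOn I X) (hX : Conn I X) {b : V} (hB : Lobe I X B b) :
    ∃ B' b', Lobe I X B' b' ∧ B'.erase b' ⊆ B.erase b ∧ Block I B' := by
  induction B using Finset.strongInduction generalizing b with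
  | H B ih =>
    by_cases hbl : ∀ z ∈ B, (B.erase z).Nonempty → Conn I (B.erase z)
    · exact ⟨B, b, hB, subset_rfl, hB.conn hG hX, hbl⟩
    push Not at hbl
    obtain ⟨z, hz, hzn, hzc⟩ := hbl
    have hB' := hB
    obtain ⟨hb, hBX, hBn, hcl, y, hyX, hyB⟩ := hB'
    obtain ⟨a, ha, hab⟩ : ∃ a ∈ B.erase z, z = b ∨ a = b := by
      by_cases hzb : z = b
      · exact ⟨hzn.choose, hzn.choose_spec, Or.inl hzb⟩
      · exact ⟨b, mem_erase.mpr ⟨fun h => hzb h.symm, hb⟩, Or.inr rfl⟩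
    obtain ⟨Z, hZ, hZn, haZ, hZcl⟩ := exists_separated ha hzc
    have hzZ : z ∉ Z := fun h => (mem_erase.mp (hZ h)).1 rfl
    have hbZ : b ∉ Z := by
      rcases hab with rfl | rfl
      · exact hzZ
      · exact haZ
    have hZB : Z ⊆ B := hZ.trans (erase_subset _ _)
    have hZb : Z ⊆ B.erase b := fun u hu => mem_erase.mpr ⟨fun h => hbZ (h ▸ hu), hZB hu⟩
    have hzZB : insert z Z ⊆ B := insert_subset hz hZB
    have hss : insert z Z ⊂ B := by
      refine (ssubset_iff_of_subset hzZB).mpr ⟨a, mem_of_mem_erase ha, fun h => ?_⟩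
      exact (mem_insert.mp h).elim (mem_erase.mp ha).1 haZ
    obtain ⟨B', b', h1, h2, h3⟩ := ih (insert z Z) hss (b := z) ⟨mem_insert_self _ _,
      hzZB.trans hBX, by rwa [erase_insert hzZ], fun u hu w hw huw => by
        rw [erase_insert hzZ] at hu
        by_cases hwz : w = z
        · simp [hwz]
        · exact mem_insert_of_mem (hZcl u hu w
            (mem_erase.mpr ⟨hwz, hcl u (hZb hu) w hw huw⟩) huw), y, hyX, fun h => hyB (hzZB h)⟩
    rw [erase_insert hzZ] at h2
    exact ⟨B', b', h1, h2.trans hZb, h3⟩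

/-- Two lobes at a cut vertex. -/
theorem exists_two_lobes (hX : Conn I X) (hbl : ¬ Block I X) :
    ∃ B B' b, Lobe I X B b ∧ Lobe I X B' b ∧ Disjoint (B.erase b) (B'.erase b) ∧
      B ∪ B' = X := by
  have : ∃ z ∈ X, (X.erase z).Nonempty ∧ ¬ Conn I (X.erase z) := by
    by_contra! h
    exact hbl ⟨hX, h⟩
  obtain ⟨z, hz, ⟨a, ha⟩, hzc⟩ := this
  obtain ⟨Z, hZ, hZn, haZ, hZcl⟩ := exists_separated ha hzc
  have hzZ : z ∉ Z := fun h => (mem_erase.mp (hZ h)).1 rfl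
  have hzZ' : z ∉ X.erase z \ Z := by simp
  have haz := mem_erase.mp ha
  obtain ⟨y, hy⟩ := hZn
  have hyz := mem_erase.mp (hZ hy)
  refine ⟨insert z Z, insert z (X.erase z \ Z), z, ⟨mem_insert_self _ _,
    insert_subset hz (hZ.trans (erase_subset _ _)), ?_, ?_, a, haz.2, ?_⟩, ⟨mem_insert_self _ _,
    insert_subset hz (sdiff_subset.trans (erase_subset _ _)), ?_, ?_, y, hyz.2, ?_⟩, ?_, ?_⟩
  · rw [erase_insert hzZ]; exact ⟨y, hy⟩
  · rw [erase_insert hzZ]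
    intro u hu w hw huw
    by_cases hwz : w = z
    · simp [hwz]
    · exact mem_insert_of_mem (hZcl u hu w (mem_erase.mpr ⟨hwz, hw⟩) huw)
  · simp [haz.1, haZ]
  · rw [erase_insert hzZ']; exact ⟨a, mem_sdiff.mpr ⟨ha, haZ⟩⟩
  · rw [erase_insert hzZ']
    intro u hu w hw huw
    by_cases hwz : w = z
    · simp [hwz]
    · rw [mem_sdiff] at hu
      refine mem_insert_of_mem (mem_sdiff.mpr ⟨mem_erase.mpr ⟨hwz, hw⟩, fun hwZ => hu.2 ?_⟩)
      exact hZcl w hwZ u hu.1 huw.symm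
  · simp [hyz.1, hy]
  · rw [erase_insert hzZ, erase_insert hzZ']
    exact disjoint_sdiff
  · rw [insert_union, union_insert, union_sdiff_of_subset hZ, insert_idem, insert_erase hz]

/-- Let a second vertex `z` be deleted after `u`. If `z = v`, then `B - u` is connected and
everything else reaches `b` without `u`. Otherwise a part `Z` separated from `v` avoids `B - b`,
whose vertices are adjacent to `v`, and must contain `b`, the only vertex outside `B - b` that can
see `u` apart from `v`. If `z` lies in `B - b`, then `Z` contains everything outside `B` except `v`,
and some vertex there sees `v` because `S - b` is connected. If not, `b` has a neighbor in `B - b`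
other than `u`, which leads to `v`. -/
theorem block_erase_of_lobe {v b u : V} (hG : IsGraphOn I S) (hS : Block I S) (hv : v ∈ S)
    (hX : Conn I (S.erase v)) (hL : Lobe I (S.erase v) B b) (hB : Block I B)
    (hadj : ∀ q ∈ B.erase b, Adj I q v) (hu : u ∈ B.erase b) (hu2 : B.erase b ≠ {u}) :
    Block I (S.erase u) := by
  obtain ⟨hb, hBX, -, hcl, y, hyX, hyB⟩ := hL
  have hub := mem_erase.mp hu
  have hXS : S.erase v ⊆ S := erase_subset _ _
  have huX := hBX hub.2
  have huS := hXS huX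
  have huv : u ≠ v := (mem_erase.mp huX).1
  have hbX := hBX hb
  have hbv : b ≠ v := (mem_erase.mp hbX).1
  have hBu : Conn I (B.erase u) := hB.2 u hub.2 ⟨b, mem_erase.mpr ⟨hub.1.symm, hb⟩⟩
  have hvB : v ∉ B := fun h => (mem_erase.mp (hBX h)).1 rfl
  refine ⟨hS.2 u huS ⟨v, mem_erase.mpr ⟨huv.symm, hv⟩⟩, fun z hz _ => ?_⟩
  have hzu := mem_erase.mp hz
  by_cases hzv : z = v
  · subst hzv
    refine conn_of_avoid (a := b) (by simp [hub.1.symm, hbv, hXS hbX]) fun Z hZ hZn hbZ => ?_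
    have hZX : Z ⊆ S.erase z := hZ.trans (erase_subset_erase _ (erase_subset _ _))
    by_cases hZB : (Z ∩ B).Nonempty
    · obtain ⟨x, hx, w, hw, hwZ, hxw⟩ := hBu.exists_adj (X := Z ∩ B)
        (hG.mono ((erase_subset _ _).trans (hBX.trans hXS))) (fun x hx => by
          rw [mem_inter] at hx
          exact mem_erase.mpr ⟨fun h => by have := hZ hx.1; simp [h] at this, hx.2⟩) hZB
        (fun h => hbZ (mem_inter.mp (h ▸ mem_erase.mpr ⟨hub.1.symm, hb⟩)).1)
      have hwB := mem_erase.mp hw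
      refine ⟨x, (mem_inter.mp hx).1, w, ?_, fun h => hwZ (mem_inter.mpr ⟨h, hwB.2⟩), hxw⟩
      exact mem_erase.mpr ⟨(mem_erase.mp (hBX hwB.2)).1,
        mem_erase.mpr ⟨hwB.1, hXS (hBX hwB.2)⟩⟩
    · obtain ⟨x, hx, w, hw, hwZ, hxw⟩ := hX.exists_adj (hG.mono hXS) hZX hZn
        (fun h => hbZ (h ▸ hbX))
      refine ⟨x, hx, w, ?_, hwZ, hxw⟩
      have hw' := mem_erase.mp hw
      refine mem_erase.mpr ⟨hw'.1, mem_erase.mpr ⟨fun hwu => hZB ⟨x, ?_⟩, hw'.2⟩⟩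
      subst hwu
      exact mem_inter.mpr ⟨hx, hcl w hu x (hZX hx) hxw.symm⟩
  · have hvT : v ∈ (S.erase u).erase z := by
      exact mem_erase.mpr ⟨fun h => hzv h.symm, mem_erase.mpr ⟨huv.symm, hv⟩⟩
    refine conn_of_avoid hvT fun Z hZ hZn hvZ => ?_
    by_contra! H
    have hT : ∀ x, x ∈ Z → x ≠ z ∧ x ≠ u ∧ x ∈ S := fun x hx => by
      have := hZ hx
      simpa using this
    have hZX : ∀ x ∈ Z, x ∈ S.erase v := fun x hx =>
      mem_erase.mpr ⟨fun h => hvZ (h ▸ hx), (hT x hx).2.2⟩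
    have hZQ : ∀ x ∈ Z, x ∉ B.erase b := fun x hx hxQ =>
      H x hx v hvT hvZ (hadj x hxQ)
    have hbZ : b ∈ Z := by
      obtain ⟨x, hx, w, hw, hwZ, hxw⟩ := (hS.2 z hzu.2 ⟨v, mem_erase.mpr
        ⟨fun h => hzv h.symm, hv⟩⟩).exists_adj (X := Z) (hG.mono (erase_subset _ _))
        (fun x hx => mem_erase.mpr ⟨(hT x hx).1, (hT x hx).2.2⟩) hZn
        (fun h => hvZ (h ▸ mem_erase.mpr ⟨fun h => hzv h.symm, hv⟩))
      have hw' := mem_erase.mp hw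
      have hwu : w = u := by
        by_contra hwu
        exact H x hx w (mem_erase.mpr ⟨hw'.1, mem_erase.mpr ⟨hwu, hw'.2⟩⟩) hwZ hxw
      subst hwu
      have hxB := hcl w hu x (hZX x hx) hxw.symm
      by_contra hbZ
      exact hZQ x hx (mem_erase.mpr ⟨fun h => hbZ (h ▸ hx), hxB⟩)
    by_cases hzQ : z ∈ B.erase b
    · have hXeq : ∀ w ∈ S.erase v, w ∈ Z ∪ B.erase b := by
        by_contra! hne
        obtain ⟨y', hy', hy'n⟩ := hne
        obtain ⟨x, hx, w, hw, hwZ, hxw⟩ := hX.exists_adj (X := Z ∪ B.erase b) (hG.mono hXS)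
          (union_subset hZX ((erase_subset _ _).trans hBX)) ⟨b, mem_union_left _ hbZ⟩
          (fun h => hy'n (h ▸ hy'))
        rw [mem_union, not_or] at hwZ
        rcases mem_union.mp hx with hx | hx
        · exact H x hx w (mem_erase.mpr ⟨fun h => hwZ.2 (h ▸ hzQ), mem_erase.mpr
            ⟨fun h => hwZ.2 (h ▸ hu), hXS hw⟩⟩) hwZ.1 hxw
        · exact hwZ.2 (mem_erase.mpr ⟨fun h => hwZ.1 (h ▸ hbZ), hcl x hx w hw hxw⟩)
      have hvb : v ∈ S.erase b := mem_erase.mpr ⟨hbv.symm, hv⟩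
      obtain ⟨x, hx, w, hw, hwZ, hxw⟩ := (hS.2 b (hXS hbX) ⟨v, hvb⟩).exists_adj
        (X := S.erase v \ B) (hG.mono (erase_subset _ _)) (fun x hx => by
          rw [mem_sdiff] at hx
          exact mem_erase.mpr ⟨fun h => hx.2 (h ▸ hb), hXS hx.1⟩)
        ⟨y, mem_sdiff.mpr ⟨hyX, hyB⟩⟩ (fun h => by rw [← h] at hvb; simp at hvb)
      have hw' := mem_erase.mp hw
      rw [mem_sdiff] at hx
      have hwv : w = v := by
        by_contra hwv
        have hwX : w ∈ S.erase v := mem_erase.mpr ⟨hwv, hw'.2⟩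
        have hwB : w ∈ B := by
          by_contra hwB
          exact hwZ (mem_sdiff.mpr ⟨hwX, hwB⟩)
        exact hx.2 (hcl w (mem_erase.mpr ⟨hw'.1, hwB⟩) x hx.1 hxw.symm)
      subst hwv
      have hxZ : x ∈ Z := (mem_union.mp (hXeq x hx.1)).resolve_right
        fun h => hx.2 (mem_of_mem_erase h)
      exact H x hxZ w hvT hvZ hxw
    · obtain ⟨x, hx, w, hw, hwb, hxw⟩ := hBu.exists_adj (X := {b})
        (hG.mono ((erase_subset _ _).trans (hBX.trans hXS)))
        (by simpa using ⟨hub.1.symm, hb⟩) ⟨b, by simp⟩ (fun h => hu2 (by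
          ext q
          constructor
          · intro hq
            by_contra hqu
            have hq' := mem_erase.mp hq
            have : q ∈ B.erase u := mem_erase.mpr ⟨by simpa using hqu, hq'.2⟩
            rw [← h] at this
            exact hq'.1 (by simpa using this)
          · intro hq
            rw [mem_singleton.mp hq]; exact hu))
      rw [mem_singleton] at hx hwb
      subst hx
      have hw' := mem_erase.mp hw
      have hwQ : w ∈ B.erase x := mem_erase.mpr ⟨hwb, hw'.2⟩
      exact H x hbZ w (mem_erase.mpr ⟨fun h => hzQ (h ▸ hwQ), mem_erase.mpr
        ⟨hw'.1, hXS (hBX hw'.2)⟩⟩) (fun h => hZQ w h hwQ) hxw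

end

end VariableDegeneracy

/-! ### Shifting capacities by deleting a colored vertex. -/

namespace VariableDegeneracy

open Finset

section

variable {V E C : Type*} [DecidableEq V] [Fintype E] [DecidableEq C] [Fintype C] [Nonempty C]
  {I : E → Finset V} {F : C → V → ℕ} {S X B : Finset V}

/-- Deleting a vertex `v` of color `c` costs every neighbor of `v` one unit of color `c`. -/
theorem exists_shift (hI : ∀ e, 2 ≤ #(I e)) (hG : IsGraphOn I S) {v : V} {c : C} (hv : v ∈ S)
    (hX : Conn I (S.erase v)) (hd : ∀ u ∈ S, degOn I S u ≤ ∑ c, F c u) (hF : ¬ Colorable I F S)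
    (hc : 0 < F c v) :
    ∃ R : C → V → ℕ, (∀ c', c' ≠ c → ∀ u ∈ S.erase v, R c' u = F c' u) ∧
      (∀ u ∈ S.erase v, ¬ Adj I u v → R c u = F c u) ∧
      (∀ u ∈ S.erase v, Adj I u v → F c u = R c u + 1) ∧
      (∀ u ∈ S.erase v, degOn I (S.erase v) u ≤ ∑ c, R c u) ∧ ¬ Colorable I R (S.erase v) := by
  classical
  have hXS : S.erase v ⊆ S := erase_subset _ _
  have hR1 : ∀ c', c' ≠ c → ∀ u ∈ S.erase v,
      residual I F S (S.erase v) (fun _ => c) c' u = F c' u := by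
    intro c' hc' u _
    unfold residual
    rw [card_eq_zero.mpr, Nat.sub_zero]
    refine filter_eq_empty_iff.mpr fun e _ he => ?_
    obtain ⟨w, hw, hwu⟩ := exists_mem_ne (hI e) u
    exact hc' (he.2.2.2 w hw hwu).2.symm
  have hR2 : ∀ u ∈ S.erase v, ¬ Adj I u v →
      residual I F S (S.erase v) (fun _ => c) c u = F c u := by
    intro u hu huv
    unfold residual
    rw [card_eq_zero.mpr, Nat.sub_zero]
    refine filter_eq_empty_iff.mpr fun e _ he => huv ⟨e, ?_⟩
    have hve : v ∈ I e := by
      by_contra hve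
      exact he.2.2.1 fun x hx => mem_erase.mpr ⟨fun h => hve (h ▸ hx), he.2.1 hx⟩
    exact hG.eq_pair he.2.1 he.1 hve (mem_erase.mp hu).1
  have hd' : ∀ u ∈ S.erase v, degOn I (S.erase v) u ≤
      ∑ c', residual I F S (S.erase v) (fun _ => c) c' u :=
    fun u hu => degOn_le_sum_residual hI hXS _ (hd u (hXS hu))
  have hF' : ¬ Colorable I (residual I F S (S.erase v) (fun _ => c)) (S.erase v) := by
    refine not_colorable_residual (fun e heS heX => ?_) (fun c' Y hY hn => ?_) hF
    · have hve : v ∈ I e := by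
        by_contra hve
        exact heX fun x hx => mem_erase.mpr ⟨fun h => hve (h ▸ hx), heS hx⟩
      have h1 : I e ∩ S.erase v ⊆ (I e).erase v := fun x hx => by
        rw [mem_inter, mem_erase] at hx
        exact mem_erase.mpr ⟨hx.2.1, hx.1⟩
      have := card_le_card h1
      rwa [card_erase_of_mem hve, hG.1 e heS] at this
    · obtain ⟨y, hy⟩ := hn
      have h1 : ∀ x ∈ Y, x = v ∧ c = c' := fun x hx => by
        have h := mem_filter.mp (hY hx)
        have h2 := mem_sdiff.mp h.1
        refine ⟨?_, h.2⟩
        by_contra hxv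
        exact h2.2 (mem_erase.mpr ⟨hxv, h2.1⟩)
      obtain ⟨rfl, rfl⟩ := h1 y hy
      refine ⟨y, hy, ?_⟩
      rw [(eq_singleton_iff_unique_mem.mpr ⟨hy, fun x hx => (h1 x hx).1⟩ : Y = {y}),
        degOn_singleton hI]
      exact hc
  refine ⟨residual I F S (S.erase v) (fun _ => c), hR1, hR2, ?_, hd', hF'⟩
  intro u hu huv
  -- If `u` had no capacity of color `c`, its total capacity would survive the deletion while its
  -- degree drops; but in the connected set `S - v` capacity and degree must agree.
  have hpos : 0 < F c u := by
    by_contra h0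
    have hsum : ∑ c', residual I F S (S.erase v) (fun _ => c) c' u = ∑ c', F c' u := by
      refine sum_congr rfl fun c' _ => ?_
      by_cases hcc : c' = c
      · subst hcc
        have := residual_le (I := I) (F := F) (S := S) (X := S.erase v) (fun _ => c') c' u
        omega
      · exact hR1 c' hcc u hu
    have h1 := sum_eq_degOn hI hX hd' hF' hu
    obtain ⟨e, he⟩ := huv
    have h2 : degOn I (S.erase v) u < degOn I S u := by
      refine degOn_lt (e := e) hXS (by simp [he]) ?_ fun h => ?_
      · rw [he]
        intro x hx
        rcases mem_insert.mp hx with rfl | hx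
        · exact hXS hu
        · rwa [mem_singleton.mp hx]
      · have : v ∈ S.erase v := h (by simp [he])
        simp at this
    have := hd u (hXS hu)
    omega
  have hone : #{e | u ∈ I e ∧ I e ⊆ S ∧ ¬ I e ⊆ S.erase v ∧
      ∀ w ∈ I e, w ≠ u → w ∉ S.erase v ∧ (fun _ : V => c) w = c} = 1 := by
    obtain ⟨e, he⟩ := huv
    have huv' := (mem_erase.mp hu).1
    refine card_eq_one.mpr ⟨e, ?_⟩
    ext e'
    simp only [mem_filter, mem_univ, true_and, mem_singleton]
    constructor
    · rintro ⟨h1, h2, h3, -⟩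
      have hve : v ∈ I e' := by
        by_contra hve
        exact h3 fun x hx => mem_erase.mpr ⟨fun h => hve (h ▸ hx), h2 hx⟩
      exact hG.2 e' e h2 ((hG.eq_pair h2 h1 hve huv').trans he.symm)
    · rintro rfl
      rw [he]
      refine ⟨by simp, ?_, fun h => ?_, ?_⟩
      · intro x hx
        rcases mem_insert.mp hx with rfl | hx
        · exact hXS hu
        · rwa [mem_singleton.mp hx]
      · have : v ∈ S.erase v := h (by simp)
        simp at this
      · intro w hw hwu
        have := (mem_insert.mp hw).resolve_left hwu
        rw [mem_singleton] at this
        simp [this]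
  unfold residual
  rw [hone]
  omega

/-- In a block the same colors are available at all vertices. -/
theorem Block.pos_of_pos (hI : ∀ e, 2 ≤ #(I e)) (hG : IsGraphOn I S) (hS : Block I S)
    (hd : ∀ u ∈ S, degOn I S u ≤ ∑ c, F c u) (hF : ¬ Colorable I F S) {c : C} {u v : V}
    (hu : u ∈ S) (hv : v ∈ S) (hc : 0 < F c u) : 0 < F c v := by
  by_contra hcv
  obtain ⟨x, hx, w, hw, hwX, hxw⟩ := hS.1.exists_adj hG (X := {x ∈ S | 0 < F c x})
    (filter_subset _ _) ⟨u, mem_filter.mpr ⟨hu, hc⟩⟩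
    (fun h => by rw [← h] at hv; exact hcv (mem_filter.mp hv).2)
  rw [mem_filter] at hx hwX
  have hwx : w ∈ S.erase x := mem_erase.mpr ⟨fun h => hwX (h ▸ hx), hw⟩
  obtain ⟨R, -, -, h3, -⟩ := exists_shift hI hG hx.1 (hS.2 x hx.1 ⟨w, hwx⟩) hd hF hx.2
  have := h3 w hwx hxw.symm
  exact hwX ⟨hw, by omega⟩

end

end VariableDegeneracy

/-! ### The structure theorem for blocks that are simple graphs. -/

namespace VariableDegeneracy

open Finset

/-- If the shifts of two colors along `A` are both of one of the two types, then `A` holds on all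
of `Q` or nowhere on `Q`. -/
theorem all_of_shift {V C : Type*} {F : C → V → ℕ} {A : V → Prop} {Q : Finset V} {c₁ c₂ : C}
    (hc : c₁ ≠ c₂) (h₁ : ∀ q ∈ Q, 0 < F c₁ q) (h₂ : ∀ q ∈ Q, 0 < F c₂ q)
    (hR : ∀ c, (c = c₁ ∨ c = c₂) → ∃ R : C → V → ℕ, (∀ c', c' ≠ c → ∀ q ∈ Q, R c' q = F c' q) ∧
      (∀ q ∈ Q, ¬ A q → R c q = F c q) ∧ (∀ q ∈ Q, A q → F c q = R c q + 1) ∧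
      (Monochrome R Q ∨ ConstOn R Q)) {q₀ : V} (hq₀ : q₀ ∈ Q) (hA : A q₀) : ∀ q ∈ Q, A q := by
  intro q hq
  by_contra hAq
  -- A shift of `c` keeps `c'` alive at `q₀` and `c` alive at the point `q` where `A` fails, so its
  -- result is not monochromatic.
  have key : ∀ c c', c ≠ c' → 0 < F c' q₀ → 0 < F c q → ∀ R : C → V → ℕ,
      (∀ c', c' ≠ c → ∀ q ∈ Q, R c' q = F c' q) → (∀ q ∈ Q, ¬ A q → R c q = F c q) →
      Monochrome R Q → False := by
    rintro c c' hcc h1 h2 R hR1 hR2 ⟨c₀, hc₀⟩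
    by_cases h : c = c₀
    · have := hc₀ c' (fun h' => hcc (h.trans h'.symm)) q₀ hq₀
      rw [hR1 c' hcc.symm q₀ hq₀] at this
      omega
    · have := hc₀ c h q hq
      rw [hR2 q hq hAq] at this
      omega
  obtain ⟨R₁, a1, a2, a3, a4⟩ := hR c₁ (Or.inl rfl)
  obtain ⟨R₂, b1, b2, b3, b4⟩ := hR c₂ (Or.inr rfl)
  rcases a4 with a4 | a4
  · exact key c₁ c₂ hc (h₂ q₀ hq₀) (h₁ q hq) R₁ a1 a2 a4
  rcases b4 with b4 | b4
  · exact key c₂ c₁ hc.symm (h₁ q₀ hq₀) (h₂ q hq) R₂ b1 b2 b4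
  -- The shift of `c₂` shows that `F c₁` agrees at `q` and `q₀`, whereas the shift of `c₁` lowers it
  -- at `q₀` only and must again produce equal values.
  have e1 := b4 c₁ q hq q₀ hq₀
  rw [b1 c₁ hc q hq, b1 c₁ hc q₀ hq₀] at e1
  have e2 := a4 c₁ q hq q₀ hq₀
  have e3 := a2 q hq hAq
  have e4 := a3 q₀ hq₀ hA
  omega

/-- The statement of the structure theorem for blocks. -/
def BlockType {V E C : Type*} [DecidableEq V] [Fintype E] (I : E → Finset V) (F : C → V → ℕ)
    (S : Finset V) : Prop :=
  Monochrome F S ∨ ConstOn F S ∧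
    ((∀ u ∈ S, ∀ v ∈ S, u ≠ v → Adj I u v) ∨ ∀ v ∈ S, degOn I S v = 2)

theorem BlockType.weaken {V E C : Type*} [DecidableEq V] [Fintype E] {I : E → Finset V}
    {F : C → V → ℕ} {S X : Finset V} (h : BlockType I F S) (hX : X ⊆ S) : Monochrome F X ∨ ConstOn F X := by
  rcases h with ⟨c, hc⟩ | ⟨h, -⟩
  · exact Or.inl ⟨c, fun c' hc' v hv => hc c' hc' v (hX hv)⟩
  · exact Or.inr fun c u hu v hv => h c u (hX hu) v (hX hv)

section

variable {V E C : Type*} [DecidableEq V] [Fintype E] [DecidableEq C] [Fintype C] [Nonempty C]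
  {I : E → Finset V} {F : C → V → ℕ} {S X B : Finset V}

/-- For either of the two colors, deleting `v` leaves a smaller block to which the induction
applies. `all_of_shift` then makes adjacency to `v` all or nothing, and connectedness excludes
nothing. -/
theorem adj_of_block_erase (hI : ∀ e, 2 ≤ #(I e)) (hG : IsGraphOn I S) (hS : Block I S)
    (hd : ∀ u ∈ S, degOn I S u ≤ ∑ c, F c u) (hF : ¬ Colorable I F S)
    (ih : ∀ T ⊂ S, ∀ F : C → V → ℕ, Block I T → (∀ u ∈ T, degOn I T u ≤ ∑ c, F c u) →
      ¬ Colorable I F T → BlockType I F T) {c₁ c₂ : C} (hc : c₁ ≠ c₂)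
    (h₁ : ∀ q ∈ S, 0 < F c₁ q) (h₂ : ∀ q ∈ S, 0 < F c₂ q) {v : V} (hv : v ∈ S)
    (hX : Block I (S.erase v)) : ∀ u ∈ S.erase v, Adj I u v := by
  have hXS : S.erase v ⊆ S := erase_subset _ _
  obtain ⟨q₀, hq₀, w, hw, hwX, hqw⟩ := hS.1.exists_adj hG hXS hX.1.1
    (fun h => by rw [← h] at hv; simp at hv)
  have hwv : w = v := by
    by_contra h
    exact hwX (mem_erase.mpr ⟨h, hw⟩)
  subst hwv
  refine all_of_shift hc (fun q hq => h₁ q (hXS hq)) (fun q hq => h₂ q (hXS hq)) ?_ hq₀ hqw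
  intro c hcc
  have hcw : 0 < F c w := by
    rcases hcc with rfl | rfl
    · exact h₁ w hv
    · exact h₂ w hv
  obtain ⟨R, r1, r2, r3, r4, r5⟩ := exists_shift hI hG hv hX.1 hd hF hcw
  exact ⟨R, r1, r2, r3, (ih _ (erase_ssubset hv) R hX r4 r5).weaken subset_rfl⟩

/-- The argument of `adj_of_block_erase`, localized: the capacities of `B - b` are unaffected when
the part of `S - v` outside `B` is colored, so `all_of_shift` applies on `B - b`. Some vertex of `B
- b` sees `v` because `b` is no cut vertex of `S`. -/
theorem adj_of_lobe (hI : ∀ e, 2 ≤ #(I e)) (hG : IsGraphOn I S) (hS : Block I S)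
    (hd : ∀ u ∈ S, degOn I S u ≤ ∑ c, F c u) (hF : ¬ Colorable I F S)
    (ih : ∀ T ⊂ S, ∀ F : C → V → ℕ, Block I T → (∀ u ∈ T, degOn I T u ≤ ∑ c, F c u) →
      ¬ Colorable I F T → BlockType I F T) {c₁ c₂ : C} (hc : c₁ ≠ c₂)
    (h₁ : ∀ q ∈ S, 0 < F c₁ q) (h₂ : ∀ q ∈ S, 0 < F c₂ q) {v b : V} (hv : v ∈ S)
    (hX : Conn I (S.erase v)) (hL : Lobe I (S.erase v) B b) (hB : Block I B) :
    ∀ u ∈ B.erase b, Adj I u v := by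
  have hXS : S.erase v ⊆ S := erase_subset _ _
  obtain ⟨hb, hBX, hBn, hcl, -⟩ := hL
  have hbX := mem_erase.mp (hBX hb)
  have hvb : v ∈ S.erase b := mem_erase.mpr ⟨hbX.1.symm, hv⟩
  have hQX : B.erase b ⊆ S.erase v := (erase_subset _ _).trans hBX
  obtain ⟨q₀, hq₀, w, hw, hwX, hqw⟩ := (hS.2 b hbX.2 ⟨v, hvb⟩).exists_adj
    (hG.mono (erase_subset _ _)) (X := B.erase b)
    (erase_subset_erase _ (hBX.trans hXS)) hBn
    (fun h => by rw [← h] at hvb; have := hQX hvb; simp at this)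
  have hwv : w = v := by
    by_contra h
    have hw' := mem_erase.mp hw
    exact hwX (mem_erase.mpr ⟨hw'.1, hcl q₀ hq₀ w (mem_erase.mpr ⟨h, hw'.2⟩) hqw⟩)
  subst hwv
  refine all_of_shift hc (fun q hq => h₁ q (hXS (hQX hq))) (fun q hq => h₂ q (hXS (hQX hq))) ?_
    hq₀ hqw
  intro c hcc
  have hcw : 0 < F c w := by
    rcases hcc with rfl | rfl
    · exact h₁ w hv
    · exact h₂ w hv
  obtain ⟨R, r1, r2, r3, r4, r5⟩ := exists_shift hI hG hv hX hd hF hcw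
  obtain ⟨R', -, s2, s3, s4⟩ := exists_not_colorable_part hI hX r4 r5 hBX ⟨b, hb⟩
    fun e heX heB => by
      by_contra! h
      have h2 := hG.1 e (heX.trans hXS)
      have : I e ∩ B = I e := eq_of_subset_of_card_le inter_subset_left (by omega)
      exact heB (inter_eq_left.mp this)
  have hR' : ∀ q ∈ B.erase b, ∀ c, R' c q = R c q := by
    intro q hq
    refine s2 q fun e hqe heX x hx => ?_
    by_cases hxq : x = q
    · exact hxq ▸ mem_of_mem_erase hq
    · exact hcl q hq x (heX hx) ⟨e, hG.eq_pair (heX.trans hXS) hqe hx fun h => hxq h.symm⟩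
  have hBS : B ⊂ S := (ssubset_iff_of_subset (hBX.trans hXS)).mpr
    ⟨w, hv, fun h => by have := hBX h; simp at this⟩
  refine ⟨R', fun c' hc' q hq => ?_, fun q hq hA => ?_, fun q hq hA => ?_,
    (ih B hBS R' hB s3 s4).weaken (erase_subset _ _)⟩
  · rw [hR' q hq, r1 c' hc' q (hQX hq)]
  · rw [hR' q hq, r2 q (hQX hq) hA]
  · rw [hR' q hq, r3 q (hQX hq) hA]

/-- Every lobe of `S - v` contains a vertex with only two neighbors in `S`. -/
theorem exists_thin_vertex (hI : ∀ e, 2 ≤ #(I e)) (hG : IsGraphOn I S) (hS : Block I S)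
    (hd : ∀ u ∈ S, degOn I S u ≤ ∑ c, F c u) (hF : ¬ Colorable I F S)
    (ih : ∀ T ⊂ S, ∀ F : C → V → ℕ, Block I T → (∀ u ∈ T, degOn I T u ≤ ∑ c, F c u) →
      ¬ Colorable I F T → BlockType I F T) {c₁ c₂ : C} (hc : c₁ ≠ c₂)
    (h₁ : ∀ q ∈ S, 0 < F c₁ q) (h₂ : ∀ q ∈ S, 0 < F c₂ q) {v b : V} (hv : v ∈ S)
    (hX : Conn I (S.erase v)) (hL : Lobe I (S.erase v) B b) :
    ∃ u ∈ B.erase b, u ∈ S ∧ Adj I u v ∧ ¬ Block I (S.erase u) ∧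
      ∃ t, ∀ w ∈ S, Adj I u w → w = v ∨ w = t := by
  have hXS : S.erase v ⊆ S := erase_subset _ _
  obtain ⟨B', b', hL', hQ, hB'⟩ := hL.exists_block (hG.mono hXS) hX
  have hadj := adj_of_lobe hI hG hS hd hF ih hc h₁ h₂ hv hX hL' hB'
  have hL'' := hL'
  obtain ⟨hb, hBX, ⟨u, hu⟩, hcl, y, hyX, hyB⟩ := hL'
  have hu' := mem_erase.mp hu
  have huS := hXS (hBX hu'.2)
  -- Otherwise `u` would be adjacent to all of `S`, including the vertex `y` outside the lobe.
  have hnb : ¬ Block I (S.erase u) := by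
    intro h
    have := adj_of_block_erase hI hG hS hd hF ih hc h₁ h₂ huS h y
      (mem_erase.mpr ⟨fun h => hyB (h ▸ hu'.2), hXS hyX⟩)
    exact hyB (hcl u hu y hyX this.symm)
  have hone : B'.erase b' = {u} := by
    by_contra h
    exact hnb (block_erase_of_lobe hG hS hv hX hL'' hB' hadj hu h)
  refine ⟨u, hQ hu, huS, hadj u hu, hnb, b', fun w hw huw => ?_⟩
  by_cases hwv : w = v
  · exact Or.inl hwv
  · refine Or.inr ?_
    have hwB := hcl u hu w (mem_erase.mpr ⟨hwv, hw⟩) huw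
    by_contra hwb
    have hwQ : w ∈ B'.erase b' := mem_erase.mpr ⟨hwb, hwB⟩
    rw [hone, mem_singleton] at hwQ
    obtain ⟨e, he⟩ := huw
    have := hI e
    rw [he, hwQ] at this
    simp at this

theorem degOn_eq_two {w q₁ q₂ : V} (hI : ∀ e, 2 ≤ #(I e)) (hG : IsGraphOn I S) (hw : w ∈ S)
    (hq₁ : q₁ ∈ S) (hq₂ : q₂ ∈ S) (hne : q₁ ≠ q₂) (h₁ : Adj I w q₁) (h₂ : Adj I w q₂)
    (h : ∀ x ∈ S, Adj I w x → x = q₁ ∨ x = q₂) : degOn I S w = 2 := by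
  classical
  obtain ⟨e₁, he₁⟩ := h₁
  obtain ⟨e₂, he₂⟩ := h₂
  have hwq : ∀ q e, I e = {w, q} → w ≠ q := fun q e he hq => by
    have := hI e
    rw [he, hq] at this
    simp at this
  refine card_eq_two.mpr ⟨e₁, e₂, fun hee => ?_, ?_⟩
  · have : q₁ ∈ I e₂ := by rw [← hee, he₁]; simp
    rw [he₂] at this
    simp only [mem_insert, mem_singleton, hne, or_false] at this
    exact hwq q₁ e₁ he₁ this.symm
  · ext e
    simp only [mem_filter, mem_univ, true_and, mem_insert, mem_singleton]
    constructor
    · rintro ⟨hwe, heS⟩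
      obtain ⟨x, hx, hxw⟩ := exists_mem_ne (hI e) w
      have hp := hG.eq_pair heS hwe hx hxw.symm
      rcases h x (heS hx) ⟨e, hp⟩ with rfl | rfl
      · exact Or.inl (hG.2 _ _ heS (hp.trans he₁.symm))
      · exact Or.inr (hG.2 _ _ heS (hp.trans he₂.symm))
    · rintro (rfl | rfl)
      · rw [he₁]; exact ⟨by simp, by simp [insert_subset_iff, hw, hq₁]⟩
      · rw [he₂]; exact ⟨by simp, by simp [insert_subset_iff, hw, hq₂]⟩

theorem exists_ne_of_two_le_degOn {u w : V} (hG : IsGraphOn I S) (h : 2 ≤ degOn I S u) : ∃ v ∈ S, v ≠ u ∧ v ≠ w := by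
  by_contra! hcon
  unfold degOn at h
  obtain ⟨e, he, e', he', hee⟩ := one_lt_card.mp h
  simp only [mem_filter, mem_univ, true_and] at he he'
  have key : ∀ e, u ∈ I e → I e ⊆ S → I e = {u, w} := fun e hue heS => by
    obtain ⟨x, hx, hxu⟩ := exists_mem_ne (hG.1 e heS).ge u
    exact (hcon x (heS hx) hxu) ▸ hG.eq_pair heS hue hx hxu.symm
  exact hee (hG.2 e e' he.2 ((key e he.1 he.2).trans (key e' he'.1 he'.2).symm))

/-- Blocks that cannot be partitioned are monochromatic, complete, or cycles. -/
theorem block_structure (hI : ∀ e, 2 ≤ #(I e)) (hG : IsGraphOn I S) (hS : Block I S)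
    (hd : ∀ u ∈ S, degOn I S u ≤ ∑ c, F c u) (hF : ¬ Colorable I F S) : BlockType I F S := by
  induction S using Finset.strongInduction generalizing F with
  | H S ih' =>
    have ih : ∀ T ⊂ S, ∀ F : C → V → ℕ, Block I T → (∀ u ∈ T, degOn I T u ≤ ∑ c, F c u) →
        ¬ Colorable I F T → BlockType I F T :=
      fun T hT F h1 h2 h3 => ih' T hT (hG.mono hT.1) h1 h2 h3
    obtain ⟨v₀, hv₀⟩ := hS.1.1
    by_cases hmono : ∃ c, ∀ c', c' ≠ c → F c' v₀ = 0
    · obtain ⟨c, hc⟩ := hmono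
      refine Or.inl ⟨c, fun c' hc' v hv => ?_⟩
      by_contra h
      have := hS.pos_of_pos hI hG hd hF hv hv₀ (Nat.pos_of_ne_zero h)
      have := hc c' hc'
      omega
    refine Or.inr ?_
    push Not at hmono
    obtain ⟨c₁, -, hc₁⟩ := hmono (Classical.arbitrary C)
    obtain ⟨c₂, hc, hc₂⟩ := hmono c₁
    have h₁ : ∀ q ∈ S, 0 < F c₁ q :=
      fun q hq => hS.pos_of_pos hI hG hd hF hv₀ hq (Nat.pos_of_ne_zero hc₁)
    have h₂ : ∀ q ∈ S, 0 < F c₂ q :=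
      fun q hq => hS.pos_of_pos hI hG hd hF hv₀ hq (Nat.pos_of_ne_zero hc₂)
    have hsum : ∀ q ∈ S, ∑ c, F c q = degOn I S q := fun q hq => sum_eq_degOn hI hS.1 hd hF hq
    have hsub : ∀ q, ∀ T : Finset C, ∑ c ∈ T, F c q ≤ ∑ c, F c q :=
      fun q T => sum_le_sum_of_subset (subset_univ T)
    have htwo : ∀ q ∈ S, 2 ≤ degOn I S q := fun q hq => by
      have := hsub q {c₁, c₂}
      rw [sum_pair hc.symm, hsum q hq] at this
      have := h₁ q hq
      have := h₂ q hq
      omega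
    have hconn : ∀ v ∈ S, Conn I (S.erase v) := fun v hv => by
      obtain ⟨w, hw, hwv, -⟩ := exists_ne_of_two_le_degOn hG (htwo v hv) (w := v)
      exact hS.2 v hv ⟨w, mem_erase.mpr ⟨hwv, hw⟩⟩
    by_cases hbl : ∀ v ∈ S, Block I (S.erase v)
    · have hadj : ∀ u ∈ S, ∀ v ∈ S, u ≠ v → Adj I u v := fun u hu v hv huv =>
        adj_of_block_erase hI hG hS hd hF ih hc.symm h₁ h₂ hv (hbl v hv) u
          (mem_erase.mpr ⟨huv, hu⟩)
      refine ⟨fun c u hu w hw => ?_, Or.inl hadj⟩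
      -- Capacities at `u` and `w` are compared by deleting a third vertex `v`: it is adjacent to
      -- both, so both lose the same unit. If only one color survives, it must be `c`'s rival, and
      -- then both values of `F c` equal `1`.
      obtain ⟨v, hv, hvu, hvw⟩ := exists_ne_of_two_le_degOn hG (htwo u hu) (w := w)
      have hue : u ∈ S.erase v := mem_erase.mpr ⟨hvu.symm, hu⟩
      have hwe : w ∈ S.erase v := mem_erase.mpr ⟨hvw.symm, hw⟩
      by_cases hcv : 0 < F c v
      · obtain ⟨R, r1, r2, r3, r4, r5⟩ := exists_shift hI hG hv (hconn v hv) hd hF hcv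
        have e1 := r3 u hue (hadj u hu v hv hvu.symm)
        have e2 := r3 w hwe (hadj w hw v hv hvw.symm)
        rcases (ih _ (erase_ssubset hv) R (hbl v hv) r4 r5).weaken subset_rfl with
          ⟨c₀, hc₀⟩ | hcon
        · by_cases hcc : c = c₀
          · subst hcc
            have hex : ∃ c', c' ≠ c ∧ 0 < F c' u := by
              by_cases h : c₁ = c
              · exact ⟨c₂, fun h' => hc (h'.trans h.symm), h₂ u hu⟩
              · exact ⟨c₁, h, h₁ u hu⟩
            obtain ⟨c', hc', hpos⟩ := hex
            have := hc₀ c' hc' u hue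
            rw [r1 c' hc' u hue] at this
            omega
          · rw [e1, e2, hc₀ c hcc u hue, hc₀ c hcc w hwe]
        · rw [e1, e2, hcon c u hue w hwe]
      · have key : ∀ x ∈ S, F c x = 0 := fun x hx => by
          by_contra h
          exact hcv (hS.pos_of_pos hI hG hd hF hx hv (Nat.pos_of_ne_zero h))
        rw [key u hu, key w hw]
    · push Not at hbl
      obtain ⟨w₀, hw₀, hw₀b⟩ := hbl
      have thin : ∀ w ∈ S, ¬ Block I (S.erase w) → ∃ q₁ q₂, q₁ ≠ q₂ ∧ ∀ q, (q = q₁ ∨ q = q₂) →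
          q ∈ S ∧ Adj I w q ∧ ¬ Block I (S.erase q) ∧
            ∃ t, ∀ x ∈ S, Adj I q x → x = w ∨ x = t := by
        intro w hw hwb
        obtain ⟨B, B', b, hB, hB', hdis, -⟩ := exists_two_lobes (hconn w hw) hwb
        obtain ⟨q₁, a1, a2, a3, a4, a5⟩ :=
          exists_thin_vertex hI hG hS hd hF ih hc.symm h₁ h₂ hw (hconn w hw) hB
        obtain ⟨q₂, b1, b2, b3, b4, b5⟩ :=
          exists_thin_vertex hI hG hS hd hF ih hc.symm h₁ h₂ hw (hconn w hw) hB'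
        refine ⟨q₁, q₂, fun h => disjoint_left.mp hdis a1 (h ▸ b1), ?_⟩
        rintro q (rfl | rfl)
        · exact ⟨a2, a3.symm, a4, a5⟩
        · exact ⟨b2, b3.symm, b4, b5⟩
      have full : ∀ w ∈ S, ¬ Block I (S.erase w) → degOn I S w = 2 ∧
          ∀ x ∈ S, Adj I w x → ¬ Block I (S.erase x) := by
        intro w hw hwb
        obtain ⟨q₁, q₂, hq, hq'⟩ := thin w hw hwb
        obtain ⟨a1, a2, a3, t, ht⟩ := hq' q₁ (Or.inl rfl)
        obtain ⟨b1, b2, b3, -⟩ := hq' q₂ (Or.inr rfl)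
        obtain ⟨p₁, p₂, hp, hp'⟩ := thin q₁ a1 a3
        obtain ⟨c1, c2, c3, s₁, d1⟩ := hp' p₁ (Or.inl rfl)
        obtain ⟨c1', c2', c3', s₂, d2⟩ := hp' p₂ (Or.inr rfl)
        -- The vertex `q₁` has at most the neighbors `w` and `t`, and two of its neighbors are thin;
        -- so `w` is one of them, and its own neighbors are `q₁` and one more.
        have hws : ∃ s, ∀ x ∈ S, Adj I w x → x = q₁ ∨ x = s := by
          by_cases h : p₁ = w
          · exact ⟨s₁, h ▸ d1⟩
          · by_cases h' : p₂ = w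
            · exact ⟨s₂, h' ▸ d2⟩
            · have e1 := (ht p₁ c1 c2).resolve_left h
              have e2 := (ht p₂ c1' c2').resolve_left h'
              exact absurd (e1.trans e2.symm) hp
        obtain ⟨s, hs⟩ := hws
        have hsq : q₂ = s := (hs q₂ b1 b2).resolve_left hq.symm
        subst hsq
        refine ⟨degOn_eq_two hI hG hw a1 b1 hq a2 b2 hs, fun x hx hwx => ?_⟩
        rcases hs x hx hwx with rfl | rfl
        · exact a3
        · exact b3
      have hall : ∀ w ∈ S, ¬ Block I (S.erase w) := by
        classical
        by_contra! hcon
        obtain ⟨y, hy, hyb⟩ := hcon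
        obtain ⟨u, hu, x, hx, hxn, hux⟩ := hS.1.exists_adj hG
          (X := {w ∈ S | ¬ Block I (S.erase w)}) (filter_subset _ _)
          ⟨w₀, mem_filter.mpr ⟨hw₀, hw₀b⟩⟩ (fun h => by
            rw [← h] at hy; exact (mem_filter.mp hy).2 hyb)
        rw [mem_filter] at hu hxn
        exact hxn ⟨hx, (full u hu.1 hu.2).2 x hx hux⟩
      have hdeg : ∀ w ∈ S, degOn I S w = 2 := fun w hw => (full w hw (hall w hw)).1
      refine ⟨fun c u hu w hw => ?_, Or.inr hdeg⟩
      -- The capacities at a vertex add up to its degree `2`, and both `c₁` and `c₂` take at least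
      -- one unit.
      have key : ∀ x ∈ S, F c x = if c = c₁ ∨ c = c₂ then 1 else 0 := by
        intro x hx
        have e1 := h₁ x hx
        have e2 := h₂ x hx
        have e3 := hsub x {c₁, c₂}
        rw [sum_pair hc.symm, hsum x hx, hdeg x hx] at e3
        split_ifs with h
        · rcases h with rfl | rfl <;> omega
        · rw [not_or] at h
          have e4 := hsub x {c, c₁, c₂}
          rw [sum_insert (by simp [h.1, h.2]), sum_pair hc.symm, hsum x hx, hdeg x hx] at e4
          omega
      rw [key u hu, key w hw]

end

end VariableDegeneracy

/-! ### Blocks of hypergraphs and moving the uncolored vertex. -/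

namespace VariableDegeneracy

open Finset

/-- The hypergraph induced on `S` is connected and has no cut vertex. -/
def HyperBlock {V E : Type*} [DecidableEq V] (I : E → Finset V) (S : Finset V) : Prop :=
  Conn I S ∧ ∀ z ∈ S, ∀ Z ⊆ S.erase z, Z.Nonempty →
    (∀ e, I e ⊆ S → (I e ∩ Z).Nonempty → I e ⊆ insert z Z) → Z = S.erase z

/-- A proper part `B` of `X` which is attached to the rest of `X` by the vertex `b`. -/
def HyperLobe {V E : Type*} [DecidableEq V] (I : E → Finset V) (X B : Finset V) (b : V) : Prop :=
  b ∈ B ∧ B ⊆ X ∧ (B.erase b).Nonempty ∧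
    (∀ e, I e ⊆ X → (I e ∩ B.erase b).Nonempty → I e ⊆ B) ∧ ∃ y ∈ X, y ∉ B

section

variable {V E : Type*} [DecidableEq V] {I : E → Finset V} {S X B : Finset V}

theorem Conn.of_avoid {a : V} (ha : a ∈ S)
    (h : ∀ X ⊆ S, X.Nonempty → a ∉ X → ¬ ClosedIn I S X) : Conn I S := by
  refine ⟨⟨a, ha⟩, fun X hXS hX hcl => ?_⟩
  by_cases haX : a ∈ X
  · by_contra hne
    refine h (S \ X) sdiff_subset ?_ (by simp [haX]) hcl.compl
    exact sdiff_nonempty.mpr fun h => hne (hXS.antisymm h)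
  · exact absurd hcl (h X hXS hX haX)

theorem HyperLobe.conn (hX : Conn I X) {b : V} (hB : HyperLobe I X B b) : Conn I B := by
  obtain ⟨hb, hBX, -, hcl, -⟩ := hB
  refine Conn.of_avoid hb fun Z hZ hZn hbZ h => ?_
  have hZb : Z ⊆ B.erase b := fun u hu => mem_erase.mpr ⟨fun h => hbZ (h ▸ hu), hZ hu⟩
  have := hX.2 Z (hZ.trans hBX) hZn fun e heX hne =>
    h e (hcl e heX (hne.mono (inter_subset_inter_left hZb))) hne
  exact hbZ (this ▸ hBX hb)

/-- A cut vertex of a lobe yields a smaller lobe. -/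
theorem exists_cut_avoiding {z a : V} (hz : z ∈ S) (ha : a ∈ S.erase z) {Z : Finset V}
    (hZ : Z ⊆ S.erase z) (hZn : Z.Nonempty)
    (hcl : ∀ e, I e ⊆ S → (I e ∩ Z).Nonempty → I e ⊆ insert z Z) (hne : Z ≠ S.erase z) :
    ∃ Z ⊆ S.erase z, Z.Nonempty ∧ a ∉ Z ∧
      ∀ e, I e ⊆ S → (I e ∩ Z).Nonempty → I e ⊆ insert z Z := by
  by_cases haZ : a ∈ Z
  · refine ⟨S.erase z \ Z, sdiff_subset, sdiff_nonempty.mpr fun h => hne (hZ.antisymm h),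
      by simp [haZ], fun e heS hn x hx => ?_⟩
    by_cases hxz : x = z
    · exact hxz ▸ mem_insert_self _ _
    refine mem_insert_of_mem (mem_sdiff.mpr ⟨mem_erase.mpr ⟨hxz, heS hx⟩, fun hxZ => ?_⟩)
    obtain ⟨y, hy⟩ := hn
    rw [mem_inter, mem_sdiff] at hy
    rcases mem_insert.mp (hcl e heS ⟨x, mem_inter.mpr ⟨hx, hxZ⟩⟩ hy.1) with rfl | h
    · simp at hy
    · exact hy.2.2 h
  · exact ⟨Z, hZ, hZn, haZ, hcl⟩

/-- Every lobe contains a lobe without cut vertices. -/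
theorem HyperLobe.exists_block (hX : Conn I X) {b : V} (hB : HyperLobe I X B b) :
    ∃ B' b', HyperLobe I X B' b' ∧ HyperBlock I B' := by
  induction B using Finset.strongInduction generalizing b with
  | H B ih =>
    by_cases hbl : HyperBlock I B
    · exact ⟨B, b, hB, hbl⟩
    have : ∃ z ∈ B, ∃ Z ⊆ B.erase z, Z.Nonempty ∧
        (∀ e, I e ⊆ B → (I e ∩ Z).Nonempty → I e ⊆ insert z Z) ∧ Z ≠ B.erase z := by
      by_contra! h
      exact hbl ⟨hB.conn hX, h⟩
    obtain ⟨z, hz, Z₀, hZ₀, hZ₀n, hcl₀, hne⟩ := this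
    obtain ⟨hb, hBX, hBn, hcl, y, hyX, hyB⟩ := hB
    obtain ⟨a, ha, hab⟩ : ∃ a ∈ B.erase z, z = b ∨ a = b := by
      by_cases hzb : z = b
      · subst hzb
        exact ⟨hBn.choose, hBn.choose_spec, Or.inl rfl⟩
      · exact ⟨b, mem_erase.mpr ⟨fun h => hzb h.symm, hb⟩, Or.inr rfl⟩
    obtain ⟨Z, hZ, hZn, haZ, hZcl⟩ := exists_cut_avoiding hz ha hZ₀ hZ₀n hcl₀ hne
    have hzZ : z ∉ Z := fun h => (mem_erase.mp (hZ h)).1 rfl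
    have hbZ : b ∉ Z := by
      rcases hab with rfl | rfl
      · exact hzZ
      · exact haZ
    have hZB : Z ⊆ B := hZ.trans (erase_subset _ _)
    have hZb : Z ⊆ B.erase b := fun u hu => mem_erase.mpr ⟨fun h => hbZ (h ▸ hu), hZB hu⟩
    have hzZB : insert z Z ⊆ B := insert_subset hz hZB
    have hss : insert z Z ⊂ B := by
      refine (ssubset_iff_of_subset hzZB).mpr ⟨a, mem_of_mem_erase ha, fun h => ?_⟩
      exact (mem_insert.mp h).elim (mem_erase.mp ha).1 haZ
    exact ih (insert z Z) hss (b := z) ⟨mem_insert_self _ _, hzZB.trans hBX,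
      by rwa [erase_insert hzZ], fun e heX hn => by
        rw [erase_insert hzZ] at hn
        exact hZcl e (hcl e heX (hn.mono (inter_subset_inter_left hZb))) hn,
      y, hyX, fun h => hyB (hzZB h)⟩

theorem exists_hyperLobe (hS : Conn I S) (hbl : ¬ HyperBlock I S) :
    ∃ B b, HyperLobe I S B b ∧ HyperBlock I B := by
  have : ∃ z ∈ S, ∃ Z ⊆ S.erase z, Z.Nonempty ∧
      (∀ e, I e ⊆ S → (I e ∩ Z).Nonempty → I e ⊆ insert z Z) ∧ Z ≠ S.erase z := by
    by_contra! h
    exact hbl ⟨hS, h⟩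
  obtain ⟨z, hz, Z, hZ, hZn, hcl, hne⟩ := this
  have hzZ : z ∉ Z := fun h => (mem_erase.mp (hZ h)).1 rfl
  obtain ⟨y, hy, hyZ⟩ : ∃ y ∈ S.erase z, y ∉ Z := by
    by_contra! h
    exact hne (hZ.antisymm h)
  have hy' := mem_erase.mp hy
  obtain ⟨B, b, h1, h2⟩ := HyperLobe.exists_block hS (B := insert z Z) (b := z)
    ⟨mem_insert_self _ _, insert_subset hz (hZ.trans (erase_subset _ _)),
      by rwa [erase_insert hzZ], fun e heS hn => by
        rw [erase_insert hzZ] at hn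
        exact hcl e heS hn, y, hy'.2, by simp [hy'.1, hyZ]⟩
  exact ⟨B, b, h1, h2⟩

theorem HyperLobe.compl {b : V} (hB : HyperLobe I S B b) : HyperLobe I S (S \ B.erase b) b := by
  obtain ⟨hb, hBS, ⟨x, hx⟩, hcl, y, hyS, hyB⟩ := hB
  have hyb : y ≠ b := fun h => hyB (h ▸ hb)
  refine ⟨by simp [hBS hb], sdiff_subset, ⟨y, by simp [hyb, hyS, hyB]⟩, fun e heS hne => ?_,
    x, hBS (mem_of_mem_erase hx), by simp [(mem_erase.mp hx).1, (mem_erase.mp hx).2]⟩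
  obtain ⟨z, hz⟩ := hne
  intro u hu
  refine mem_sdiff.mpr ⟨heS hu, fun huB => ?_⟩
  have hzB := hcl e heS ⟨u, mem_inter.mpr ⟨hu, huB⟩⟩ (mem_inter.mp hz).1
  simp only [mem_inter, mem_erase, mem_sdiff] at hz
  exact hz.2.2.2 ⟨hz.2.1, hzB⟩

theorem HyperLobe.card_inter_le {b : V} (hB : HyperLobe I S B b) {e : E} (heS : I e ⊆ S)
    (heB : ¬ I e ⊆ B) : #(I e ∩ B) ≤ 1 := by
  have : I e ∩ B ⊆ {b} := fun x hx => by
    rw [mem_inter] at hx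
    by_contra hxb
    rw [mem_singleton] at hxb
    exact heB (hB.2.2.2.1 e heS ⟨x, mem_inter.mpr ⟨hx.1, mem_erase.mpr ⟨hxb, hx.2⟩⟩⟩)
  simpa using card_le_card this

theorem HyperBlock.block (hG : IsGraphOn I S) (hS : HyperBlock I S) : Block I S := by
  refine ⟨hS.1, fun z hz hn => ⟨hn, fun Z hZ hZn hcl => hS.2 z hz Z hZ hZn ?_⟩⟩
  intro e heS hne x hx
  by_cases hze : z ∈ I e
  · obtain ⟨y, hy⟩ := hne
    rw [mem_inter] at hy
    have hyz : y ≠ z := (mem_erase.mp (hZ hy.2)).1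
    rw [hG.eq_pair heS hy.1 hze hyz, mem_insert, mem_singleton] at hx
    rcases hx with rfl | rfl
    · exact mem_insert_of_mem hy.2
    · exact mem_insert_self _ _
  · exact mem_insert_of_mem (hcl e (fun w hw => mem_erase.mpr ⟨fun h => hze (h ▸ hw), heS hw⟩)
      hne hx)

end

section

variable {V E C : Type*} [DecidableEq V] [Fintype E] [DecidableEq C] [Fintype C] [Nonempty C]
  {I : E → Finset V} {F : C → V → ℕ} {S X B : Finset V}

/-- `φ` is a partition of `S - v` as required. -/
def ValidOff {V E C : Type*} [DecidableEq V] [Fintype E] [DecidableEq C] (I : E → Finset V)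
    (F : C → V → ℕ) (S : Finset V) (v : V) (φ : V → C) : Prop :=
  ∀ c, Degenerate I (F c) {u ∈ S.erase v | φ u = c}

theorem exists_validOff (hI : ∀ e, 2 ≤ #(I e)) (hS : Conn I S)
    (hd : ∀ v ∈ S, degOn I S v ≤ ∑ c, F c v) {v : V} (hv : v ∈ S) : ∃ φ, ValidOff I F S v φ :=
  colorable_of_ssubset hI hS hd (erase_ssubset hv)

/-- The edges at the uncolored vertex are monochromatic otherwise, and each color occurs as often
as the capacity allows. -/
theorem ValidOff.exact (hI : ∀ e, 2 ≤ #(I e)) (hS : Conn I S)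
    (hd : ∀ v ∈ S, degOn I S v ≤ ∑ c, F c v) (hF : ¬ Colorable I F S) {v : V} (hv : v ∈ S)
    {φ : V → C} (hφ : ValidOff I F S v φ) :
    (∀ c, degOn I (insert v {u ∈ S.erase v | φ u = c}) v = F c v) ∧
      ∀ e, v ∈ I e → I e ⊆ S → ∃ c, ∀ x ∈ I e, x ≠ v → φ x = c := by
  classical
  -- If fewer edges ran to class `c`, then `v` could receive color `c`. Since the capacities add up
  -- to the degree, all these inequalities are equalities and no edge at `v` remains for a mixed set
  -- of colors.
  have hge : ∀ c, F c v ≤ degOn I (insert v {u ∈ S.erase v | φ u = c}) v := by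
    by_contra! hcon
    obtain ⟨c, hc⟩ := hcon
    refine hF ⟨Function.update φ v c, fun c' => ?_⟩
    by_cases hcc : c' = c
    · subst hcc
      refine ((hφ c').insert hc).mono fun u hu => ?_
      rw [mem_filter] at hu
      by_cases huv : u = v
      · simp [huv]
      · simpa [huv, hu.1] using hu.2
    · refine (hφ c').mono fun u hu => ?_
      rw [mem_filter] at hu
      by_cases huv : u = v
      · subst huv; simp at hu; exact absurd hu.2.symm hcc
      · simpa [huv, hu.1] using hu.2
  set A : C → Finset E := fun c =>
    {e | v ∈ I e ∧ I e ⊆ insert v {u ∈ S.erase v | φ u = c}} with hA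
  have hmem : ∀ c e, e ∈ A c → v ∈ I e ∧ I e ⊆ S ∧ ∀ x ∈ I e, x ≠ v → φ x = c := by
    intro c e he
    simp only [hA, mem_filter, mem_univ, true_and] at he
    refine ⟨he.1, fun x hx => ?_, fun x hx hxv => ?_⟩
    · rcases mem_insert.mp (he.2 hx) with rfl | h
      · exact hv
      · exact mem_of_mem_erase (mem_filter.mp h).1
    · exact (mem_filter.mp ((mem_insert.mp (he.2 hx)).resolve_left hxv)).2
  have hdis : (Set.univ : Set C).PairwiseDisjoint A := by
    intro c _ c' _ hcc
    refine disjoint_left.mpr fun e he he' => hcc ?_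
    obtain ⟨u, hu, huv⟩ := exists_mem_ne (hI e) v
    exact ((hmem c e he).2.2 u hu huv).symm.trans ((hmem c' e he').2.2 u hu huv)
  have hsub : univ.biUnion A ⊆ ({e | v ∈ I e ∧ I e ⊆ S} : Finset E) := fun e he => by
    obtain ⟨c, -, hc⟩ := mem_biUnion.mp he
    have := hmem c e hc
    simp [this.1, this.2.1]
  have hcard : #(univ.biUnion A) = ∑ c, #(A c) := card_biUnion fun c _ c' _ h => hdis
    (Set.mem_univ _) (Set.mem_univ _) h
  have hsum : ∑ c, F c v = #({e | v ∈ I e ∧ I e ⊆ S} : Finset E) := sum_eq_degOn hI hS hd hF hv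
  have hle : ∑ c, F c v ≤ ∑ c, #(A c) := sum_le_sum fun c _ => hge c
  have hle' := card_le_card hsub
  have heq : ∑ c, F c v = ∑ c, #(A c) := by omega
  refine ⟨fun c => ((sum_eq_sum_iff_of_le fun c _ => hge c).mp heq c (mem_univ c)).symm,
    fun e hve heS => ?_⟩
  have hfull := eq_of_subset_of_card_le hsub (by omega)
  have he : e ∈ univ.biUnion A := by rw [hfull]; simp [hve, heS]
  obtain ⟨c, -, hc⟩ := mem_biUnion.mp he
  exact ⟨c, (hmem c e hc).2.2⟩

/-- The uncolored vertex can be moved along an edge. -/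
theorem ValidOff.slide (hI : ∀ e, 2 ≤ #(I e)) (hS : Conn I S)
    (hd : ∀ v ∈ S, degOn I S v ≤ ∑ c, F c v) (hF : ¬ Colorable I F S) {v u : V} (hv : v ∈ S)
    {φ : V → C} (hφ : ValidOff I F S v φ) {e : E} (heS : I e ⊆ S) (hve : v ∈ I e) (hue : u ∈ I e)
    (huv : u ≠ v) : ∃ c, (∀ x ∈ I e, x ≠ v → φ x = c) ∧ 0 < F c v ∧
      ValidOff I F S u (Function.update φ v c) := by
  obtain ⟨h1, h2⟩ := hφ.exact hI hS hd hF hv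
  obtain ⟨c, hc⟩ := h2 e hve heS
  have hin : I e ⊆ insert v {u ∈ S.erase v | φ u = c} := fun x hx => by
    by_cases hxv : x = v
    · simp [hxv]
    · simp [hxv, heS hx, hc x hx hxv]
  -- Uncoloring `u` removes the edge `e` from the class of color `c`, which frees exactly the room
  -- that `v` needs.
  have hlt : degOn I (insert v (({u ∈ S.erase v | φ u = c} : Finset V).erase u)) v < F c v := by
    rw [← h1 c]
    refine degOn_lt (insert_subset_insert _ (erase_subset _ _)) hve hin fun h => ?_
    have := h hue
    simp [huv] at this
  refine ⟨c, hc, by omega, fun c' => ?_⟩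
  by_cases hcc : c' = c
  · subst hcc
    refine (((hφ c').mono (erase_subset u _)).insert hlt).mono fun x hx => ?_
    rw [mem_filter, mem_erase] at hx
    by_cases hxv : x = v
    · simp [hxv]
    · rw [Function.update_of_ne hxv] at hx
      simp [hxv, hx.1.1, hx.1.2, hx.2]
  · refine (hφ c').mono fun x hx => ?_
    rw [mem_filter, mem_erase] at hx
    by_cases hxv : x = v
    · subst hxv; simp at hx; exact absurd hx.2.symm hcc
    · rw [Function.update_of_ne hxv] at hx
      simp [hxv, hx.1.2, hx.2]

/-- In a block the uncolored vertex can be moved to an edge `e` without touching `e` before, and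
without passing through the vertex `a` of `e`. -/
theorem ValidOff.walk (hI : ∀ e, 2 ≤ #(I e)) (hS : HyperBlock I S)
    (hd : ∀ v ∈ S, degOn I S v ≤ ∑ c, F c v) (hF : ¬ Colorable I F S) {x a : V}
    (hx : x ∈ S.erase a) {φ : V → C} (hφ : ValidOff I F S x φ) {e : E} (heS : I e ⊆ S)
    (ha : a ∈ I e) : ∃ y ∈ I e, y ≠ a ∧ ∃ φ', ValidOff I F S y φ' ∧ ∀ w ∈ I e, φ' w = φ w := by
  classical
  by_contra! hcon
  -- Positions the uncolored vertex can reach without changing colors on `e`. If none of them lay on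
  -- `e`, they would be closed under sliding away from `a`; as `a` is no cut vertex they would
  -- exhaust `S - a`, which meets `e`.
  set Z : Finset V := {z ∈ S.erase a | ∃ φ', ValidOff I F S z φ' ∧ ∀ w ∈ I e, φ' w = φ w} with hZ
  have hZe : ∀ z ∈ Z, z ∉ I e := fun z hz hze => by
    obtain ⟨hza, φ', h1, h2⟩ := mem_filter.mp hz
    obtain ⟨w, hw, hne⟩ := hcon z hze (mem_erase.mp hza).1 φ' h1
    exact hne (h2 w hw)
  have hZeq := hS.2 a (heS ha) Z (filter_subset _ _)
    ⟨x, mem_filter.mpr ⟨hx, φ, hφ, fun _ _ => rfl⟩⟩ (by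
      intro g hgS hgZ u hu
      obtain ⟨z, hz⟩ := hgZ
      obtain ⟨hzg, hzZ⟩ := mem_inter.mp hz
      obtain ⟨hza, φ', h1, h2⟩ := mem_filter.mp hzZ
      by_cases hua : u = a
      · simp [hua]
      refine mem_insert_of_mem ?_
      by_cases huz : u = z
      · exact huz ▸ hzZ
      obtain ⟨c, -, -, h3⟩ := h1.slide hI hS.1 hd hF (mem_of_mem_erase hza) hgS hzg hu huz
      refine mem_filter.mpr ⟨mem_erase.mpr ⟨hua, hgS hu⟩, _, h3, fun w hw => ?_⟩
      have hwz : w ≠ z := fun h => hZe z hzZ (h ▸ hw)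
      rw [Function.update_of_ne hwz, h2 w hw])
  obtain ⟨y, hy, hya⟩ := exists_mem_ne (hI e) a
  exact hZe y (hZeq ▸ mem_erase.mpr ⟨hya, heS hy⟩) hy

theorem exists_edge_of_pos (hI : ∀ e, 2 ≤ #(I e)) (hS : Conn I S)
    (hd : ∀ v ∈ S, degOn I S v ≤ ∑ c, F c v) (hF : ¬ Colorable I F S) {v : V} (hv : v ∈ S)
    {φ : V → C} (hφ : ValidOff I F S v φ) {c : C} (hc : 0 < F c v) :
    ∃ e, v ∈ I e ∧ I e ⊆ S ∧ ∀ x ∈ I e, x ≠ v → φ x = c := by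
  rw [← (hφ.exact hI hS hd hF hv).1 c] at hc
  obtain ⟨e, he⟩ := card_pos.mp hc
  simp only [mem_filter, mem_univ, true_and] at he
  refine ⟨e, he.1, fun x hx => ?_, fun x hx hxv => ?_⟩
  · rcases mem_insert.mp (he.2 hx) with rfl | h
    · exact hv
    · exact mem_of_mem_erase (mem_filter.mp h).1
  · exact (mem_filter.mp ((mem_insert.mp (he.2 hx)).resolve_left hxv)).2

/-- A vertex of an edge can be given any of its colors while another vertex of the edge is
uncolored. -/
theorem exists_validOff_color (hI : ∀ e, 2 ≤ #(I e)) (hS : HyperBlock I S)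
    (hd : ∀ v ∈ S, degOn I S v ≤ ∑ c, F c v) (hF : ¬ Colorable I F S) {a : V} {e : E}
    (heS : I e ⊆ S) (ha : a ∈ I e) {φ : V → C} (hφ : ValidOff I F S a φ) {c : C}
    (hc : 0 < F c a) : ∃ y ∈ I e, y ≠ a ∧ ∃ φ', ValidOff I F S y φ' ∧ φ' a = c ∧
      ∀ w ∈ I e, w ≠ a → φ' w = φ w := by
  obtain ⟨e₁, hae, he₁S, hcol⟩ := exists_edge_of_pos hI hS.1 hd hF (heS ha) hφ hc
  obtain ⟨x, hx, hxa⟩ := exists_mem_ne (hI e₁) a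
  obtain ⟨c', h1, -, h2⟩ := hφ.slide hI hS.1 hd hF (heS ha) he₁S hae hx hxa
  have hcc : c' = c := (h1 x hx hxa).symm.trans (hcol x hx hxa)
  subst hcc
  obtain ⟨y, hy, hya, φ', h3, h4⟩ :=
    h2.walk hI hS hd hF (mem_erase.mpr ⟨hxa, he₁S hx⟩) heS ha
  refine ⟨y, hy, hya, φ', h3, by rw [h4 a ha]; simp, fun w hw hwa => ?_⟩
  rw [h4 w hw, Function.update_of_ne hwa]

/-- Along an edge `e` through `a`, give `a` the color `c` with another vertex `y` of `e` uncolored.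
Then the colored part of `e` has color `c`, and sliding inside `e` puts color `c` on any vertex of
`e`, which requires positive capacity there. -/
theorem HyperBlock.pos_of_pos (hI : ∀ e, 2 ≤ #(I e)) (hS : HyperBlock I S)
    (hd : ∀ v ∈ S, degOn I S v ≤ ∑ c, F c v) (hF : ¬ Colorable I F S) {c : C} {u v : V}
    (hu : u ∈ S) (hv : v ∈ S) (hc : 0 < F c u) : 0 < F c v := by
  have key : ({x ∈ S | 0 < F c x} : Finset V) = S := by
    refine hS.1.2 _ (filter_subset _ _) ⟨u, mem_filter.mpr ⟨hu, hc⟩⟩ fun e heS hne b hb => ?_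
    obtain ⟨a, ha⟩ := hne
    simp only [mem_inter, mem_filter] at ha
    refine mem_filter.mpr ⟨heS hb, ?_⟩
    obtain ⟨φ, hφ⟩ := exists_validOff hI hS.1 hd (heS ha.1)
    obtain ⟨y, hy, hya, φ', h1, h2, -⟩ := exists_validOff_color hI hS hd hF heS ha.1 hφ ha.2.2
    obtain ⟨c₁, h3, h4, h5⟩ := h1.slide hI hS.1 hd hF (heS hy) heS hy ha.1 hya.symm
    have hc₁ : c₁ = c := (h3 a ha.1 hya.symm).symm.trans h2
    subst hc₁
    by_cases hba : b = a
    · exact hba ▸ ha.2.2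
    by_cases hby : b = y
    · exact hby ▸ h4
    obtain ⟨c₂, h6, -, h7⟩ := h1.slide hI hS.1 hd hF (heS hy) heS hy hb hby
    have hc₂ : c₂ = c₁ := (h6 a ha.1 hya.symm).symm.trans h2
    subst hc₂
    obtain ⟨c₃, h8, h9, -⟩ := h7.slide hI hS.1 hd hF (heS hb) heS hb ha.1 fun h => hba h.symm
    have := h8 a ha.1 fun h => hba h.symm
    rw [Function.update_of_ne hya.symm, h2] at this
    exact this ▸ h9
  rw [← key] at hv
  exact (mem_filter.mp hv).2

/-- A vertex with two colors lies in no edge with more than two vertices. -/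
theorem HyperBlock.card_eq_two (hI : ∀ e, 2 ≤ #(I e)) (hS : HyperBlock I S)
    (hd : ∀ v ∈ S, degOn I S v ≤ ∑ c, F c v) (hF : ¬ Colorable I F S) {c₁ c₂ : C} (hc : c₁ ≠ c₂)
    {a : V} {e : E} (heS : I e ⊆ S) (ha : a ∈ I e) (h₁ : 0 < F c₁ a) (h₂ : 0 < F c₂ a) :
    #(I e) = 2 := by
  by_contra hne
  have h3 : 2 < #(I e) := lt_of_le_of_ne (hI e) (Ne.symm hne)
  obtain ⟨φ, hφ⟩ := exists_validOff hI hS.1 hd (heS ha)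
  obtain ⟨c, hc'⟩ := (hφ.exact hI hS.1 hd hF (heS ha)).2 e ha heS
  -- With `a` uncolored, the rest of `e` has color `c`. Recoloring `a` by `c'` uncolors some `y` but
  -- keeps a third vertex of `e` in color `c`, so `e - y` is not monochromatic, against
  -- `ValidOff.exact`.
  obtain ⟨c', hcc, hpos⟩ : ∃ c', c' ≠ c ∧ 0 < F c' a := by
    by_cases h : c₁ = c
    · exact ⟨c₂, fun h' => hc (h.trans h'.symm), h₂⟩
    · exact ⟨c₁, h, h₁⟩
  obtain ⟨y, hy, hya, φ', a1, a2, a3⟩ := exists_validOff_color hI hS hd hF heS ha hφ hpos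
  obtain ⟨d, hd'⟩ := (a1.exact hI hS.1 hd hF (heS hy)).2 e hy heS
  obtain ⟨w, hw, hwy⟩ : ∃ w ∈ (I e).erase a, w ≠ y :=
    exists_mem_ne (by rw [card_erase_of_mem ha]; omega) y
  have hw' := mem_erase.mp hw
  have e1 := hd' a ha hya.symm
  have e2 := hd' w hw'.2 hwy
  rw [a3 w hw'.2 hw'.1, hc' w hw'.2 hw'.1] at e2
  exact hcc (a2.symm.trans (e1.trans e2.symm))

/-- Blocks that cannot be partitioned are monochromatic, or simple graphs of block type. -/
theorem hyperBlock_structure (hI : ∀ e, 2 ≤ #(I e)) (hS : HyperBlock I S)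
    (hinj : ∀ e e', I e ⊆ S → #(I e) = 2 → I e = I e' → e = e')
    (hd : ∀ u ∈ S, degOn I S u ≤ ∑ c, F c u) (hF : ¬ Colorable I F S) :
    Monochrome F S ∨ IsGraphOn I S ∧
      ((∀ u ∈ S, ∀ v ∈ S, u ≠ v → Adj I u v) ∨ ∀ v ∈ S, degOn I S v = 2) := by
  obtain ⟨v₀, hv₀⟩ := hS.1.1
  by_cases hmono : ∃ c, ∀ c', c' ≠ c → F c' v₀ = 0
  · obtain ⟨c, hc⟩ := hmono
    refine Or.inl ⟨c, fun c' hc' v hv => ?_⟩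
    by_contra h
    have := hS.pos_of_pos hI hd hF hv hv₀ (Nat.pos_of_ne_zero h)
    have := hc c' hc'
    omega
  push Not at hmono
  obtain ⟨c₁, -, hc₁⟩ := hmono (Classical.arbitrary C)
  obtain ⟨c₂, hc, hc₂⟩ := hmono c₁
  have hpos : ∀ c, F c v₀ ≠ 0 → ∀ q ∈ S, 0 < F c q :=
    fun c hc q hq => hS.pos_of_pos hI hd hF hv₀ hq (Nat.pos_of_ne_zero hc)
  have hG : IsGraphOn I S := by
    have h2 : ∀ e, I e ⊆ S → #(I e) = 2 := fun e heS => by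
      obtain ⟨a, ha, -⟩ := exists_mem_ne (hI e) v₀
      exact hS.card_eq_two hI hd hF hc heS ha (hpos c₂ hc₂ a (heS ha)) (hpos c₁ hc₁ a (heS ha))
    exact ⟨h2, fun e e' heS => hinj e e' heS (h2 e heS)⟩
  rcases block_structure hI hG (hS.block hG) hd hF with h | ⟨-, h⟩
  · exact Or.inl h
  · exact Or.inr ⟨hG, h⟩

end

end VariableDegeneracy

/-! ### Degree counts and the potential. -/

namespace VariableDegeneracy

open Finset

section

variable {V E : Type*} [DecidableEq V] [Fintype E] {I : E → Finset V} {S T B X : Finset V}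

theorem Conn.degOn_pos (hS : Conn I S) {v w : V} (hv : v ∈ S) (hw : w ∈ S) (hwv : w ≠ v) :
    0 < degOn I S v := by
  have h : ¬ ClosedIn I S {v} := fun h => by
    have := hS.2 {v} (by simpa using hv) (by simp) h
    rw [← this] at hw
    exact hwv (by simpa using hw)
  unfold ClosedIn at h
  push Not at h
  obtain ⟨e, heS, ⟨x, hx⟩, -⟩ := h
  rw [mem_inter, mem_singleton] at hx
  exact card_pos.mpr ⟨e, by simpa using ⟨hx.2 ▸ hx.1, heS⟩⟩

theorem degOn_le_sum (hI : ∀ e, 2 ≤ #(I e)) (x : V) :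
    degOn I S x ≤ ∑ y ∈ S.erase x, degOn I S y := by
  classical
  refine le_trans (card_le_card fun e he => ?_) (card_biUnion_le (s := S.erase x)
    (t := fun y => ({e | y ∈ I e ∧ I e ⊆ S} : Finset E)))
  simp only [mem_filter, mem_univ, true_and] at he
  obtain ⟨y, hy, hyx⟩ := exists_mem_ne (hI e) x
  exact mem_biUnion.mpr ⟨y, mem_erase.mpr ⟨hyx, he.2 hy⟩, by simp [hy, he.2]⟩

open Classical in
theorem degOn_eq_card_adj (hG : IsGraphOn I S) {v : V} (hv : v ∈ S) :
    degOn I S v = #{w ∈ S.erase v | Adj I v w} := by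
  refine (card_bij (fun w hw => (mem_filter.mp hw).2.choose) ?_ ?_ ?_).symm
  · intro w hw
    have hspec := (mem_filter.mp hw).2.choose_spec
    have hwS := mem_of_mem_erase (mem_filter.mp hw).1
    simp only [mem_filter, mem_univ, true_and, hspec]
    exact ⟨by simp, by simp [insert_subset_iff, hv, hwS]⟩
  · intro w hw w' hw' h
    have hspec := (mem_filter.mp hw).2.choose_spec
    have hspec' := (mem_filter.mp hw').2.choose_spec
    rw [← h, hspec] at hspec'
    have : w ∈ ({v, w'} : Finset V) := by rw [← hspec']; simp
    have hne := (mem_erase.mp (mem_filter.mp hw).1).1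
    simpa [hne] using this
  · intro e he
    simp only [mem_filter, mem_univ, true_and] at he
    obtain ⟨w, hw, hwv⟩ := exists_mem_ne (hG.1 e he.2).ge v
    have hp := hG.eq_pair he.2 he.1 hw hwv.symm
    have hmem : w ∈ ({w ∈ S.erase v | Adj I v w} : Finset V) :=
      mem_filter.mpr ⟨mem_erase.mpr ⟨hwv, he.2 hw⟩, e, hp⟩
    refine ⟨w, hmem, (hG.2 e _ he.2 ?_).symm⟩
    exact hp.trans (mem_filter.mp hmem).2.choose_spec.symm

theorem degOn_lt_card (hG : IsGraphOn I S) {v : V} (hv : v ∈ S) : degOn I S v + 1 ≤ #S := by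
  classical
  rw [degOn_eq_card_adj hG hv]
  refine (Nat.add_le_add_right (card_filter_le _ _) 1).trans_eq ?_
  rw [card_erase_add_one hv]

theorem degOn_of_complete (hG : IsGraphOn I S) (hc : ∀ u ∈ S, ∀ v ∈ S, u ≠ v → Adj I u v) {v : V}
    (hv : v ∈ S) : degOn I S v + 1 = #S := by
  classical
  rw [degOn_eq_card_adj hG hv, filter_true_of_mem, card_erase_of_mem hv]
  · have := card_pos.mpr ⟨v, hv⟩
    omega
  · intro w hw
    have := mem_erase.mp hw
    exact hc v hv w this.2 this.1.symm

theorem HyperLobe.degOn_eq {b : V} (hB : HyperLobe I S B b) {v : V} (hv : v ∈ B.erase b) :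
    degOn I S v = degOn I B v := by
  refine congrArg card (filter_congr fun e _ => ?_)
  constructor
  · rintro ⟨h1, h2⟩
    exact ⟨h1, hB.2.2.2.1 e h2 ⟨v, mem_inter.mpr ⟨h1, hv⟩⟩⟩
  · rintro ⟨h1, h2⟩
    exact ⟨h1, h2.trans hB.2.1⟩

theorem HyperLobe.degOn_root (hI : ∀ e, 2 ≤ #(I e)) {b : V} (hB : HyperLobe I S B b) :
    degOn I S b = degOn I B b + degOn I (S \ B.erase b) b := by
  classical
  unfold degOn
  rw [← card_union_of_disjoint]
  · congr 1
    ext e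
    simp only [mem_union, mem_filter, mem_univ, true_and]
    constructor
    · rintro ⟨h1, h2⟩
      by_cases h : (I e ∩ B.erase b).Nonempty
      · exact Or.inl ⟨h1, hB.2.2.2.1 e h2 h⟩
      · refine Or.inr ⟨h1, fun x hx => mem_sdiff.mpr ⟨h2 hx, fun hxB => h ⟨x, ?_⟩⟩⟩
        exact mem_inter.mpr ⟨hx, hxB⟩
    · rintro (⟨h1, h2⟩ | ⟨h1, h2⟩)
      · exact ⟨h1, h2.trans hB.2.1⟩
      · exact ⟨h1, h2.trans sdiff_subset⟩
  · refine disjoint_left.mpr fun e he he' => ?_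
    simp only [mem_filter, mem_univ, true_and] at he he'
    obtain ⟨x, hx, hxb⟩ := exists_mem_ne (hI e) b
    exact (mem_sdiff.mp (he'.2 hx)).2 (mem_erase.mpr ⟨hxb, he.2 hx⟩)

/-- The potential of `S` with the set `T` of marked vertices, which count `1`. -/
noncomputable def potential (I : E → Finset V) (β : ℝ) (S T : Finset V) : ℝ :=
  ∑ v ∈ S, if v ∈ T then 1 else β - degOn I S v

/-- The attachment vertex `b` is counted on both sides and its degree splits between them, so one
`β` is counted too often. -/
theorem HyperLobe.potential_eq (hI : ∀ e, 2 ≤ #(I e)) {b : V} (hB : HyperLobe I S B b) (hbT : b ∉ T)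
    (β : ℝ) : potential I β S T =
      potential I β B T + potential I β (S \ B.erase b) T - β := by
  have hY := hB.compl
  have h1 : S.erase b = B.erase b ∪ (S \ B.erase b).erase b := by
    ext x
    simp only [mem_union, mem_erase, mem_sdiff]
    constructor
    · tauto
    · rintro (h | h)
      · exact ⟨h.1, hB.2.1 h.2⟩
      · tauto
  have h2 : Disjoint (B.erase b) ((S \ B.erase b).erase b) :=
    disjoint_left.mpr fun x hx hx' => (mem_sdiff.mp (mem_of_mem_erase hx')).2 hx
  unfold potential
  rw [← add_sum_erase S _ (hB.2.1 hB.1), ← add_sum_erase B _ hB.1, ← add_sum_erase _ _ hY.1,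
    h1, sum_union h2, hB.degOn_root hI, sum_congr rfl fun v hv => by rw [hB.degOn_eq hv],
    sum_congr (s₁ := (S \ B.erase b).erase b) rfl fun v hv => by rw [hY.degOn_eq hv]]
  simp only [hbT, if_false]
  push_cast
  ring

/-- The reason for marks: cutting off a `K_δ`, of potential `2`, at a vertex `b` of remaining degree
`1` changes the potential exactly as replacing the weight `β - 1` of `b` by `1`. A mark thus records
a `K_δ` hanging at `b`. -/
theorem potential_insert {b : V} (hb : b ∈ S) (hbT : b ∉ T) (β : ℝ) :
    potential I β S T = potential I β S (insert b T) + (β - degOn I S b) - 1 := by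
  unfold potential
  rw [← add_sum_erase S _ hb, ← add_sum_erase S (fun v => if v ∈ insert b T then _ else _) hb]
  have : ∑ x ∈ S.erase b, (if x ∈ insert b T then (1 : ℝ) else β - degOn I S x) =
      ∑ x ∈ S.erase b, if x ∈ T then (1 : ℝ) else β - degOn I S x := by
    refine sum_congr rfl fun x hx => ?_
    simp [(mem_erase.mp hx).1]
  rw [this]
  simp only [hbT, if_false, mem_insert_self, if_true]
  ring

theorem potential_split (β : ℝ) : potential I β S T =
    #{v ∈ S | v ∈ T} + ∑ v ∈ S with v ∉ T, (β - degOn I S v) := by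
  unfold potential
  rw [sum_ite]
  simp

theorem potential_regular (β : ℝ) {d : ℕ} (hd : ∀ v ∈ S, degOn I S v = d)
    (hT : ∀ v ∈ S, v ∉ T) : potential I β S T = #S * (β - d) := by
  unfold potential
  rw [sum_congr rfl fun v hv => by rw [if_neg (hT v hv), hd v hv], sum_const, nsmul_eq_mul]

/-- The sparse case: blocks of small degree have large potential. -/
theorem le_potential_of_small (hI : ∀ e, 2 ≤ #(I e)) {δ : ℕ} {β : ℝ} (hβ0 : 2 ≤ β) (hβ : (δ : ℝ) / 2 + 1 ≤ β)
    (hβ' : (δ : ℝ) ≤ β + 1) (hsmall : ∀ v ∈ S, 2 * degOn I S v ≤ δ)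
    (htwo : #S ≤ 2 → ∀ v ∈ S, degOn I S v ≤ 1) (hT : ∀ v ∈ S, v ∈ T → degOn I S v = 1) {x : V}
    (hx : x ∈ S) (hxT : x ∉ T) : β ≤ potential I β S T ∧
      ∀ b ∈ S, b ∉ T → b ≠ x → degOn I S b = 1 → 2 * β - 2 ≤ potential I β S T := by
  have hδ0 : (0 : ℝ) ≤ δ := Nat.cast_nonneg _
  rw [potential_split]
  have hUx : x ∈ {v ∈ S | v ∉ T} := mem_filter.mpr ⟨hx, hxT⟩
  set A : Finset V := {v ∈ S | v ∈ T} with hA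
  set U : Finset V := {v ∈ S | v ∉ T} with hU
  have hcard : #A + #U = #S := card_filter_add_card_filter_not _
  have hA0 : (0 : ℝ) ≤ #A := Nat.cast_nonneg _
  have hlow : ∀ W ⊆ S, (#W : ℝ) * (β - δ / 2) ≤ ∑ v ∈ W, (β - degOn I S v) := by
    intro W hW
    rw [← nsmul_eq_mul]
    refine card_nsmul_le_sum _ _ _ fun v hv => ?_
    have : (2 * degOn I S v : ℝ) ≤ δ := by exact_mod_cast hsmall v (hW hv)
    linarith
  have hsumA : ∑ v ∈ A, degOn I S v = #A := by
    rw [card_eq_sum_ones]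
    exact sum_congr rfl fun v hv => hT v (mem_filter.mp hv).1 (mem_filter.mp hv).2
  have hdx : (degOn I S x : ℝ) ≤ #A + ∑ v ∈ U.erase x, (degOn I S v : ℝ) := by
    have h1 := degOn_le_sum hI (S := S) x
    have h2 : S.erase x = A ∪ U.erase x := by
      ext v
      simp only [hA, hU, mem_union, mem_erase, mem_filter]
      constructor
      · tauto
      · rintro (h | h)
        · exact ⟨fun h' => hxT (h' ▸ h.2), h.1⟩
        · tauto
    have h3 : Disjoint A (U.erase x) := disjoint_left.mpr fun v hv hv' =>
      (mem_filter.mp (mem_of_mem_erase hv')).2 (mem_filter.mp hv).2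
    rw [h2, sum_union h3, hsumA] at h1
    exact_mod_cast h1
  have hUS : U ⊆ S := filter_subset _ _
  have hUpos := card_pos.mpr ⟨x, hUx⟩
  constructor
  -- A lone unmarked vertex has degree at most the number of marked ones, each of degree `1`. With
  -- two unmarked vertices, either `S` has two vertices and `2(β - 1) ≥ β`, or a marked vertex
  -- contributes `1` and `β ≥ δ - 1` suffices. With three, the claim `2β ≥ 3δ/2` is the sum of the
  -- two lower bounds for `β`.
  · obtain h | h | h : #U = 1 ∨ #U = 2 ∨ 3 ≤ #U := by omega
    · obtain ⟨y, hy⟩ := card_eq_one.mp h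
      have hxy : x = y := by rw [hy] at hUx; simpa using hUx
      subst hxy
      rw [hy] at hdx ⊢
      simp only [sum_singleton, erase_singleton, sum_empty] at hdx ⊢
      linarith
    · by_cases hA1 : #A = 0
      · have hdeg := htwo (by omega)
        have : ∑ v ∈ U, (β - 1) ≤ ∑ v ∈ U, (β - degOn I S v) := sum_le_sum fun v hv => by
          have : (degOn I S v : ℝ) ≤ 1 := by exact_mod_cast hdeg v (hUS hv)
          linarith
        rw [sum_const, h, nsmul_eq_mul] at this
        push_cast at this
        linarith
      · have h1 := hlow U hUS
        have h2 : (1 : ℝ) ≤ #A := by exact_mod_cast Nat.pos_of_ne_zero hA1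
        rw [h] at h1
        push_cast at h1
        linarith
    · have h1 := hlow U hUS
      have h2 : (3 : ℝ) ≤ #U := by exact_mod_cast h
      have h3 : 3 * (β - δ / 2) ≤ #U * (β - δ / 2) :=
        mul_le_mul_of_nonneg_right h2 (by linarith)
      linarith
  · intro b hb hbT hbx hdb
    have hbU : b ∈ U := mem_filter.mpr ⟨hb, hbT⟩
    have hxU : x ∈ U.erase b := mem_erase.mpr ⟨hbx.symm, hUx⟩
    rw [← add_sum_erase U _ hbU, hdb]
    have hU2 : #(U.erase b) + 1 = #U := card_erase_add_one hbU
    have hpos := card_pos.mpr ⟨x, hxU⟩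
    obtain h | h : #(U.erase b) = 1 ∨ 2 ≤ #(U.erase b) := by omega
    · obtain ⟨y, hy⟩ := card_eq_one.mp h
      have hxy : x = y := by rw [hy] at hxU; simpa using hxU
      subst hxy
      have hUe : U.erase x = {b} := by
        obtain ⟨z, hz⟩ := card_eq_one.mp (show #(U.erase x) = 1 by
          have := card_erase_add_one hUx
          omega)
        have : b ∈ U.erase x := mem_erase.mpr ⟨hbx, hbU⟩
        rw [hz] at this ⊢
        rw [mem_singleton.mp this]
      rw [hUe] at hdx
      rw [hy]
      simp only [sum_singleton, hdb] at hdx ⊢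
      push_cast at hdx ⊢
      linarith
    · have h1 := hlow (U.erase b) ((erase_subset _ _).trans hUS)
      have h2 : (2 : ℝ) ≤ #(U.erase b) := by exact_mod_cast h
      have h3 : 2 * (β - δ / 2) ≤ #(U.erase b) * (β - δ / 2) :=
        mul_le_mul_of_nonneg_right h2 (by linarith)
      push_cast
      linarith

end

end VariableDegeneracy

/-! ### The density theorem. -/

namespace VariableDegeneracy

open Finset

section

variable {V E C : Type*} [DecidableEq V] [Fintype E] [DecidableEq C] [Fintype C] [Nonempty C]
  {I : E → Finset V} {F : C → V → ℕ} {S T B : Finset V}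

/-- The potential of a block, with three exceptional cases: a complete graph on `δ` or `δ + 1`
vertices, and blocks of small degree. -/
theorem HyperBlock.potential_cases (hI : ∀ e, 2 ≤ #(I e)) {δ r : ℕ} (hδ3 : 3 ≤ δ)
    (hr : 2 * r ≤ δ) (hS : HyperBlock I S)
    (hinj : ∀ e e', I e ⊆ S → #(I e) = 2 → I e = I e' → e = e')
    (hd : ∀ v ∈ S, degOn I S v ≤ ∑ c, F c v) (hF : ¬ Colorable I F S)
    (hFr : ∀ c, ∀ v ∈ S, F c v ≤ r) (hδ : ∀ v ∈ S, degOn I S v ≤ δ) {β : ℝ}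
    (hβ : (δ : ℝ) * β = δ ^ 2 - δ + 2) (hT : ∀ v ∈ S, v ∈ T → degOn I S v = 1) :
    (IsGraphOn I S ∧ (∀ u ∈ S, ∀ v ∈ S, u ≠ v → Adj I u v) ∧ #S = δ + 1) ∨
    ((∀ v ∈ S, degOn I S v + 1 = δ ∧ v ∉ T) ∧ #S = δ) ∨
    ((∀ v ∈ S, 2 ≤ degOn I S v ∧ v ∉ T) ∧ β ≤ potential I β S T) ∨
    ((∀ x ∈ S, x ∉ T → β ≤ potential I β S T ∧
      ∀ b ∈ S, b ∉ T → b ≠ x → degOn I S b = 1 → 2 * β - 2 ≤ potential I β S T) ∧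
      2 ≤ potential I β S T) := by
  have hδR : (3 : ℝ) ≤ δ := by exact_mod_cast hδ3
  have hδ0 : (0 : ℝ) < δ := by linarith
  have hβ0 : 2 ≤ β := by
    by_contra! h
    nlinarith
  have hβ1 : (δ : ℝ) / 2 + 1 ≤ β := by
    by_contra! h
    nlinarith [sq_nonneg ((δ : ℝ) - 2)]
  have hβ2 : (δ : ℝ) ≤ β + 1 := by
    by_contra! h
    nlinarith
  obtain ⟨v₀, hv₀⟩ := hS.1.1
  have hgraph : IsGraphOn I S → #S ≤ 2 → ∀ v ∈ S, degOn I S v ≤ 1 := fun hG h v hv => by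
    have := degOn_lt_card hG hv
    omega
  have htwo : #S ≤ 2 → ∀ v ∈ S, degOn I S v ≤ 1 := by
    intro h
    have h2 : ∀ e, I e ⊆ S → #(I e) = 2 := fun e he =>
      le_antisymm ((card_le_card he).trans h) (hI e)
    exact hgraph ⟨h2, fun e e' he => hinj e e' he (h2 e he)⟩ h
  by_cases hsmall : ∀ v ∈ S, 2 * degOn I S v ≤ δ
  · refine Or.inr (Or.inr (Or.inr ⟨fun x hx hxT =>
      le_potential_of_small hI hβ0 hβ1 hβ2 hsmall htwo hT hx hxT, ?_⟩))
    by_cases hex : ∃ x ∈ S, x ∉ T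
    · obtain ⟨x, hx, hxT⟩ := hex
      exact hβ0.trans (le_potential_of_small hI hβ0 hβ1 hβ2 hsmall htwo hT hx hxT).1
    · push Not at hex
      have hcard : 2 ≤ #S := by
        have h1 := hT v₀ hv₀ (hex v₀ hv₀)
        obtain ⟨e, he⟩ := card_pos.mp (show 0 < degOn I S v₀ by omega)
        simp only [mem_filter, mem_univ, true_and] at he
        exact (hI e).trans (card_le_card he.2)
      unfold potential
      rw [sum_congr rfl fun v hv => by rw [if_pos (hex v hv)], sum_const, nsmul_eq_mul, mul_one]
      exact_mod_cast hcard
  have hreg : ∃ d, IsGraphOn I S ∧ (∀ v ∈ S, degOn I S v = d) ∧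
      ((∀ u ∈ S, ∀ v ∈ S, u ≠ v → Adj I u v) ∧ d + 1 = #S ∨ d = 2) := by
    rcases hyperBlock_structure hI hS hinj hd hF with ⟨c, hc⟩ | ⟨hG, hc | h2⟩
    -- With one color the degree is at most `r`, and `2r ≤ δ`; this case is covered by small
    -- degrees.
    · refine absurd (fun v hv => ?_) hsmall
      have h1 := hd v hv
      rw [sum_eq_single c (fun c' _ h => hc c' h v hv) (fun h => absurd (mem_univ c) h)] at h1
      have := hFr c v hv
      omega
    · refine ⟨#S - 1, hG, fun v hv => ?_, Or.inl ⟨hc, ?_⟩⟩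
      · have := degOn_of_complete hG hc hv
        omega
      · have := degOn_of_complete hG hc hv₀
        omega
    · exact ⟨2, hG, h2, Or.inr rfl⟩
  obtain ⟨d, hG, hdeg, hcase⟩ := hreg
  have hdn : d + 1 ≤ #S := by
    have := degOn_lt_card hG hv₀
    rwa [hdeg v₀ hv₀] at this
  have hd2 : 2 ≤ d := by
    push Not at hsmall
    obtain ⟨v, hv, h⟩ := hsmall
    rw [hdeg v hv] at h
    omega
  have hdδ : d ≤ δ := hdeg v₀ hv₀ ▸ hδ v₀ hv₀
  have hnT : ∀ v ∈ S, v ∉ T := fun v hv hvT => by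
    have := hT v hv hvT
    rw [hdeg v hv] at this
    omega
  have hpot := potential_regular (T := T) β hdeg hnT
  by_cases hfull : d + 1 = #S
  · by_cases h1 : d = δ
    · rcases hcase with h | h
      · exact Or.inl ⟨hG, h.1, by omega⟩
      · omega
    by_cases h2 : d + 1 = δ
    · exact Or.inr (Or.inl ⟨fun v hv => ⟨by rw [hdeg v hv, h2], hnT v hv⟩, by omega⟩)
    refine Or.inr (Or.inr (Or.inl ⟨fun v hv => ⟨by rw [hdeg v hv]; exact hd2, hnT v hv⟩, ?_⟩))
    rw [hpot, ← hfull]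
    have h3 : (d : ℝ) + 2 ≤ δ := by exact_mod_cast (by omega : d + 2 ≤ δ)
    have h4 : (2 : ℝ) ≤ d := by exact_mod_cast hd2
    push_cast
    nlinarith [mul_nonneg (by linarith : (0 : ℝ) ≤ d) (by linarith : (0 : ℝ) ≤ δ - d - 2)]
  · have h2 : d = 2 := by tauto
    subst h2
    refine Or.inr (Or.inr (Or.inl ⟨fun v hv => ⟨by rw [hdeg v hv], hnT v hv⟩, ?_⟩))
    rw [hpot]
    have h4 : (4 : ℝ) ≤ #S := by exact_mod_cast (by omega : 4 ≤ #S)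
    have h5 : 4 * (β - 2) ≤ #S * (β - 2) := mul_le_mul_of_nonneg_right h4 (by linarith)
    -- Equality holds for `δ = 3`, so a 4-cycle just attains the bound `4(β - 2) ≥ β`.
    have h6 : (8 : ℝ) ≤ 3 * β := by
      by_contra! h
      nlinarith
    push_cast
    linarith

/-- The density theorem: a connected hypergraph without partition is a complete graph on `δ + 1`
vertices, or its potential is at least `2`. -/
theorem potential_bound (hI : ∀ e, 2 ≤ #(I e)) {δ r : ℕ} (hδ3 : 3 ≤ δ) (hr : 2 * r ≤ δ)
    (hS : Conn I S) (hinj : ∀ e e', I e ⊆ S → #(I e) = 2 → I e = I e' → e = e')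
    (hd : ∀ v ∈ S, degOn I S v ≤ ∑ c, F c v) (hF : ¬ Colorable I F S)
    (hFr : ∀ c, ∀ v ∈ S, F c v ≤ r) (hδ : ∀ v ∈ S, degOn I S v ≤ δ) {β : ℝ}
    (hβ : (δ : ℝ) * β = δ ^ 2 - δ + 2) (hT : ∀ v ∈ S, v ∈ T → degOn I S v = 1) :
    (HyperBlock I S ∧ IsGraphOn I S ∧ (∀ u ∈ S, ∀ v ∈ S, u ≠ v → Adj I u v) ∧ #S = δ + 1) ∨
    (2 ≤ potential I β S T ∧
      ((∃ x ∈ S, x ∉ T ∧ degOn I S x + 2 ≤ δ) → β ≤ potential I β S T)) := by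
  have hδR : (3 : ℝ) ≤ δ := by exact_mod_cast hδ3
  have hδ0 : (0 : ℝ) < δ := by linarith
  have hβ0 : 2 ≤ β := by
    by_contra! h
    nlinarith
  induction S using Finset.strongInduction generalizing F T with
  | H S ih =>
    by_cases hbl : HyperBlock I S
    · rcases hbl.potential_cases hI hδ3 hr hinj hd hF hFr hδ hβ hT with h | h | h | h
      · exact Or.inl ⟨hbl, h⟩
      · refine Or.inr ⟨?_, ?_⟩
        · rw [potential_regular β (d := δ - 1) (fun v hv => by have := (h.1 v hv).1; omega)
            (fun v hv => (h.1 v hv).2), h.2, Nat.cast_sub (by omega)]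
          push_cast
          linarith
        · rintro ⟨x, hx, -, hdx⟩
          have := (h.1 x hx).1
          omega
      · exact Or.inr ⟨hβ0.trans h.2, fun _ => h.2⟩
      · refine Or.inr ⟨h.2, ?_⟩
        rintro ⟨x, hx, hxT, -⟩
        exact (h.1 x hx hxT).1
    obtain ⟨B, b, hB, hBbl⟩ := exists_hyperLobe hS hbl
    have hY := hB.compl
    set Y := S \ B.erase b with hYdef
    have hbS : b ∈ S := hB.2.1 hB.1
    have hroot : degOn I S b = degOn I B b + degOn I Y b := hB.degOn_root hI
    obtain ⟨x₁, hx₁⟩ := hB.2.2.1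
    obtain ⟨x₂, hx₂⟩ := hY.2.2.1
    have hBconn := hBbl.1
    have hYconn := hY.conn hS
    have hBpos : 0 < degOn I B b :=
      hBconn.degOn_pos hB.1 (mem_of_mem_erase hx₁) (mem_erase.mp hx₁).1
    have hYpos : 0 < degOn I Y b :=
      hYconn.degOn_pos hY.1 (mem_of_mem_erase hx₂) (mem_erase.mp hx₂).1
    have hbδ := hδ b hbS
    have hbT : b ∉ T := fun h => by
      have := hT b hbS h
      omega
    have hpot := hB.potential_eq hI hbT β
    rw [← hYdef] at hpot
    obtain ⟨FB, fB1, -, fB3, fB4⟩ := exists_not_colorable_part hI hS hd hF hB.2.1 ⟨b, hB.1⟩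
      fun e heS heB => hB.card_inter_le heS heB
    obtain ⟨FY, fY1, -, fY3, fY4⟩ := exists_not_colorable_part hI hS hd hF hY.2.1 ⟨b, hY.1⟩
      fun e heS heB => hY.card_inter_le heS heB
    have hTB : ∀ v ∈ B, v ∈ T → degOn I B v = 1 := fun v hv hvT => by
      rw [← hB.degOn_eq (mem_erase.mpr ⟨fun h => hbT (h ▸ hvT), hv⟩)]
      exact hT v (hB.2.1 hv) hvT
    have hTY : ∀ v ∈ Y, v ∈ T → degOn I Y v = 1 := fun v hv hvT => by
      rw [← hY.degOn_eq (mem_erase.mpr ⟨fun h => hbT (h ▸ hvT), hv⟩)]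
      exact hT v (hY.2.1 hv) hvT
    have hYS : Y ⊂ S := (ssubset_iff_of_subset hY.2.1).mpr hY.2.2.2.2
    -- The induction is used for arbitrary marks, since `b` may get marked. `Y` is not `K_{δ+1}`:
    -- its vertex `b` would have degree `δ` there and a further edge in `B`.
    have ihY : ∀ T, (∀ v ∈ Y, v ∈ T → degOn I Y v = 1) → 2 ≤ potential I β Y T ∧
        ((∃ x ∈ Y, x ∉ T ∧ degOn I Y x + 2 ≤ δ) → β ≤ potential I β Y T) := fun T hT => by
      rcases ih Y hYS hYconn (fun e e' he => hinj e e' (he.trans hY.2.1)) fY3 fY4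
        (fun c v hv => (fY1 c v).trans (hFr c v (hY.2.1 hv)))
        (fun v hv => (degOn_mono hY.2.1 v).trans (hδ v (hY.2.1 hv))) hT with h | h
      · have := degOn_of_complete h.2.1 h.2.2.1 hY.1
        omega
      · exact h
    have hlowY : ∀ x ∈ S, degOn I S x + 2 ≤ δ → degOn I Y x + 2 ≤ δ := fun x _ h =>
      (Nat.add_le_add_right (degOn_mono hY.2.1 x) 2).trans h
    have hcov : ∀ x ∈ S, x ∉ Y → x ∈ B ∧ x ≠ b := fun x hx hxY => by
      rw [hYdef, mem_sdiff, not_and, not_not, mem_erase] at hxY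
      exact ⟨(hxY hx).2, (hxY hx).1⟩
    rcases hBbl.potential_cases hI hδ3 hr (fun e e' he => hinj e e' (he.trans hB.2.1)) fB3 fB4
        (fun c v hv => (fB1 c v).trans (hFr c v (hB.2.1 hv)))
        (fun v hv => (degOn_mono hB.2.1 v).trans (hδ v (hB.2.1 hv))) hβ hTB with h | h | h | h
    · have := degOn_of_complete h.1 h.2.1 hB.1
      omega
    -- An end block on `δ` vertices of degree `δ - 1` is traded for a mark at `b`, with no change of
    -- potential.
    · have hb1 := (h.1 b hB.1).1
      have hYb : degOn I Y b = 1 := by omega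
      obtain ⟨h1, h2⟩ := ihY (insert b T) fun v hv hvT => by
        rcases mem_insert.mp hvT with rfl | hvT
        · exact hYb
        · exact hTY v hv hvT
      have hpB : potential I β B T = 2 := by
        rw [potential_regular β (d := δ - 1) (fun v hv => by have := (h.1 v hv).1; omega)
            (fun v hv => (h.1 v hv).2), h.2, Nat.cast_sub (by omega)]
        push_cast
        linarith
      have heq : potential I β S T = potential I β Y (insert b T) := by
        rw [hpot, hpB, potential_insert hY.1 hbT, hYb]
        push_cast
        ring
      rw [heq]
      refine Or.inr ⟨h1, ?_⟩
      rintro ⟨x, hx, hxT, hdx⟩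
      have hxY : x ∈ Y := by
        by_contra hxY
        obtain ⟨hxB, hxb⟩ := hcov x hx hxY
        have := hB.degOn_eq (mem_erase.mpr ⟨hxb, hxB⟩)
        have := (h.1 x hxB).1
        omega
      have hxb : x ≠ b := by
        rintro rfl
        omega
      exact h2 ⟨x, hxY, by simp [hxb, hxT], hlowY x hx hdx⟩
    · obtain ⟨-, h2⟩ := ihY T hTY
      -- Two edges at `b` go into `B`, so `b` has degree at most `δ - 2` in `Y` and the stronger
      -- bound `β` is available there.
      have hb2 := (h.1 b hB.1).1
      have h3 := h2 ⟨b, hY.1, hbT, by omega⟩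
      have : β ≤ potential I β S T := by linarith [h.2]
      exact Or.inr ⟨hβ0.trans this, fun _ => this⟩
    · obtain ⟨h1, h2⟩ := ihY T hTY
      have hbB := (h.1 b hB.1 hbT).1
      refine Or.inr ⟨by linarith, ?_⟩
      rintro ⟨x, hx, hxT, hdx⟩
      by_cases hxY : x ∈ Y
      · have := h2 ⟨x, hxY, hxT, hlowY x hx hdx⟩
        linarith
      obtain ⟨hxB, hxb⟩ := hcov x hx hxY
      -- If `b` has one edge in `B`, the block alone supplies `2β - 2`; if it has more, its low
      -- degree in `Y` raises the bound for `Y` from `2` to `β`. Either way the total reaches `β`.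
      by_cases hb1 : degOn I B b = 1
      · have := (h.1 x hxB hxT).2 b hB.1 hbT hxb.symm hb1
        linarith
      · have := h2 ⟨b, hY.1, hbT, by omega⟩
        linarith

end

end VariableDegeneracy

/-! ### Smooth and additive properties, and critical hypergraphs. -/

namespace FinHypergraph

/-- The inverse of an isomorphism. -/
def Iso.symm {G H : FinHypergraph} (f : Iso G H) : Iso H G where
  toV := f.toV.symm
  toE := f.toE.symm
  inc_map e := by
    have h := f.inc_map (f.toE.symm e)
    rw [Equiv.apply_symm_apply] at h
    rw [h, ← Set.image_comp]
    simp

/-- Inducing twice. -/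
def induceInduceIso (H : FinHypergraph) {X Z : Set H.V} (hZ : Z ⊆ X) :
    Iso ((H.induce X).induce (Subtype.val ⁻¹' Z)) (H.induce Z) where
  toV :=
    { toFun := fun v => ⟨v.1.1, v.2⟩
      invFun := fun v => ⟨⟨v.1, hZ v.2⟩, v.2⟩
      left_inv := fun _ => rfl
      right_inv := fun _ => rfl }
  toE :=
    { toFun := fun e => ⟨e.1.1, fun v hv => e.2 (a := ⟨v, e.1.2 hv⟩) hv⟩
      invFun := fun e => ⟨⟨e.1, e.2.trans hZ⟩, fun _ hv => e.2 hv⟩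
      left_inv := fun _ => rfl
      right_inv := fun _ => rfl }
  inc_map e := by
    ext v
    constructor
    · intro hv
      exact ⟨⟨⟨v.1, hZ v.2⟩, v.2⟩, hv, rfl⟩
    · rintro ⟨w, hw, rfl⟩
      exact hw

variable {P : FinHypergraph → Prop} {H : FinHypergraph}

theorem IsSmooth.induce_mono (hP : IsSmooth P) {X Z : Set H.V} (hZ : Z ⊆ X)
    (hX : P (H.induce X)) : P (H.induce Z) :=
  hP.isProperty _ _ ⟨induceInduceIso H hZ⟩ (hP.hereditary _ _ hX)

theorem IsSmooth.induce_induce_iff (hP : IsSmooth P) {X Z : Set H.V} {Y : Set (H.induce X).V}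
    (hZ : Z ⊆ X) (hY : ∀ v (hv : v ∈ X), (⟨v, hv⟩ : X) ∈ Y ↔ v ∈ Z) :
    P ((H.induce X).induce Y) ↔ P (H.induce Z) := by
  obtain rfl : Y = (Subtype.val ⁻¹' Z : Set X) := Set.ext fun v => hY v.1 v.2
  exact ⟨hP.isProperty _ _ ⟨induceInduceIso H hZ⟩,
    hP.isProperty _ _ ⟨(induceInduceIso H hZ).symm⟩⟩

theorem propDeg_le {G : FinHypergraph} (hG : MinForbidden P G) : propDeg P ≤ G.minDeg :=
  Nat.sInf_le ⟨G, hG, rfl⟩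

theorem deg_induce (H : FinHypergraph) (Z : Set H.V) (v : Z) :
    (H.induce Z).deg v = {e : H.E | v.1 ∈ H.inc e ∧ H.inc e ⊆ Z}.ncard := by
  refine (Set.ncard_image_of_injective {e : {e : H.E // H.inc e ⊆ Z} | v.1 ∈ H.inc e.1}
    Subtype.val_injective).symm.trans (congrArg Set.ncard ?_)
  ext e
  constructor
  · rintro ⟨e, he, rfl⟩
    exact ⟨he, e.2⟩
  · rintro ⟨h1, h2⟩
    exact ⟨⟨e, h2⟩, h1, rfl⟩

/-- A set outside `P` contains a nonempty part in which all degrees are at least `d(P)`. -/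
theorem IsSmooth.exists_dense_subset (hP : IsSmooth P) {X : Set H.V} (hX : ¬ P (H.induce X)) :
    ∃ Z ⊆ X, ¬ P (H.induce Z) ∧
      ∀ v ∈ Z, propDeg P ≤ {e : H.E | v ∈ H.inc e ∧ H.inc e ⊆ Z}.ncard := by
  -- An inclusion-minimal set outside `P` induces a member of `F(P)`.
  obtain ⟨Z, hZX, hZ⟩ := (Set.toFinite {Z : Set H.V | ¬ P (H.induce Z)}).exists_le_minimal hX
  refine ⟨Z, hZX, hZ.prop, fun v hv => ?_⟩
  have hmin : MinForbidden P (H.induce Z) := by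
    refine ⟨hZ.prop, fun w => ?_⟩
    have hsub : Z \ {w.1} ⊆ Z := Set.sdiff_subset
    refine (hP.induce_induce_iff hsub fun u hu => ?_).mpr ?_
    · constructor
      · exact fun h => ⟨hu, fun h' => h (Subtype.ext h')⟩
      · exact fun h h' => h.2 (congrArg Subtype.val h')
    · by_contra hcon
      have := hZ.le_of_le hcon hsub w.2
      simp at this
  refine (propDeg_le hmin).trans ?_
  rw [← deg_induce H Z ⟨v, hv⟩]
  exact Nat.sInf_le ⟨_, rfl⟩

/-- A coloring is admissible if it is so outside `K` and no part meeting `K` is dense. -/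
theorem IsSmooth.listColorable_of_sparse (hP : IsSmooth P) {C : Type} {L : H.V → Set C}
    {χ : H.V → C} (hL : ∀ v, χ v ∈ L v) {K : Set H.V}
    (hK : ∀ c, P (H.induce {v | v ∉ K ∧ χ v = c}))
    (h : ∀ c, ∀ Z ⊆ χ ⁻¹' {c}, (Z ∩ K).Nonempty →
      ∃ v ∈ Z ∩ K, {e : H.E | v ∈ H.inc e ∧ H.inc e ⊆ Z}.ncard < propDeg P) :
    ListColorable P H L := by
  refine ⟨χ, hL, fun c => ?_⟩
  by_contra hc
  obtain ⟨Z, hZ, hZP, hdense⟩ := hP.exists_dense_subset hc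
  by_cases hZK : (Z ∩ K).Nonempty
  · obtain ⟨v, hv, hlt⟩ := h c Z hZ hZK
    exact absurd (hdense v hv.1) (not_le.mpr hlt)
  · exact hZP (hP.induce_mono (X := {v | v ∉ K ∧ χ v = c}) (fun v hv => ⟨fun hvK => hZK ⟨v, hv, hvK⟩, (hZ hv : χ v = c)⟩) (hK c))

/-- Restrict a coloring of `H - v` to the complement of `K`. Values on `K` carry no meaning; the
nonempty list serves only to make `ψ` total. -/
theorem ListCritical.exists_coloring_off (hP : IsSmooth P) {C : Type} {L : H.V → Set C}
    (hcrit : ListCritical P H L) {v : H.V} (hv : (L v).Nonempty) {K : Set H.V} (hvK : v ∈ K) :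
    ∃ ψ : H.V → C, (∀ u ∉ K, ψ u ∈ L u) ∧ ∀ c, P (H.induce {u | u ∉ K ∧ ψ u = c}) := by
  classical
  obtain ⟨φ, hφL, hφ⟩ := hcrit.1 v
  obtain ⟨c₀, -⟩ := hv
  have hne : ∀ u ∉ K, u ∈ ({v}ᶜ : Set H.V) := fun u hu h => hu (by
    rw [Set.mem_singleton_iff] at h
    rwa [h])
  refine ⟨fun u => if h : u ∈ ({v}ᶜ : Set H.V) then φ ⟨u, h⟩ else c₀, fun u hu => ?_,
    fun c => ?_⟩
  · simp only [dif_pos (hne u hu)]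
    exact hφL ⟨u, hne u hu⟩
  · set Z : Set H.V := {u | ∃ h : u ∈ ({v}ᶜ : Set H.V), φ ⟨u, h⟩ = c} with hZ
    have hsub : Z ⊆ {v}ᶜ := fun u hu => hu.choose
    have h := (hP.induce_induce_iff (Y := φ ⁻¹' {c}) hsub fun u hu =>
      ⟨fun h => ⟨hu, h⟩, fun h => h.choose_spec⟩).mp (hφ c)
    refine hP.induce_mono (fun u hu => ?_) h
    have h2 := hu.2
    simp only [dif_pos (hne u hu.1)] at h2
    exact ⟨hne u hu.1, h2⟩

/-- Two parts without edges between them induce a disjoint union. -/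
noncomputable def disjUnionIso (H : FinHypergraph) {A B : Set H.V} (hAB : Disjoint A B)
    (he : ∀ e, H.inc e ⊆ A ∪ B → H.inc e ⊆ A ∨ H.inc e ⊆ B) :
    Iso (disjUnion (H.induce A) (H.induce B)) (H.induce (A ∪ B)) where
  toV := Equiv.ofBijective (Sum.elim (fun v => ⟨v.1, Or.inl v.2⟩) fun v => ⟨v.1, Or.inr v.2⟩) <| by
    constructor
    · rintro (v | v) (w | w) h
      · have h : v.1 = w.1 := congrArg (fun x : ↥(A ∪ B) => x.1) h
        exact congrArg Sum.inl (Subtype.ext h)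
      · have h : v.1 = w.1 := congrArg (fun x : ↥(A ∪ B) => x.1) h
        exact absurd w.2 (Set.disjoint_left.mp hAB (h ▸ v.2))
      · have h : v.1 = w.1 := congrArg (fun x : ↥(A ∪ B) => x.1) h
        exact absurd v.2 (Set.disjoint_left.mp hAB (h ▸ w.2))
      · have h : v.1 = w.1 := congrArg (fun x : ↥(A ∪ B) => x.1) h
        exact congrArg Sum.inr (Subtype.ext h)
    · rintro ⟨v, hv | hv⟩
      · exact ⟨Sum.inl ⟨v, hv⟩, rfl⟩
      · exact ⟨Sum.inr ⟨v, hv⟩, rfl⟩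
  toE := Equiv.ofBijective (Sum.elim (fun e => ⟨e.1, e.2.trans Set.subset_union_left⟩)
      fun e => ⟨e.1, e.2.trans Set.subset_union_right⟩) <| by
    have hno : ∀ e, H.inc e ⊆ A → H.inc e ⊆ B → False := fun e h1 h2 => by
      have h := H.two_le_inc e
      have : H.inc e = ∅ := Set.subset_empty_iff.mp fun v hv =>
        Set.disjoint_left.mp hAB (h1 hv) (h2 hv)
      rw [this] at h
      simp at h
    constructor
    · rintro (v | v) (w | w) h
      · have h : v.1 = w.1 :=
          congrArg (fun x : {e // H.inc e ⊆ A ∪ B} => x.1) h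
        exact congrArg Sum.inl (Subtype.ext h)
      · have h : v.1 = w.1 :=
          congrArg (fun x : {e // H.inc e ⊆ A ∪ B} => x.1) h
        exact (hno v.1 v.2 (h ▸ w.2)).elim
      · have h : v.1 = w.1 :=
          congrArg (fun x : {e // H.inc e ⊆ A ∪ B} => x.1) h
        exact (hno v.1 (h ▸ w.2) v.2).elim
      · have h : v.1 = w.1 :=
          congrArg (fun x : {e // H.inc e ⊆ A ∪ B} => x.1) h
        exact congrArg Sum.inr (Subtype.ext h)
    · rintro ⟨e, h⟩
      rcases he e h with h | h
      · exact ⟨Sum.inl ⟨e, h⟩, rfl⟩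
      · exact ⟨Sum.inr ⟨e, h⟩, rfl⟩
  inc_map := by
    rintro (e | e)
    · ext v
      constructor
      · intro hv
        exact ⟨Sum.inl ⟨v.1, e.2 hv⟩, ⟨⟨v.1, e.2 hv⟩, hv, rfl⟩, rfl⟩
      · rintro ⟨_, ⟨w, hw, rfl⟩, rfl⟩
        exact hw
    · ext v
      constructor
      · intro hv
        exact ⟨Sum.inr ⟨v.1, e.2 hv⟩, ⟨⟨v.1, e.2 hv⟩, hv, rfl⟩, rfl⟩
      · rintro ⟨_, ⟨w, hw, rfl⟩, rfl⟩
        exact hw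

/-- A proper nonempty part of a critical hypergraph is joined to the rest by an edge. -/
theorem ListCritical.eq_univ_of_closed (hP : IsSmooth P) (hadd : IsAdditive P) {C : Type}
    {L : H.V → Set C} (hcrit : ListCritical P H L) (hL : ∀ v, (L v).Nonempty) {K : Set H.V}
    (hK : K.Nonempty) (hcl : ∀ e, (H.inc e ∩ K).Nonempty → H.inc e ⊆ K) : K = Set.univ := by
  classical
  by_contra hne
  obtain ⟨w, hw⟩ := (Set.ne_univ_iff_exists_notMem K).mp hne
  obtain ⟨v, hv⟩ := hK
  obtain ⟨ψ, hψL, hψ⟩ := hcrit.exists_coloring_off hP (hL v) hv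
  obtain ⟨ψ', hψL', hψ'⟩ := hcrit.exists_coloring_off hP (hL w) (K := {w}) rfl
  have hKw : ∀ u ∈ K, u ∉ ({w} : Set H.V) := fun u hu h => hw (by
    rw [Set.mem_singleton_iff] at h
    rwa [← h])
  -- Colorings of `K` and of its complement are combined; no edge joins the two, so each color class
  -- is a disjoint union and additivity applies.
  refine hcrit.2 ⟨fun u => if u ∈ K then ψ' u else ψ u, fun u => ?_, fun c => ?_⟩
  · by_cases hu : u ∈ K
    · simp only [if_pos hu]; exact hψL' u (hKw u hu)
    · simp only [if_neg hu]; exact hψL u hu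
  · have hA : P (H.induce {u | u ∈ K ∧ ψ' u = c}) :=
      hP.induce_mono (X := {u | u ∉ ({w} : Set H.V) ∧ ψ' u = c}) (fun u hu => ⟨hKw u hu.1, hu.2⟩) (hψ' c)
    have hdis : Disjoint {u | u ∈ K ∧ ψ' u = c} {u | u ∉ K ∧ ψ u = c} :=
      Set.disjoint_left.mpr fun u hu hu' => hu'.1 hu.1
    refine hP.induce_mono (X := {u | u ∈ K ∧ ψ' u = c} ∪ {u | u ∉ K ∧ ψ u = c})
      (fun u hu => ?_) (hP.isProperty _ _ ⟨disjUnionIso H hdis fun e he => ?_⟩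
      (hadd _ _ hA (hψ c)))
    · by_cases huK : u ∈ K
      · refine Or.inl ⟨huK, ?_⟩
        simpa [huK] using hu
      · refine Or.inr ⟨huK, ?_⟩
        simpa [huK] using hu
    · by_cases hn : (H.inc e ∩ K).Nonempty
      · exact Or.inl fun u hu => (he hu).resolve_right fun h => h.1 (hcl e hn hu)
      · exact Or.inr fun u hu => (he hu).resolve_left fun h => hn ⟨u, hu, h.1⟩

end FinHypergraph

/-! ### From list colorings to capacities. -/

namespace FinHypergraph

open VariableDegeneracy Finset Classical

section

variable {H : FinHypergraph}

/-- The vertices of the edge `e` in `K`. -/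
noncomputable def part (H : FinHypergraph) (K : Finset H.V) (e : H.E) : Finset H.V :=
  {v ∈ K | v ∈ H.inc e}

/-- The edges of the hypergraph `H(K)`, as finite sets of vertices. -/
noncomputable def traceEdge (H : FinHypergraph) (K : Finset H.V) :
    {e : H.E // 2 ≤ #(part H K e)} → Finset H.V :=
  fun e => part H K e.1

/-- The colors which occur in a list. -/
def Palette {V C : Type} (L : V → Set C) : Type := {c : C // ∃ v, c ∈ L v}

theorem mem_part {K : Finset H.V} {e : H.E} {v : H.V} : v ∈ part H K e ↔ v ∈ K ∧ v ∈ H.inc e :=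
  mem_filter

theorem exists_ne_mem_inc (e : H.E) (v : H.V) : ∃ u ∈ H.inc e, u ≠ v :=
  Set.exists_ne_of_one_lt_ncard (H.two_le_inc e) v

theorem two_le_traceEdge (H : FinHypergraph) (K : Finset H.V) (e) : 2 ≤ #(traceEdge H K e) := e.2

theorem traceEdge_subset (H : FinHypergraph) (K : Finset H.V) (e) : traceEdge H K e ⊆ K :=
  filter_subset _ _

theorem card_palette_filter {C : Type} {L : H.V → Set C} [Fintype (Palette L)] {k : ℕ}
    {v : H.V} (hv : (L v).encard = k) : #{c : Palette L | c.1 ∈ L v} = k := by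
  have h : ((fun c : Palette L => c.1) '' (({c : Palette L | c.1 ∈ L v} : Finset (Palette L)) :
      Set (Palette L))) = L v := by
    ext c
    constructor
    · rintro ⟨c, hc, rfl⟩
      exact (mem_filter.mp (mem_coe.mp hc)).2
    · intro hc
      exact ⟨⟨c, v, hc⟩, mem_coe.mpr (mem_filter.mpr ⟨mem_univ _, hc⟩), rfl⟩
  have h2 := Set.InjOn.encard_image (f := fun c : Palette L => c.1)
    (s := (({c : Palette L | c.1 ∈ L v} : Finset (Palette L)) : Set (Palette L)))
    (fun a _ b _ hab => Subtype.ext hab)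
  rw [h, hv, Set.encard_coe_eq_coe_finsetCard] at h2
  exact_mod_cast h2.symm

theorem finite_palette {C : Type} {L : H.V → Set C} {k : ℕ} (hL : ∀ v, (L v).encard = k) :
    Finite (Palette L) := by
  have : (⋃ v, L v).Finite := Set.finite_iUnion fun v => Set.finite_of_encard_eq_coe (hL v)
  have h : (⋃ v, L v) = {c | ∃ v, c ∈ L v} := by
    ext c
    simp
  rw [h] at this
  exact this.to_subtype

end

section

variable {P : FinHypergraph → Prop} {H : FinHypergraph} [Fintype H.E]

/-- The degree of `v` in `H(K)`. -/
noncomputable def partDeg (H : FinHypergraph) [Fintype H.E] (K : Finset H.V) (v : H.V) : ℕ :=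
  #{e : H.E | v ∈ H.inc e ∧ 2 ≤ #(part H K e)}

/-- The number of edges at `v` which do not count in `H(K)`. -/
noncomputable def pendantDeg (H : FinHypergraph) [Fintype H.E] (K : Finset H.V) (v : H.V) : ℕ :=
  #{e : H.E | v ∈ H.inc e ∧ ¬ 2 ≤ #(part H K e)}

/-- The number of edges at `v` all of whose other vertices are outside `K` and colored `c`. -/
noncomputable def colorDeg (H : FinHypergraph) [Fintype H.E] {C : Type} (K : Finset H.V)
    (ψ : H.V → C) (c : C) (v : H.V) : ℕ :=
  #{e : H.E | v ∈ H.inc e ∧ ∀ u ∈ H.inc e, u ≠ v → u ∉ K ∧ ψ u = c}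

/-- What `d(P)` leaves for the vertices of `K` when the other vertices are colored by `ψ`. -/
noncomputable def capacity (H : FinHypergraph) [Fintype H.E] {C : Type} (L : H.V → Set C) (r : ℕ)
    (K : Finset H.V) (ψ : H.V → C) (c : Palette L) (v : H.V) : ℕ :=
  if c.1 ∈ L v then r - colorDeg H K ψ c.1 v else 0

theorem deg_eq_card (v : H.V) : H.deg v = #{e : H.E | v ∈ H.inc e} := by
  unfold deg
  rw [Set.ncard_eq_toFinset_card', Set.toFinset_ofPred]

theorem deg_eq_add (K : Finset H.V) (v : H.V) : H.deg v = partDeg H K v + pendantDeg H K v := by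
  unfold partDeg pendantDeg
  rw [deg_eq_card, ← card_filter_add_card_filter_not (fun e => 2 ≤ #(part H K e)), filter_filter,
    filter_filter]

theorem degOn_traceEdge (K : Finset H.V) {v : H.V} (hv : v ∈ K) :
    degOn (traceEdge H K) K v = partDeg H K v := by
  unfold degOn partDeg
  refine card_bij (fun e _ => e.1) ?_ ?_ ?_
  · intro e he
    rw [mem_filter] at he ⊢
    exact ⟨mem_univ _, (mem_part.mp he.2.1).2, e.2⟩
  · exact fun e _ e' _ h => Subtype.ext h
  · intro e he
    rw [mem_filter] at he
    exact ⟨⟨e, he.2.2⟩, mem_filter.mpr ⟨mem_univ _, mem_part.mpr ⟨hv, he.2.1⟩,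
      traceEdge_subset H K _⟩, rfl⟩

/-- The edges inside `Z` at `v`, compared with the edges of `H(K)`. -/
theorem card_edges_le {C : Type} {K Y : Finset H.V} {Z : Set H.V} {ψ : H.V → C} {c : C} {v : H.V}
    (hv : v ∈ K) (hY : ∀ u ∈ K, u ∈ Z → u ∈ Y) (hψ : ∀ u ∈ Z, u ∉ K → ψ u = c) :
    {e : H.E | v ∈ H.inc e ∧ H.inc e ⊆ Z}.ncard ≤ degOn (traceEdge H K) Y v +
      colorDeg H K ψ c v := by
  rw [Set.ncard_eq_toFinset_card', Set.toFinset_ofPred]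
  unfold degOn colorDeg
  rw [← card_map (Function.Embedding.subtype fun e => 2 ≤ #(part H K e))]
  refine le_trans (card_le_card fun e he => ?_) (card_union_le _ _)
  rw [mem_filter] at he
  obtain ⟨-, hve, heZ⟩ := he
  rw [mem_union]
  by_cases h2 : 2 ≤ #(part H K e)
  · refine Or.inl (mem_map.mpr ⟨⟨e, h2⟩, mem_filter.mpr ⟨mem_univ _, mem_part.mpr ⟨hv, hve⟩,
      fun u hu => ?_⟩, rfl⟩)
    have := mem_part.mp hu
    exact hY u this.1 (heZ this.2)
  · refine Or.inr (mem_filter.mpr ⟨mem_univ _, hve, fun u hu huv => ?_⟩)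
    have huK : u ∉ K := fun huK => h2 (one_lt_card.mpr
      ⟨u, mem_part.mpr ⟨huK, hu⟩, v, mem_part.mpr ⟨hv, hve⟩, huv⟩)
    exact ⟨huK, hψ u (heZ hu) huK⟩

/-- Otherwise `φ` on `K` and `ψ` elsewhere would color `H`: in a monochromatic set meeting `K`,
strict degeneracy yields a vertex of `K` whose degree, including the edges charged to `colorDeg`,
stays below `d(P)`. -/
theorem not_colorable_capacity (hP : IsSmooth P) {C : Type} {L : H.V → Set C}
    (hcrit : ListCritical P H L) {K : Finset H.V} {ψ : H.V → C}
    (hψL : ∀ u ∉ K, ψ u ∈ L u) (hψ : ∀ c, P (H.induce {u | u ∉ K ∧ ψ u = c})) :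
    ¬ Colorable (traceEdge H K) (capacity H L (propDeg P) K ψ) K := by
  rintro ⟨φ, hφ⟩
  refine hcrit.2 (hP.listColorable_of_sparse (χ := fun v => if v ∈ K then (φ v).1 else ψ v)
    (K := (K : Set H.V)) (fun v => ?_) (fun c => ?_) fun c Z hZ hZK => ?_)
  · by_cases hv : v ∈ K
    · simp only [if_pos hv]
      -- Degeneracy of the singleton gives positive capacity, which is zero for colors outside the
      -- list.
      obtain ⟨y, hy, hlt⟩ := hφ (φ v) {v} (by simp [hv]) (by simp)
      rw [mem_singleton] at hy
      subst hy
      by_contra h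
      unfold capacity at hlt
      rw [if_neg h] at hlt
      omega
    · simp only [if_neg hv]
      exact hψL v hv
  · refine hP.induce_mono (X := {u | u ∉ K ∧ ψ u = c}) (fun u hu => ?_) (hψ c)
    have h1 : u ∉ K := hu.1
    have h2 := hu.2
    simp only [if_neg h1] at h2
    exact ⟨h1, h2⟩
  · have hZin : ∀ v ∈ Z, v ∈ K → (φ v).1 = c := fun v hv hvK => by
      have := hZ hv
      simpa [hvK] using this
    have hZout : ∀ v ∈ Z, v ∉ K → ψ v = c := fun v hv hvK => by
      have := hZ hv
      simpa [hvK] using this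
    obtain ⟨v₀, hv₀, hv₀K⟩ := hZK
    have hv₀K : v₀ ∈ K := hv₀K
    have hc := hZin v₀ hv₀ hv₀K
    obtain ⟨y, hy, hlt⟩ := hφ (φ v₀) {v ∈ K | v ∈ Z} (fun v hv => by
      rw [mem_filter] at hv ⊢
      exact ⟨hv.1, Subtype.ext ((hZin v hv.2 hv.1).trans hc.symm)⟩)
      ⟨v₀, mem_filter.mpr ⟨hv₀K, hv₀⟩⟩
    rw [mem_filter] at hy
    refine ⟨y, ⟨hy.2, hy.1⟩, ?_⟩
    have h1 := card_edges_le (H := H) (K := K) (Y := {v ∈ K | v ∈ Z}) (Z := Z) (ψ := ψ) (c := c)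
      hy.1 (fun u huK huZ => mem_filter.mpr ⟨huK, huZ⟩) hZout
    unfold capacity at hlt
    rw [hc] at hlt
    split_ifs at hlt
    · omega
    · omega

/-- Each edge counted by `pendantDeg` lowers the capacity of at most one color. For a vertex of
degree `k * r`, the remaining capacities therefore cover its degree in `H(K)`. -/
theorem le_sum_capacity {C : Type} {L : H.V → Set C} [Fintype (Palette L)] {k r : ℕ}
    {K : Finset H.V} {ψ : H.V → C} {v : H.V} (hv : (L v).encard = k) :
    k * r ≤ ∑ c, capacity H L r K ψ c v + pendantDeg H K v := by
  unfold capacity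
  rw [← sum_filter]
  have h1 : ∑ c : Palette L with c.1 ∈ L v, r = k * r := by
    rw [sum_const, card_palette_filter hv, smul_eq_mul]
  have h2 : ∑ c : Palette L with c.1 ∈ L v, r ≤ ∑ c : Palette L with c.1 ∈ L v, (r - colorDeg H K ψ c.1 v) +
      ∑ c : Palette L with c.1 ∈ L v, colorDeg H K ψ c.1 v := by
    rw [← sum_add_distrib]
    exact sum_le_sum fun c _ => by omega
  have h3 : ∑ c : Palette L with c.1 ∈ L v, colorDeg H K ψ c.1 v ≤ pendantDeg H K v := by
    unfold colorDeg
    rw [← card_biUnion]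
    · refine card_le_card fun e he => ?_
      obtain ⟨c, -, hc⟩ := mem_biUnion.mp he
      have hc := (mem_filter.mp hc).2
      refine mem_filter.mpr ⟨mem_univ _, hc.1, fun h => ?_⟩
      obtain ⟨u, hu, huv⟩ := exists_mem_ne h v
      rw [mem_part] at hu
      exact (hc.2 u hu.2 huv).1 hu.1
    · intro c _ c' _ hcc
      refine disjoint_left.mpr fun e he he' => hcc (Subtype.ext ?_)
      have he := (mem_filter.mp he).2
      have he' := (mem_filter.mp he').2
      obtain ⟨u, hu, huv⟩ := exists_ne_mem_inc e v
      exact (he.2 u hu huv).2.symm.trans (he'.2 u hu huv).2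
  omega

/-- In a critical hypergraph all degrees are at least `k d(P)`. -/
theorem ListCritical.le_deg (hP : IsSmooth P) {C : Type} {L : H.V → Set C}
    (hcrit : ListCritical P H L) {k : ℕ} (hk : 1 ≤ k) (hL : ∀ v, (L v).encard = k) (v : H.V) :
    k * propDeg P ≤ H.deg v := by
  have hfin := finite_palette hL
  have : Fintype (Palette L) := Fintype.ofFinite _
  have hne : (L v).Nonempty := by
    rw [← Set.encard_pos, hL v]
    exact_mod_cast hk
  obtain ⟨ψ, hψL, hψ⟩ := hcrit.exists_coloring_off hP hne (K := ({v} : Finset H.V)) (by simp)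
  have hF := not_colorable_capacity hP hcrit (K := {v}) hψL hψ
  -- A color with capacity left would partition the single vertex.
  have hzero : ∀ c, capacity H L (propDeg P) {v} ψ c v = 0 := by
    by_contra! h
    obtain ⟨c, hc⟩ := h
    refine hF ⟨fun _ => c, fun c' Y hY hn => ?_⟩
    obtain ⟨y, hy⟩ := hn
    have h1 : ∀ x ∈ Y, x = v ∧ c = c' := fun x hx =>
      ⟨mem_singleton.mp (mem_filter.mp (hY hx)).1, (mem_filter.mp (hY hx)).2⟩
    obtain ⟨rfl, rfl⟩ := h1 y hy
    refine ⟨y, hy, ?_⟩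
    rw [(eq_singleton_iff_unique_mem.mpr ⟨hy, fun x hx => (h1 x hx).1⟩ : Y = {y}),
      degOn_singleton (two_le_traceEdge H _)]
    exact Nat.pos_of_ne_zero hc
  have h1 := le_sum_capacity (H := H) (K := {v}) (ψ := ψ) (r := propDeg P)
    (hL v)
  rw [sum_eq_zero fun c _ => hzero c] at h1
  have h2 := deg_eq_add (H := H) {v} v
  omega

end

end FinHypergraph

/-! ### Excluding a proper complete part. -/

namespace FinHypergraph

open VariableDegeneracy Finset Classical

/-- `k r + 1` elements can be colored by a set of `k` colors such that each class has at most `r`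
elements, apart from one class of a prescribed color which has at most `r + 1` elements, two of
them prescribed. -/
theorem exists_almost_equitable {V C : Type} {K : Finset V} {A : Set C} {k r : ℕ}
    (hA : A.encard = k) (hK : #K = k * r + 1) {u w : V} (hu : u ∈ K) (hw : w ∈ K) (huw : u ≠ w)
    {c : C} (hc : c ∈ A) : ∃ g : V → C, (∀ v, g v ∈ A) ∧ g u = c ∧ g w = c ∧
      (∀ c', c' ≠ c → #{v ∈ K | g v = c'} ≤ r) ∧ #{v ∈ K | g v = c} ≤ r + 1 := by
  have hfin : A.Finite := Set.finite_of_encard_eq_coe hA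
  have : Fintype A := hfin.fintype
  have hcardA : Fintype.card A = k := by
    have h1 := Set.coe_fintypeCard A
    rw [hA] at h1
    exact_mod_cast h1
  have hcard : Fintype.card {x // x ∈ K.erase w} = Fintype.card (A × Fin r) := by
    rw [Fintype.card_coe, card_erase_of_mem hw, hK, Fintype.card_prod, hcardA, Fintype.card_fin]
    omega
  set f := Fintype.equivOfCardEq hcard with hf
  have hue : u ∈ K.erase w := mem_erase.mpr ⟨huw, hu⟩
  -- Without `w`, the set is identified with `A × Fin r`, giving classes of size `r`; colors are
  -- swapped so that `u` gets `c`, and `w` becomes the extra element of that class.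
  set σ : Equiv.Perm A := Equiv.swap (f ⟨u, hue⟩).1 ⟨c, hc⟩ with hσ
  set g : V → C := fun v => if h : v ∈ K.erase w then (σ (f ⟨v, h⟩).1).1 else c with hg
  have hgw : g w = c := by simp [hg]
  have hgu : g u = c := by
    simp only [hg, dif_pos hue, hσ, Equiv.swap_apply_left]
  have hfib : ∀ c', #{v ∈ K.erase w | g v = c'} ≤ r := by
    intro c'
    have h1 : #{v ∈ K.erase w | g v = c'} ≤ #(univ : Finset (Fin r)) := by
      refine card_le_card_of_injOn
        (fun v => if h : v ∈ K.erase w then (f ⟨v, h⟩).2 else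
          (f ⟨u, hue⟩).2) (fun _ _ => mem_coe.mpr (mem_univ _)) ?_
      intro x hx y hy hxy
      have hx := mem_filter.mp (mem_coe.mp hx)
      have hy := mem_filter.mp (mem_coe.mp hy)
      simp only [dif_pos hx.1, dif_pos hy.1] at hxy
      have h2 := hx.2.trans hy.2.symm
      simp only [hg, dif_pos hx.1, dif_pos hy.1] at h2
      have h3 := σ.injective (Subtype.ext h2)
      have h4 := f.injective (Prod.ext h3 hxy)
      exact congrArg Subtype.val h4
    simpa using h1
  refine ⟨g, fun v => ?_, hgu, hgw, fun c' hc' => ?_, ?_⟩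
  · by_cases hv : v ∈ K.erase w
    · simp only [hg, dif_pos hv]
      exact (σ (f ⟨v, hv⟩).1).2
    · simp only [hg, dif_neg hv]
      exact hc
  · refine (card_le_card fun v hv => ?_).trans (hfib c')
    rw [mem_filter] at hv ⊢
    refine ⟨mem_erase.mpr ⟨?_, hv.1⟩, hv.2⟩
    rintro rfl
    exact hc' (hv.2.symm.trans hgw)
  · refine le_trans (card_le_card (t := insert w {v ∈ K.erase w | g v = c}) fun v hv => ?_)
      ((card_insert_le _ _).trans (Nat.add_le_add_right (hfib c) 1))
    rw [mem_filter] at hv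
    by_cases hvw : v = w
    · simp [hvw]
    · exact mem_insert_of_mem (mem_filter.mpr ⟨mem_erase.mpr ⟨hvw, hv.1⟩, hv.2⟩)

section

variable {H : FinHypergraph}

/-- A complete graph on all vertices. -/
theorem nonempty_iso_complete {n : ℕ} (hcard : Nat.card H.V = n) (h2 : ∀ e, (H.inc e).ncard = 2)
    (hinj : Function.Injective H.inc) (hadj : ∀ u v, u ≠ v → ∃ e, H.inc e = {u, v}) :
    Nonempty (Iso H (complete n)) := by
  subst hcard
  set f : H.V ≃ Fin (Nat.card H.V) := Finite.equivFin H.V with hf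
  have hbij : Function.Bijective (fun e => (⟨f '' H.inc e, by
      rw [Set.ncard_image_of_injective _ f.injective, h2 e]⟩ :
        {s : Set (Fin (Nat.card H.V)) // s.ncard = 2})) := by
    constructor
    · intro e e' h
      exact hinj (Set.image_injective.mpr f.injective (congrArg Subtype.val h))
    · rintro ⟨s, hs⟩
      obtain ⟨x, y, hxy, rfl⟩ := Set.ncard_eq_two.mp hs
      obtain ⟨e, he⟩ := hadj (f.symm x) (f.symm y) fun h => hxy (f.symm.injective h)
      refine ⟨e, Subtype.ext ?_⟩
      simp [he, Set.image_pair]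
  exact ⟨⟨f, Equiv.ofBijective _ hbij, fun e => rfl⟩⟩

theorem coe_part_of_subset {K : Finset H.V} {e : H.E} (h : ∀ v ∈ H.inc e, v ∈ K) :
    (part H K e : Set H.V) = H.inc e := by
  ext v
  rw [mem_coe, mem_part]
  exact ⟨fun hv => hv.2, fun hv => ⟨h v hv, hv⟩⟩

end

section

variable {P : FinHypergraph → Prop} {H : FinHypergraph} [Fintype H.E]

/-- A critical hypergraph, other than a complete graph, has no complete graph on `k d(P) + 1`
vertices of degree `k d(P)` as a part. -/
theorem ListCritical.nonempty_iso_of_complete (hP : IsSmooth P) (hadd : IsAdditive P)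
    {C : Type} {L : H.V → Set C} (hcrit : ListCritical P H L) {k : ℕ} (hk : 2 ≤ k)
    (hr : 1 ≤ propDeg P) (hL : ∀ v, (L v).encard = k) {K : Finset H.V}
    (hG : IsGraphOn (traceEdge H K) K) (hbl : HyperBlock (traceEdge H K) K)
    (hcomp : ∀ u ∈ K, ∀ v ∈ K, u ≠ v → Adj (traceEdge H K) u v)
    (hcard : #K = k * propDeg P + 1) (hdeg : ∀ v ∈ K, H.deg v = k * propDeg P) :
    Nonempty (Iso H (complete (k * propDeg P + 1))) := by
  have hfin := finite_palette hL
  have : Fintype (Palette L) := Fintype.ofFinite _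
  have hLne : ∀ v, (L v).Nonempty := fun v => by
    rw [← Set.encard_pos, hL v]
    exact_mod_cast (by omega : 0 < k)
  have htwo : ∀ v ∈ K, ∀ e, v ∈ H.inc e → 2 ≤ #(part H K e) := by
    intro v hv e hve
    have h1 := degOn_of_complete hG hcomp hv
    rw [degOn_traceEdge K hv] at h1
    have h2 := deg_eq_add K v
    have h3 := hdeg v hv
    have h4 : pendantDeg H K v = 0 := by omega
    by_contra h
    exact filter_eq_empty_iff.mp (card_eq_zero.mp h4) (mem_univ e) ⟨hve, h⟩
  obtain ⟨v₀, hv₀⟩ := hbl.1.1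
  by_cases hcl : ∀ e, (H.inc e ∩ (K : Set H.V)).Nonempty → H.inc e ⊆ (K : Set H.V)
  · have huniv := hcrit.eq_univ_of_closed hP hadd hLne ⟨v₀, hv₀⟩ hcl
    have hmem : ∀ v, v ∈ K := fun v => by
      have : v ∈ (K : Set H.V) := huniv ▸ Set.mem_univ v
      exact this
    have hpart : ∀ e, (part H K e : Set H.V) = H.inc e := fun e =>
      coe_part_of_subset fun v _ => hmem v
    have hbig : ∀ e, 2 ≤ #(part H K e) := fun e => by
      rw [← Set.ncard_coe_finset, hpart e]
      exact H.two_le_inc e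
    refine nonempty_iso_complete ?_ (fun e => ?_) (fun e e' h => ?_) fun u v huv => ?_
    · rw [← hcard, ← Set.ncard_coe_finset, huniv, Set.ncard_univ]
    · rw [← hpart e, Set.ncard_coe_finset]
      exact hG.1 ⟨e, hbig e⟩ (traceEdge_subset _ _ _)
    · have := hG.2 ⟨e, hbig e⟩ ⟨e', hbig e'⟩ (traceEdge_subset _ _ _)
        (coe_injective ((hpart e).trans (h.trans (hpart e').symm)))
      exact congrArg Subtype.val this
    · obtain ⟨e, he⟩ := hcomp u (hmem u) v (hmem v) huv
      refine ⟨e.1, ?_⟩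
      rw [← hpart e.1]
      have he : part H K e.1 = {u, v} := he
      rw [he]
      simp
  · exfalso
    push Not at hcl
    obtain ⟨e₀, ⟨u, hue, huK⟩, hnot⟩ := hcl
    have huK : u ∈ K := huK
    obtain ⟨z, hze, hzK⟩ := Set.not_subset.mp hnot
    have hzK : z ∉ K := hzK
    have hb₀ := htwo u huK e₀ hue
    obtain ⟨w, hw, hwu⟩ := exists_mem_ne hb₀ u
    have hwK := (mem_part.mp hw).1
    obtain ⟨ψ, hψL, hψ⟩ := hcrit.exists_coloring_off hP (hLne v₀) (K := (K : Set H.V)) hv₀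
    have hF := not_colorable_capacity hP hcrit (K := K) hψL hψ
    -- All `k * propDeg P` edges at a vertex of `K` have a second vertex in `K`, so the coloring
    -- outside costs nothing.
    have hcol : ∀ c, ∀ v ∈ K, colorDeg H K ψ c v = 0 := by
      intro c v hv
      refine card_eq_zero.mpr (filter_eq_empty_iff.mpr fun e _ he => ?_)
      obtain ⟨x, hx, hxv⟩ := exists_mem_ne (htwo v hv e he.1) v
      rw [mem_part] at hx
      exact (he.2 x hx.2 hxv).1 hx.1
    have hcap : ∀ c, ∀ v ∈ K, 0 < capacity H L (propDeg P) K ψ c v ↔ c.1 ∈ L v := by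
      intro c v hv
      unfold capacity
      rw [hcol c.1 v hv]
      split_ifs with h
      · simp only [h, iff_true]; omega
      · simp [h]
    have hd : ∀ v ∈ K, degOn (traceEdge H K) K v ≤ ∑ c, capacity H L (propDeg P) K ψ c v := by
      intro v hv
      have h1 := le_sum_capacity (H := H) (K := K) (ψ := ψ) (r := propDeg P) (hL v)
      have h2 := deg_eq_add K v
      have h3 := hdeg v hv
      rw [degOn_traceEdge K hv]
      omega
    obtain ⟨cp, hcp⟩ := hLne v₀
    have : Nonempty (Palette L) := ⟨⟨cp, v₀, hcp⟩⟩
    have hlists : ∀ v ∈ K, L u ⊆ L v := fun v hv c hc =>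
      (hcap ⟨c, u, hc⟩ v hv).mp (hbl.pos_of_pos (two_le_traceEdge H K) hd hF huK hv
        ((hcap ⟨c, u, hc⟩ u huK).mpr hc))
    -- The oversized class receives a color different from that of `z`, so the edge `e₀` through
    -- `u`, `w` and `z` is not monochromatic.
    obtain ⟨c, hc, hcz⟩ : ∃ c ∈ L u, c ≠ ψ z := by
      refine Set.exists_ne_of_one_lt_encard ?_ (ψ z)
      rw [hL u]
      exact_mod_cast hk
    obtain ⟨g, hgL, hgu, hgw, hg1, hg2⟩ :=
      exists_almost_equitable (hL u) hcard huK hwK hwu.symm hc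
    refine hcrit.2 (hP.listColorable_of_sparse (χ := fun v => if v ∈ K then g v else ψ v)
      (K := (K : Set H.V)) (fun v => ?_) (fun c => ?_) fun c' Z hZ hZK => ?_)
    · by_cases hv : v ∈ K
      · simp only [if_pos hv]
        exact hlists v hv (hgL v)
      · simp only [if_neg hv]
        exact hψL v hv
    · refine hP.induce_mono (X := {u | u ∉ (K : Set H.V) ∧ ψ u = c}) (fun u hu => ?_) (hψ c)
      have h1 : u ∉ K := hu.1
      have h2 := hu.2
      simp only [if_neg h1] at h2
      exact ⟨h1, h2⟩
    · have hZin : ∀ v ∈ Z, v ∈ K → g v = c' := fun v hv hvK => by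
        have := hZ hv
        simpa [hvK] using this
      have hZout : ∀ v ∈ Z, v ∉ K → ψ v = c' := fun v hv hvK => by
        have := hZ hv
        simpa [hvK] using this
      obtain ⟨v₁, hv₁, hv₁K⟩ := hZK
      have hv₁K : v₁ ∈ K := hv₁K
      set Y : Finset H.V := {v ∈ K | v ∈ Z} with hY
      have hYK : Y ⊆ K := filter_subset _ _
      have hYg : Y ⊆ {v ∈ K | g v = c'} := fun v hv => by
        rw [mem_filter] at hv ⊢
        exact ⟨hv.1, hZin v hv.2 hv.1⟩
      have hv₁Y : v₁ ∈ Y := mem_filter.mpr ⟨hv₁K, hv₁⟩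
      have hbound : ∀ v ∈ Y,
          {e : H.E | v ∈ H.inc e ∧ H.inc e ⊆ Z}.ncard ≤ degOn (traceEdge H K) Y v := by
        intro v hv
        have h1 := card_edges_le (H := H) (K := K) (Y := Y) (Z := Z) (ψ := ψ) (c := c')
          (hYK hv) (fun u huK huZ => mem_filter.mpr ⟨huK, huZ⟩) hZout
        rwa [hcol c' v (hYK hv), Nat.add_zero] at h1
      have hlt : ∀ v ∈ Y, degOn (traceEdge H K) Y v + 1 ≤ #Y := fun v hv =>
        degOn_lt_card (hG.mono hYK) hv
      -- In a simple graph on at most `d(P)` vertices all degrees are below `d(P)`. The one class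
      -- with `d(P) + 1` vertices contains `u` and `w`, and there `u` loses the edge `e₀`.
      by_cases hYr : #Y ≤ propDeg P
      · have h1 := hbound v₁ hv₁Y
        have h2 := hlt v₁ hv₁Y
        exact ⟨v₁, ⟨hv₁, hv₁K⟩, by omega⟩
      have hcc : c' = c := by
        by_contra h
        exact hYr ((card_le_card hYg).trans (hg1 c' h))
      subst hcc
      have hYeq : Y = ({v ∈ K | g v = c'} : Finset H.V) :=
        eq_of_subset_of_card_le hYg (by omega)
      have huY : u ∈ Y := by rw [hYeq]; exact mem_filter.mpr ⟨huK, hgu⟩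
      have hwY : w ∈ Y := by rw [hYeq]; exact mem_filter.mpr ⟨hwK, hgw⟩
      have hYcard : #Y ≤ propDeg P + 1 := by rw [hYeq]; exact hg2
      refine ⟨u, ⟨(mem_filter.mp huY).2, huK⟩, ?_⟩
      have hzZ : z ∉ Z := fun h => hcz (hZout z h hzK).symm
      have hstrict : {e : H.E | u ∈ H.inc e ∧ H.inc e ⊆ Z}.ncard < degOn (traceEdge H K) Y u := by
        unfold degOn
        rw [Set.ncard_eq_toFinset_card', Set.toFinset_ofPred,
          ← card_map (Function.Embedding.subtype fun e => 2 ≤ #(part H K e))]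
        refine card_lt_card ((ssubset_iff_of_subset fun e he => ?_).mpr ⟨e₀, ?_, ?_⟩)
        · obtain ⟨-, hue, heZ⟩ := mem_filter.mp he
          refine mem_map.mpr ⟨⟨e, htwo u huK e hue⟩, mem_filter.mpr ⟨mem_univ _,
            mem_part.mpr ⟨huK, hue⟩, fun x hx => ?_⟩, rfl⟩
          have hx := mem_part.mp hx
          exact mem_filter.mpr ⟨hx.1, heZ hx.2⟩
        · refine mem_map.mpr ⟨⟨e₀, hb₀⟩, mem_filter.mpr ⟨mem_univ _,
            mem_part.mpr ⟨huK, hue⟩, ?_⟩, rfl⟩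
          have hp := hG.eq_pair (e := ⟨e₀, hb₀⟩) (traceEdge_subset _ _ _)
            (mem_part.mpr ⟨huK, hue⟩) hw hwu.symm
          rw [hp]
          exact insert_subset huY (singleton_subset_iff.mpr hwY)
        · intro h
          exact hzZ ((mem_filter.mp h).2.2 hze)
      have := hlt u huY
      omega

end

end FinHypergraph

/-! ### Average degree of the low-vertex hypergraph and the final count. -/

namespace FinHypergraph

open VariableDegeneracy Finset Classical

section

variable {P : FinHypergraph → Prop} {H : FinHypergraph} [Fintype H.E]

/-- The average degree of the low vertex hypergraph. -/
theorem ListCritical.sum_partDeg_le (hP : IsSmooth P) (hadd : IsAdditive P) {C : Type}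
    {L : H.V → Set C} (hcrit : ListCritical P H L) {k : ℕ} (hk : 2 ≤ k) (hr : 1 ≤ propDeg P)
    (h3 : 3 ≤ k * propDeg P) (hL : ∀ v, (L v).encard = k)
    (hHK : ¬ Nonempty (Iso H (complete (k * propDeg P + 1)))) {U : Finset H.V}
    (hU : ∀ v ∈ U, H.deg v = k * propDeg P)
    (hsimple : ∀ e e', 2 ≤ #(part H U e) → part H U e = part H U e' → e = e') {β : ℝ}
    (hβ : ((k * propDeg P : ℕ) : ℝ) * β =
      ((k * propDeg P : ℕ) : ℝ) ^ 2 - ((k * propDeg P : ℕ) : ℝ) + 2)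
    {T : Finset H.V} (hTU : T ⊆ U)
    (hT : ∀ e, 2 ≤ #(part H U e) → (part H U e ∩ T).Nonempty → part H U e ⊆ T) :
    ∑ v ∈ T, (partDeg H U v : ℝ) ≤ β * #T := by
  have hfin := finite_palette hL
  have : Fintype (Palette L) := Fintype.ofFinite _
  have hLne : ∀ v, (L v).Nonempty := fun v => by
    rw [← Set.encard_pos, hL v]
    exact_mod_cast (by omega : 0 < k)
  induction T using Finset.strongInduction with
  | H T ih =>
    rcases T.eq_empty_or_nonempty with rfl | ⟨v₀, hv₀⟩
    · simp
    have hsub : ∀ e, part H T e ⊆ part H U e := fun e => filter_subset_filter _ hTU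
    have hpart : ∀ e, 2 ≤ #(part H U e) → (part H U e ∩ T).Nonempty →
        part H T e = part H U e := fun e h2 hn =>
      (hsub e).antisymm fun v hv => mem_part.mpr ⟨hT e h2 hn hv, (mem_part.mp hv).2⟩
    have hmeet : ∀ e, 2 ≤ #(part H T e) → 2 ≤ #(part H U e) ∧ (part H U e ∩ T).Nonempty := by
      intro e h2
      obtain ⟨v, hv⟩ := card_pos.mp (by omega : 0 < #(part H T e))
      exact ⟨h2.trans (card_le_card (hsub e)), v, mem_inter.mpr ⟨hsub e hv, (mem_part.mp hv).1⟩⟩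
    by_cases hconn : Conn (traceEdge H T) T
    · have hdegeq : ∀ v ∈ T, partDeg H T v = partDeg H U v := by
        intro v hv
        unfold partDeg
        refine congrArg card (filter_congr fun e _ => and_congr_right fun hve => ?_)
        refine ⟨fun h => (hmeet e h).1, fun h => ?_⟩
        rwa [hpart e h ⟨v, mem_inter.mpr ⟨mem_part.mpr ⟨hTU hv, hve⟩, hv⟩⟩]
      have hdegT : ∀ v ∈ T, degOn (traceEdge H T) T v = partDeg H U v := fun v hv => by
        rw [degOn_traceEdge T hv, hdegeq v hv]
      obtain ⟨cp, hcp⟩ := hLne v₀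
      have : Nonempty (Palette L) := ⟨⟨cp, v₀, hcp⟩⟩
      obtain ⟨ψ, hψL, hψ⟩ := hcrit.exists_coloring_off hP (hLne v₀) (K := (T : Set H.V)) hv₀
      have hF := not_colorable_capacity hP hcrit (K := T) hψL hψ
      have hinj : ∀ e e', traceEdge H T e ⊆ T → #(traceEdge H T e) = 2 →
          traceEdge H T e = traceEdge H T e' → e = e' := by
        intro e e' _ _ h
        have h1 := hmeet e.1 e.2
        have h2 := hmeet e'.1 e'.2
        refine Subtype.ext (hsimple _ _ h1.1 ?_)
        rw [← hpart _ h1.1 h1.2, ← hpart _ h2.1 h2.2]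
        exact h
      have hd : ∀ v ∈ T, degOn (traceEdge H T) T v ≤ ∑ c, capacity H L (propDeg P) T ψ c v := by
        intro v hv
        have h1 := le_sum_capacity (H := H) (K := T) (ψ := ψ) (r := propDeg P) (hL v)
        have h2 := deg_eq_add T v
        have h3 := hU v (hTU hv)
        rw [degOn_traceEdge T hv]
        omega
      have hδ : ∀ v ∈ T, degOn (traceEdge H T) T v ≤ k * propDeg P := by
        intro v hv
        have h2 := deg_eq_add T v
        have h3 := hU v (hTU hv)
        rw [degOn_traceEdge T hv]
        omega
      have hFr : ∀ c, ∀ v ∈ T, capacity H L (propDeg P) T ψ c v ≤ propDeg P := by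
        intro c v _
        unfold capacity
        split_ifs
        · exact Nat.sub_le _ _
        · exact Nat.zero_le _
      rcases potential_bound (T := ∅) (two_le_traceEdge H T) h3 (Nat.mul_le_mul_right _ hk) hconn
        hinj hd hF hFr hδ hβ (fun v _ h => absurd h (notMem_empty v)) with
        ⟨hbl, hG, hcomp, hcard⟩ | ⟨h, -⟩
      · exact absurd (hcrit.nonempty_iso_of_complete hP hadd hk hr hL hG hbl hcomp hcard
          fun v hv => hU v (hTU hv)) hHK
      · unfold potential at h
        simp only [notMem_empty, if_false] at h
        rw [sum_sub_distrib, sum_const, nsmul_eq_mul,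
          sum_congr rfl fun v hv => by rw [hdegT v hv]] at h
        linarith
    -- A disconnected set splits into two closed parts, over which the bound adds up.
    · have : ∃ X ⊆ T, X.Nonempty ∧ ClosedIn (traceEdge H T) T X ∧ X ≠ T := by
        by_contra! h
        exact hconn ⟨⟨v₀, hv₀⟩, h⟩
      obtain ⟨X, hXT, hXn, hcl, hne⟩ := this
      have hXcl : ∀ e, 2 ≤ #(part H U e) → (part H U e ∩ X).Nonempty → part H U e ⊆ X := by
        intro e h2 hn
        have hp := hpart e h2 (hn.mono (inter_subset_inter_left hXT))
        rw [← hp] at h2 hn ⊢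
        exact hcl ⟨e, h2⟩ (traceEdge_subset _ _ _) hn
      have hYcl : ∀ e, 2 ≤ #(part H U e) → (part H U e ∩ (T \ X)).Nonempty →
          part H U e ⊆ T \ X := by
        intro e h2 hn v hv
        refine mem_sdiff.mpr ⟨hT e h2 (hn.mono (inter_subset_inter_left sdiff_subset)) hv,
          fun hvX => ?_⟩
        obtain ⟨y, hy⟩ := hn
        rw [mem_inter, mem_sdiff] at hy
        exact hy.2.2 (hXcl e h2 ⟨v, mem_inter.mpr ⟨hv, hvX⟩⟩ hy.1)
      have h1 := ih X (hXT.ssubset_of_ne hne) (hXT.trans hTU) hXcl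
      have h2 := ih (T \ X) (sdiff_ssubset hXT hXn) (sdiff_subset.trans hTU) hYcl
      rw [← sum_sdiff hXT]
      have h4 : (#(T \ X) : ℝ) + #X = #T := by exact_mod_cast card_sdiff_add_card_eq_card hXT
      rw [← h4, mul_add]
      linarith

/-- Edges with only one vertex in `U` have another vertex outside `U`. -/
theorem sum_pendantDeg_le [Fintype H.V] (U : Finset H.V) :
    ∑ v ∈ U, pendantDeg H U v ≤ ∑ v ∈ univ \ U, H.deg v := by
  unfold pendantDeg
  rw [← card_biUnion]
  · simp only [deg_eq_card]
    refine le_trans (card_le_card fun e he => ?_) card_biUnion_le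
    obtain ⟨v, hv, he⟩ := mem_biUnion.mp he
    obtain ⟨-, hve, hsmall⟩ := mem_filter.mp he
    obtain ⟨u, hu, huv⟩ := exists_ne_mem_inc e v
    refine mem_biUnion.mpr ⟨u, mem_sdiff.mpr ⟨mem_univ _, fun huU => hsmall ?_⟩,
      mem_filter.mpr ⟨mem_univ _, hu⟩⟩
    exact one_lt_card.mpr ⟨u, mem_part.mpr ⟨huU, hu⟩, v, mem_part.mpr ⟨hv, hve⟩, huv⟩
  · intro v hv w hw hvw
    refine disjoint_left.mpr fun e he he' => ?_
    obtain ⟨-, hve, hsmall⟩ := mem_filter.mp he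
    obtain ⟨-, hwe, -⟩ := mem_filter.mp he'
    exact hsmall (one_lt_card.mpr
      ⟨v, mem_part.mpr ⟨hv, hve⟩, w, mem_part.mpr ⟨hw, hwe⟩, hvw⟩)

end

/-- Since `δ(2δ - β) = δ² + δ - 2`, adding `δ² + δ - 2` times the first bound to `δ` times the
second eliminates `x`; then `(δ² + δ - 2)(δ + 1) = δ(δ² + 2δ - 2) + (δ - 2)` gives the stated form.
-/
theorem gallaiBound_le {δ n : ℕ} (hδ : 3 ≤ δ) {x D β : ℝ}
    (hβ : (δ : ℝ) * β = (δ : ℝ) ^ 2 - δ + 2) (h₁ : ((δ : ℝ) + 1) * n - x ≤ D)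
    (h₂ : (2 * δ - β) * x ≤ D) : gallaiBound δ n ≤ D := by
  have hδR : (3 : ℝ) ≤ δ := by exact_mod_cast hδ
  have hq : (0 : ℝ) < (δ : ℝ) ^ 2 + 2 * δ - 2 := by nlinarith
  have hp : (0 : ℝ) ≤ (δ : ℝ) ^ 2 + δ - 2 := by nlinarith
  have h3 : ((δ : ℝ) ^ 2 + δ - 2) * x ≤ δ * D := by
    have := mul_le_mul_of_nonneg_left h₂ (by linarith : (0 : ℝ) ≤ δ)
    have e : (δ : ℝ) * ((2 * δ - β) * x) = (2 * δ ^ 2 - δ * β) * x := by ring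
    rw [e, hβ] at this
    linarith
  have h4 := mul_le_mul_of_nonneg_left h₁ hp
  unfold gallaiBound
  have e : (δ : ℝ) * n + ((δ : ℝ) - 2) / ((δ : ℝ) ^ 2 + 2 * δ - 2) * n =
      ((δ : ℝ) ^ 2 + δ - 2) * ((δ + 1) * n) / ((δ : ℝ) ^ 2 + 2 * δ - 2) := by
    rw [eq_div_iff hq.ne', add_mul, div_mul_eq_mul_div, div_mul_cancel₀ _ hq.ne']
    ring
  rw [e, div_le_iff₀ hq]
  linarith

end FinHypergraph

theorem corollary2p2 (P : FinHypergraph → Prop) (hsmooth : FinHypergraph.IsSmooth P)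
    (hadd : FinHypergraph.IsAdditive P) (r : ℕ) (hPr : FinHypergraph.propDeg P = r) (hr : 1 ≤ r)
    (k : ℕ) (hk : 2 ≤ k) (δ : ℕ) (hδ : δ = k * r) (hδ3 : 3 ≤ δ)
    (H : FinHypergraph) (hHK : ¬ Nonempty (FinHypergraph.Iso H (FinHypergraph.complete (δ + 1))))
    (hH : FinHypergraph.ChiLocallyLinear P H) (hχ : FinHypergraph.listChi P H = k + 1) :
    FinHypergraph.gallaiBound δ H.order ≤ (H.degSum : ℝ) := by
  classical
  obtain ⟨-, k', hk', C, L, hL, hcrit, hsimple⟩ := hH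
  obtain rfl : k = k' := by omega
  subst hPr hδ
  set δ := k * FinHypergraph.propDeg P with hδ
  have : Fintype H.V := Fintype.ofFinite _
  have : Fintype H.E := Fintype.ofFinite _
  set U : Finset H.V := {v | H.deg v = δ} with hU
  have hUlow : ∀ v, v ∈ FinHypergraph.lowVerts P H L ↔ v ∈ U := fun v => by
    rw [hU, Finset.mem_filter]
    simp only [FinHypergraph.lowVerts, Set.mem_ofPred_eq, hL v, Finset.mem_univ, true_and]
    rw [hδ, mul_comm k]
    norm_cast
  have hUeq : FinHypergraph.lowVerts P H L = (U : Set H.V) := Set.ext hUlow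
  rw [hUeq] at hsimple
  have hpart : ∀ e, (FinHypergraph.part H U e : Set H.V) = H.inc e ∩ U := fun e => by
    ext v
    rw [Finset.mem_coe, FinHypergraph.mem_part]
    exact and_comm
  have hinj : ∀ e e', 2 ≤ (FinHypergraph.part H U e).card →
      FinHypergraph.part H U e = FinHypergraph.part H U e' → e = e' := by
    intro e e' h2 h
    have hcard : ∀ e, (H.inc e ∩ (U : Set H.V)).ncard = (FinHypergraph.part H U e).card :=
      fun e => by rw [← hpart e, Set.ncard_coe_finset]
    have hs := @hsimple ⟨e, by rw [hcard]; exact h2⟩ ⟨e', by rw [hcard, ← h]; exact h2⟩ (by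
      ext v
      have hv : v.1 ∈ FinHypergraph.part H U e ↔ v.1 ∈ FinHypergraph.part H U e' := by rw [h]
      rw [FinHypergraph.mem_part, FinHypergraph.mem_part] at hv
      have hvU : v.1 ∈ U := v.2
      simp only [hvU, true_and] at hv
      exact hv)
    exact congrArg Subtype.val hs
  have hδR : (3 : ℝ) ≤ (δ : ℝ) := by exact_mod_cast hδ3
  obtain ⟨β, hβ⟩ : ∃ β : ℝ, (δ : ℝ) * β = (δ : ℝ) ^ 2 - δ + 2 :=
    ⟨((δ : ℝ) ^ 2 - δ + 2) / δ, mul_div_cancel₀ _ (by linarith)⟩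
  have hdegU : ∀ v ∈ U, H.deg v = δ := fun v hv => (Finset.mem_filter.mp hv).2
  have hsum := hcrit.sum_partDeg_le hsmooth hadd hk hr hδ3 hL hHK hdegU hinj hβ
    (Finset.Subset.refl U) fun e _ _ => Finset.filter_subset _ _
  have hpend := FinHypergraph.sum_pendantDeg_le (H := H) U
  have hD : H.degSum = ∑ v ∈ Finset.univ \ U, H.deg v + U.card * δ := by
    unfold FinHypergraph.degSum
    rw [finsum_eq_sum_of_fintype, ← Finset.sum_sdiff (Finset.subset_univ U),
      Finset.sum_congr (s₁ := U) rfl hdegU, Finset.sum_const, smul_eq_mul]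
  have hn : (Finset.univ \ U).card + U.card = H.order := by
    unfold FinHypergraph.order
    rw [Finset.card_sdiff_add_card_eq_card (Finset.subset_univ U), Nat.card_eq_fintype_card,
      Finset.card_univ]
  have hhigh : (Finset.univ \ U).card * (δ + 1) ≤ ∑ v ∈ Finset.univ \ U, H.deg v := by
    rw [← smul_eq_mul]
    refine Finset.card_nsmul_le_sum _ _ _ fun v hv => ?_
    have h1 := hcrit.le_deg hsmooth (by omega) hL v
    have h2 : H.deg v ≠ δ := fun h => by
      rw [Finset.mem_sdiff] at hv
      exact hv.2 (Finset.mem_filter.mpr ⟨Finset.mem_univ _, h⟩)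
    omega
  have hsplit : ∑ v ∈ U, FinHypergraph.partDeg H U v + ∑ v ∈ U, FinHypergraph.pendantDeg H U v =
      U.card * δ := by
    rw [← Finset.sum_add_distrib, Finset.sum_congr rfl fun v hv => by
      rw [← FinHypergraph.deg_eq_add, hdegU v hv], Finset.sum_const, smul_eq_mul]
  have hDR : (H.degSum : ℝ) = (∑ v ∈ Finset.univ \ U, H.deg v : ℕ) + U.card * δ := by
    exact_mod_cast hD
  have hnR : ((Finset.univ \ U).card : ℝ) + U.card = H.order := by exact_mod_cast hn
  have hhighR : ((Finset.univ \ U).card : ℝ) * (δ + 1) ≤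
      (∑ v ∈ Finset.univ \ U, H.deg v : ℕ) := by exact_mod_cast hhigh
  have hsplitR : ∑ v ∈ U, (FinHypergraph.partDeg H U v : ℝ) +
      (∑ v ∈ U, FinHypergraph.pendantDeg H U v : ℕ) = U.card * δ := by exact_mod_cast hsplit
  have hpendR : ((∑ v ∈ U, FinHypergraph.pendantDeg H U v : ℕ) : ℝ) ≤
      (∑ v ∈ Finset.univ \ U, H.deg v : ℕ) := by exact_mod_cast hpend
  -- The first bound gives degree `δ` to `U` and at least `δ + 1` to the rest; the second bounds the
  -- degree sum of the rest by the pendant edges, at least `(δ - β)|U|` in number.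
  refine FinHypergraph.gallaiBound_le hδ3 (x := U.card) hβ ?_ ?_
  · rw [hDR, ← hnR]
    linarith
  · rw [hDR]
    linarith
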